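/- **Definitions.** For a real matrix $A\in\mathbb{R}^{d\times n}$ write $\mathrm{nnz}(A)$ for its number of nonzero entries, $\Pi_A$ for the orthogonal projection onto the image of $A$, and $\kappa(A)$ for the ratio of the largest to the smallest nonzero singular value of $A$. Let $U(A,b)$ be the largest absolute value of an entry of $A$ or $b$. An instance $\mathrm{LEA}(A,b,\varepsilon)$ of the *linear equation approximation problem* consists of an integer matrix $A\in\mathbb{Z}^{d\times n}$, an integer vector $b\in\mathbb{Z}^d$ and a real $\varepsilon\in(0,1]$. A *solution* is a vector $x\in\mathbb{R}^n$ with $\|Ax-\Pi_A b\|_2\le\varepsilon\|\Pi_A b\|_2$. Let $\mathcal{G}$ be the class of nonempty integer matrices without all-zero rows and without all-zero columns. Let $\mathcal{B}_2$ be the class of matrices of the (unweighted) boundary operator $\partial_2$ of finite simplicial complexes of dimension $2$: the rows are indexed by all edges and the columns by all triangles of the complex, in any order and with any orientations, and $\partial_2[v_0,v_1,v_2]=[v_1,v_2]-[v_0,v_2]+[v_0,v_1]$. Algorithms are programs for a real RAM: exact unit-cost arithmetic and comparison of real numbers, and addition, truncated subtraction, comparison and indirect addressing with natural numbers. An instance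 is stored in sparse form: the dimensions, the list of the positions and values of the nonzero entries of $A$ in any order, the vector $b$, and $\varepsilon$. LEA over a matrix class $\mathcal{M}_1$ is *nearly-linear time reducible* to LEA over $\mathcal{M}_2$, written $\mathcal{M}_1\le_{nlt}\mathcal{M}_2$, if there are two algorithms and a constant $C$ such that for every instance $\mathrm{LEA}(M_1,c_1,\varepsilon_1)$ with $M_1\in\mathcal{M}_1$, setting $s=\mathrm{nnz}(M_1)$ and $P=\mathrm{nnz}(M_1)+\varepsilon_1^{-1}+\kappa(M_1)+U(M_1,c_1)$: 1. the first algorithm, on input $(M_1,c_1,\varepsilon_1)$, outputs an instance $\mathrm{LEA}(M_2,c_2,\varepsilon_2)$ with $M_2\in\mathcal{M}_2$; and the second algorithm, given the same input and any solution of $\mathrm{LEA}(M_2,c_2,\varepsilon_2)$, outputs a solution of $\mathrm{LEA}(M_1,c_1,\varepsilon_1)$; 2. both algorithms halt within $C\,s\,(\log P)^{C}$ steps, that is, in time $\tilde O(\mathrm{nnz}(M_1))$; 3. $\mathrm{nnz}(M_2)\le C\,s\,(\log P)^{C}$, that is, $\mathrm{nnz}(M_2)=\tilde O(\mathrm{nnz}(M_1))$,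 and $\varepsilon_2^{-1}$, $\kappa(M_2)$ and $U(M_2,c_2)$ are each at most $P^{C}$, that is, bounded by a polynomial in $\mathrm{nnz}(M_1)$, $\varepsilon_1^{-1}$, $\kappa(M_1)$ and $U(M_1,c_1)$. LEA over $\mathcal{M}$ is *sparse-linear-equation complete* if $\mathcal{G}\le_{nlt}\mathcal{M}$. **Theorem.** LEA over $\mathcal{B}_2$ is sparse-linear-equation complete. -/

import Mathlib

/-! ### Boundary matrices of simplicial complexes -/

/-- An oriented enumeration of the `k`-simplices of `K`: a list of `N` vertex orderings
(an ordering fixes an orientation) in which every `k`-simplex of `K` occurs exactly once. -/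
structure OrientedEnumeration {V : Type} [DecidableEq V] (K : PreAbstractSimplicialComplex V)
    (k N : ℕ) where
  vertex : Fin N → Fin (k + 1) → V
  injective_vertex : ∀ i, Function.Injective (vertex i)
  bijOn : Set.BijOn (fun i => Finset.univ.image (vertex i)) Set.univ
    {s : Finset V | s ∈ K.faces ∧ s.card = k + 1}

/-- The coefficient of the oriented `k`-simplex `τ` in the boundary
`∑ i, (-1) ^ i [σ 0, …, omit σ i, …, σ (k+1)]` of the oriented `(k+1)`-simplex `σ`.
Reordering the vertices of a simplex by a permutation multiplies it by the sign. -/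
def boundaryCoeff {V : Type} [DecidableEq V] {k : ℕ} (τ : Fin (k + 1) → V)
    (σ : Fin (k + 2) → V) : ℤ :=
  ∑ i : Fin (k + 2), (-1) ^ (i : ℕ) *
    ∑ π : Equiv.Perm (Fin (k + 1)),
      if σ ∘ i.succAbove ∘ π = τ then (Equiv.Perm.sign π : ℤ) else 0

/-- A class of integer matrices (of all sizes). -/
abbrev MatrixClass : Type := ∀ d n : ℕ, Matrix (Fin d) (Fin n) ℤ → Prop

/-- General matrices: nonempty integer matrices without all-0 rows and without all-0 columns. -/
def generalMatrices : MatrixClass := fun d _ A =>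
  0 < d ∧ (∀ i, ∃ j, A i j ≠ 0) ∧ (∀ j, ∃ i, A i j ≠ 0)

/-- Matrices of the boundary operator `∂₂` of finite simplicial complexes of dimension exactly 2,
with respect to some enumeration and orientation of all edges (rows) and all triangles (columns).
A finite complex can always be realized with vertices in `ℕ`. -/
def boundaryMatrices : MatrixClass := fun d n A =>
  ∃ K : PreAbstractSimplicialComplex ℕ,
    K.faces.Finite ∧ (∃ s ∈ K.faces, s.card = 3) ∧ (∀ s ∈ K.faces, s.card ≤ 3) ∧
    ∃ (edges : OrientedEnumeration K 1 d) (triangles : OrientedEnumeration K 2 n),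
      ∀ i j, A i j = boundaryCoeff (edges.vertex i) (triangles.vertex j)

/-! ### Linear equation approximation problems -/

/-- An instance of the linear equation approximation problem, with integer data and accuracy
parameter in `(0, 1]`. -/
structure LEAInstance where
  d : ℕ
  n : ℕ
  A : Matrix (Fin d) (Fin n) ℤ
  b : Fin d → ℤ
  ε : ℝ
  ε_pos : 0 < ε
  ε_le_one : ε ≤ 1

namespace LEAInstance

/-- The linear map `x ↦ A x` between Euclidean spaces. -/
noncomputable def linMap (I : LEAInstance) :
    EuclideanSpace ℝ (Fin I.n) →ₗ[ℝ] EuclideanSpace ℝ (Fin I.d) :=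
  Matrix.toEuclideanLin (I.A.map (Int.cast : ℤ → ℝ))

/-- The right-hand side as a real vector. -/
noncomputable def rhs (I : LEAInstance) : EuclideanSpace ℝ (Fin I.d) :=
  WithLp.toLp 2 (fun i => (I.b i : ℝ))

/-- The orthogonal projection of the right-hand side onto the image of `A`. -/
noncomputable def projRhs (I : LEAInstance) : EuclideanSpace ℝ (Fin I.d) :=
  (LinearMap.range I.linMap).starProjection I.rhs

/-- `x` solves the instance: `‖A x - Π_A b‖₂ ≤ ε ‖Π_A b‖₂`. -/
def IsSolution (I : LEAInstance) (x : EuclideanSpace ℝ (Fin I.n)) : Prop :=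
  ‖I.linMap x - I.projRhs‖ ≤ I.ε * ‖I.projRhs‖

/-- The positions of the nonzero entries. -/
def support (I : LEAInstance) : Finset (Fin I.d × Fin I.n) :=
  Finset.univ.filter fun p => I.A p.1 p.2 ≠ 0

/-- The number of nonzero entries of `A`. -/
def nnz (I : LEAInstance) : ℕ := I.support.card

/-- `U(A, b)`: the largest absolute value of an entry of `A` or `b`. -/
def entrySize (I : LEAInstance) : ℕ :=
  max (Finset.univ.sup fun p : Fin I.d × Fin I.n => (I.A p.1 p.2).natAbs)
    (Finset.univ.sup fun i => (I.b i).natAbs)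

/-- The ratio of the largest to the smallest nonzero singular value of `A`. -/
noncomputable def cond (I : LEAInstance) : ℝ :=
  sSup (Set.range I.linMap.singularValues) /
    sInf {t : ℝ | t ≠ 0 ∧ t ∈ Set.range I.linMap.singularValues}

/-- The sum of the four parameters `nnz(A)`, `ε⁻¹`, `κ(A)`, `U(A, b)`. Being bounded by a polynomial
in these parameters, which are at least 1 when `A ≠ 0`, is being bounded by a power of it. -/
noncomputable def param (I : LEAInstance) : ℝ :=
  I.nnz + I.ε⁻¹ + I.cond + I.entrySize

end LEAInstance

/-! ### The real RAM

Finitely many (those named in the program) unbounded arrays of natural numbers and of real numbers,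
indirect addressing, unit-cost exact arithmetic. There is no rounding of reals, and natural numbers
only have addition and truncated subtraction. -/

/-- A memory configuration: `nat a k` and `real a k` are the `k`-th cells of the `a`-th arrays. -/
structure RAMState where
  nat : ℕ → ℕ → ℕ
  real : ℕ → ℕ → ℝ

namespace RAMState

/-- Write to a cell of an array of natural numbers. -/
def setNat (s : RAMState) (a k v : ℕ) : RAMState :=
  { s with nat := Function.update s.nat a (Function.update (s.nat a) k v) }

/-- Write to a cell of an array of reals. -/
noncomputable def setReal (s : RAMState) (a k : ℕ) (v : ℝ) : RAMState :=
  { s with real := Function.update s.real a (Function.update (s.real a) k v) }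

/-- Load a vector into the `a`-th array of reals, with zeros behind it. -/
noncomputable def loadVector (s : RAMState) (a : ℕ) {n : ℕ} (y : EuclideanSpace ℝ (Fin n)) :
    RAMState :=
  { s with real := Function.update s.real a (fun k => if h : k < n then y ⟨k, h⟩ else 0) }

end RAMState

/-- Expressions with a value in `ℕ`; `read a i` is the cell of the array `a` at position `i`. -/
inductive NatExpr where
  | lit (k : ℕ)
  | read (a : ℕ) (i : NatExpr)
  | add (e f : NatExpr)
  | sub (e f : NatExpr)

namespace NatExpr

/-- The value of an expression. -/
def eval (s : RAMState) : NatExpr → ℕ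
  | lit k => k
  | read a i => s.nat a (i.eval s)
  | add e f => e.eval s + f.eval s
  | sub e f => e.eval s - f.eval s

/-- The number of operations needed to evaluate an expression. -/
def cost : NatExpr → ℕ
  | lit _ => 1
  | read _ i => i.cost + 1
  | add e f => e.cost + f.cost + 1
  | sub e f => e.cost + f.cost + 1

end NatExpr

/-- Expressions with a value in `ℝ`; `ofNat` converts a natural number. -/
inductive RealExpr where
  | ofNat (e : NatExpr)
  | read (a : ℕ) (i : NatExpr)
  | add (e f : RealExpr)
  | sub (e f : RealExpr)
  | mul (e f : RealExpr)
  | div (e f : RealExpr)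

namespace RealExpr

/-- The value of an expression (dividing by zero gives zero). -/
noncomputable def eval (s : RAMState) : RealExpr → ℝ
  | ofNat e => (e.eval s : ℝ)
  | read a i => s.real a (i.eval s)
  | add e f => e.eval s + f.eval s
  | sub e f => e.eval s - f.eval s
  | mul e f => e.eval s * f.eval s
  | div e f => e.eval s / f.eval s

/-- The number of operations needed to evaluate an expression. -/
def cost : RealExpr → ℕ
  | ofNat e => e.cost + 1
  | read _ i => i.cost + 1
  | add e f => e.cost + f.cost + 1
  | sub e f => e.cost + f.cost + 1
  | mul e f => e.cost + f.cost + 1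
  | div e f => e.cost + f.cost + 1

end RealExpr

/-- Tests: comparisons of numbers and their Boolean combinations. -/
inductive Test where
  | natLE (e f : NatExpr)
  | realLE (e f : RealExpr)
  | neg (c : Test)
  | conj (c c' : Test)

namespace Test

/-- The test succeeds. -/
def Holds (s : RAMState) : Test → Prop
  | natLE e f => e.eval s ≤ f.eval s
  | realLE e f => e.eval s ≤ f.eval s
  | neg c => ¬ c.Holds s
  | conj c c' => c.Holds s ∧ c'.Holds s

/-- The number of operations needed to evaluate a test. -/
def cost : Test → ℕ
  | natLE e f => e.cost + f.cost + 1
  | realLE e f => e.cost + f.cost + 1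
  | neg c => c.cost + 1
  | conj c c' => c.cost + c'.cost + 1

end Test

/-- Programs. `setNat a i e` and `setReal a i e` write the value of `e` to position `i` of the
array `a`. -/
inductive Program where
  | skip
  | setNat (a : ℕ) (i e : NatExpr)
  | setReal (a : ℕ) (i : NatExpr) (e : RealExpr)
  | seq (p q : Program)
  | ite (c : Test) (p q : Program)
  | loop (c : Test) (p : Program)

/-- `Runs p s s' t`: started in `s`, the program `p` halts in `s'` after exactly `t` operations.
`loop c p` repeats `p` as long as the test `c` succeeds. -/
inductive Runs : Program → RAMState → RAMState → ℕ → Prop where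
  | skip (s : RAMState) : Runs .skip s s 1
  | setNat (a : ℕ) (i e : NatExpr) (s : RAMState) :
      Runs (.setNat a i e) s (s.setNat a (i.eval s) (e.eval s)) (i.cost + e.cost + 1)
  | setReal (a : ℕ) (i : NatExpr) (e : RealExpr) (s : RAMState) :
      Runs (.setReal a i e) s (s.setReal a (i.eval s) (e.eval s)) (i.cost + e.cost + 1)
  | seq {p q : Program} {s s' s'' : RAMState} {t t' : ℕ} :
      Runs p s s' t → Runs q s' s'' t' → Runs (.seq p q) s s'' (t + t')
  | iteTrue {c : Test} {p q : Program} {s s' : RAMState} {t : ℕ} :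
      c.Holds s → Runs p s s' t → Runs (.ite c p q) s s' (c.cost + t + 1)
  | iteFalse {c : Test} {p q : Program} {s s' : RAMState} {t : ℕ} :
      ¬ c.Holds s → Runs q s s' t → Runs (.ite c p q) s s' (c.cost + t + 1)
  | loopDone {c : Test} {p : Program} {s : RAMState} :
      ¬ c.Holds s → Runs (.loop c p) s s (c.cost + 1)
  | loopStep {c : Test} {p : Program} {s s' s'' : RAMState} {t t' : ℕ} :
      c.Holds s → Runs p s s' t → Runs (.loop c p) s' s'' t' →
        Runs (.loop c p) s s'' (c.cost + t + t' + 1)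

/-! ### Instances in memory, and reductions -/

namespace LEAInstance

/-- The arrays `o, o + 1, o + 2` of naturals and of reals hold the instance `I` in sparse form:
the header `d, n, nnz(A)`; the row indices, the column indices and the values of the nonzero entries
of `A`, each of them once, in any order; the vector `b`; and `ε`. -/
def StoredAt (I : LEAInstance) (o : ℕ) (s : RAMState) : Prop :=
  s.nat o 0 = I.d ∧ s.nat o 1 = I.n ∧ s.nat o 2 = I.nnz ∧
  (∃ pos : Fin I.nnz → Fin I.d × Fin I.n,
    Set.BijOn pos Set.univ (I.support : Set (Fin I.d × Fin I.n)) ∧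
    ∀ k : Fin I.nnz,
      s.nat (o + 1) k = ((pos k).1 : ℕ) ∧ s.nat (o + 2) k = ((pos k).2 : ℕ) ∧
      s.real o k = (I.A (pos k).1 (pos k).2 : ℝ)) ∧
  (∀ i : Fin I.d, s.real (o + 1) i = (I.b i : ℝ)) ∧
  s.real (o + 2) 0 = I.ε

/-- The memory holds the instance `I` in the arrays `0, 1, 2` and zeros everywhere else. -/
def IsInput (I : LEAInstance) (s : RAMState) : Prop :=
  I.StoredAt 0 s ∧
  (∀ a k, (a = 0 ∧ 3 ≤ k) ∨ ((a = 1 ∨ a = 2) ∧ I.nnz ≤ k) ∨ 3 ≤ a → s.nat a k = 0) ∧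
  (∀ a k, (a = 0 ∧ I.nnz ≤ k) ∨ (a = 1 ∧ I.d ≤ k) ∨ (a = 2 ∧ 1 ≤ k) ∨ 3 ≤ a → s.real a k = 0)

end LEAInstance

/-- Nearly-linear time reducibility between the linear equation approximation problems over two
matrix classes. The program `enc` reads an instance `I` from the arrays `0, 1, 2` and writes an
instance `J` to the arrays `3, 4, 5`. The program `dec` gets the same memory as `enc`, together with
a solution of `J` in the array `6` of reals, and writes a solution of `I` to the array `7` of reals.
The programs and the constant `C` do not depend on the instance. -/
def NearlyLinearTimeReducible (M₁ M₂ : MatrixClass) : Prop :=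
  ∃ (enc dec : Program) (C : ℕ), ∀ I : LEAInstance, M₁ I.d I.n I.A →
    ∀ s : RAMState, I.IsInput s →
    ∃ J : LEAInstance, M₂ J.d J.n J.A ∧
      (∃ (s' : RAMState) (t : ℕ), Runs enc s s' t ∧ J.StoredAt 3 s' ∧
        (t : ℝ) ≤ C * I.nnz * Real.log I.param ^ C) ∧
      (∀ y : EuclideanSpace ℝ (Fin J.n), J.IsSolution y →
        ∃ (s' : RAMState) (t : ℕ) (x : EuclideanSpace ℝ (Fin I.n)),
          Runs dec (s.loadVector 6 y) s' t ∧ (∀ j : Fin I.n, s'.real 7 j = x j) ∧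
          I.IsSolution x ∧ (t : ℝ) ≤ C * I.nnz * Real.log I.param ^ C) ∧
      (J.nnz : ℝ) ≤ C * I.nnz * Real.log I.param ^ C ∧
      J.ε⁻¹ ≤ I.param ^ C ∧ J.cond ≤ I.param ^ C ∧ (J.entrySize : ℝ) ≤ I.param ^ C

/-- The linear equation approximation problem over `M` is sparse-linear-equation complete. -/
def SparseLinearEquationComplete (M : MatrixClass) : Prop :=
  NearlyLinearTimeReducible generalMatrices M

/-!
An integer matrix `A` is turned into a two-dimensional complex whose 2-chains with prescribed
boundary are the solutions of `A x = b`, written in binary.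

*The complex.* Every column `j` contributes a sphere, divided into lunes ("legs") between two poles,
one leg for each binary digit 1 of an entry of the column. The middle of every leg is removed. A
2-chain whose boundary vanishes inside the sphere is constant on it, and the constant is `x j`.
Every row `i` contributes rims (triangulated circles) `(0, i), …, (L, i)`, and a "doubling gadget"
between each rim and the next one: a cylinder that winds twice around the lower rim and once,
backwards, around the upper one. The hole of a leg for a digit `± 2 ^ l` in the row `i` is glued to
the rim `(l, i)`, with the orientation given by the sign. If `T l` is the value of a chain on the
gadget above the rim `(l, i)`, then the boundary equations of this rim say
`∑ ± x j + 2 * T l - T (l - 1) = if l = 0 then b i else 0`, and eliminating the `T l` leaves the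
equation of row `i` of `A x = b`. All entries of the boundary matrix are `0` or `± 1`, although the
encoded numbers are large; each row and each digit costs `O(L)` and `O(1)` triangles.

*Inconsistent systems.* If `A x = b` has no solution, then the optimal residual `r` of the boundary
problem is a cocycle. Its holonomy doubles from each rim to the next one, so that the combination of
its equations that eliminates the gadgets is a fixed multiple of the vector `h` of its holonomies
around the lowest rims (`Scaffold.IsCocycle.rowDefect_eq`). As the legs of a column bound, `h` is
orthogonal to the image of `A` (`Scaffold.IsCocycle.sum_loopSum_mul`). Hence an approximate solution
of the boundary problem gives an `x` with `A x + c * h` close to `b`, that is, `A x` close to the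
projection of `b` (`Scaffold.Model.norm_linMap_sub_projRhs_le`). The values of the chain on
different legs of a column differ by little more than a multiple of `‖r‖`, and `r` is exponentially
small: the only equations that have to be violated are those on the highest rims, where the error has
been halved `L` times (`Scaffold.Model.norm_residual`).

*Parameters.* The resulting error is relative to `‖b‖`. By integrality the projection of `b` is zero
or not much shorter than `b` (`LEAInstance.norm_rhs_le`); in the first case `0` is a solution, and
this case is recognized by `Aᵀ b = 0`. Thus a number of levels `L` of the order of the logarithm of
the size parameters suffices (`LEAInstance.isSolution_of_boundaryInstance`). The condition number is
bounded by controlling a chain by its boundary modulo the kernel of the boundary operator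
(`Scaffold.Model.cond_le`). Both translations are carried out by explicit programs for the real RAM
(`Sparse.encProg_spec`, `Sparse.decProg_spec`).
-/

/-! ### Boundary matrices from oriented edges and triangles -/

/-- The coefficient of an oriented edge in the boundary of an oriented triangle, as a sum over the
three sides of the triangle. -/
lemma boundaryCoeff_edge_triangle {V : Type} [DecidableEq V] (τ : Fin 2 → V) (σ : Fin 3 → V) :
    boundaryCoeff τ σ = ∑ s : Fin 3,
      ((if σ s = τ 0 ∧ σ (s + 1) = τ 1 then 1 else 0) -
        (if σ s = τ 1 ∧ σ (s + 1) = τ 0 then 1 else 0)) := by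
  have h2 : ∀ (F : Equiv.Perm (Fin 2) → ℤ), ∑ π, F π = F 1 + F (Equiv.swap 0 1) := by
    intro F
    have : (Finset.univ : Finset (Equiv.Perm (Fin 2))) = {1, Equiv.swap 0 1} := by decide
    rw [this, Finset.sum_insert (by decide), Finset.sum_singleton]
  have hs : ∀ (i : Fin 3) (π : Equiv.Perm (Fin 2)), (σ ∘ i.succAbove ∘ π = τ) ↔
      (σ (i.succAbove (π 0)) = τ 0 ∧ σ (i.succAbove (π 1)) = τ 1) := by
    intro i π
    rw [funext_iff, Fin.forall_fin_two]; rfl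
  refine (Fin.sum_univ_three _).trans ?_
  simp only [h2, hs, Fin.sum_univ_three, Equiv.Perm.sign_one,
    Equiv.Perm.sign_swap (show (0 : Fin 2) ≠ 1 by decide), Equiv.Perm.one_apply,
    Equiv.swap_apply_left, Equiv.swap_apply_right]
  have e00 : Fin.succAbove (0 : Fin 3) (0 : Fin 2) = 1 := by decide
  have e01 : Fin.succAbove (0 : Fin 3) (1 : Fin 2) = 2 := by decide
  have e10 : Fin.succAbove (1 : Fin 3) (0 : Fin 2) = 0 := by decide
  have e11 : Fin.succAbove (1 : Fin 3) (1 : Fin 2) = 2 := by decide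
  have e20 : Fin.succAbove (2 : Fin 3) (0 : Fin 2) = 0 := by decide
  have e21 : Fin.succAbove (2 : Fin 3) (1 : Fin 2) = 1 := by decide
  have a0 : (0 : Fin 3) + 1 = 1 := by decide
  have a1 : (1 : Fin 3) + 1 = 2 := by decide
  have a2 : (2 : Fin 3) + 1 = 0 := by decide
  simp only [e00, e01, e10, e11, e20, e21, a0, a1, a2, Fin.val_zero, Fin.val_one, Fin.val_two,
    pow_zero, pow_one, and_comm (a := σ 2 = _),
    and_comm (a := σ 1 = _) (b := σ 0 = _)]
  push_cast
  have neg_ite : ∀ (p : Prop) [Decidable p], (if p then (-1 : ℤ) else 0) =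
      -(if p then 1 else 0) := by
    intro p _; split_ifs <;> simp
  simp only [neg_ite]
  ring

/-- A two-dimensional simplicial complex given by lists `E` of oriented edges and `T` of oriented
triangles. The side of the triangle `t` from its vertex `s` to its vertex `s + 1` is the edge
`side t s`, traversed forwards or backwards according to the sign `sgn t s`. -/
structure OrientedComplex (V E T : Type) where
  ends : E → Fin 2 → V
  verts : T → Fin 3 → V
  side : T → Fin 3 → E
  sgn : T → Fin 3 → ℤ
  ends_ne : ∀ e, ends e 0 ≠ ends e 1
  ends_inj : ∀ e e', (ends e 0 = ends e' 0 ∧ ends e 1 = ends e' 1) ∨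
    (ends e 0 = ends e' 1 ∧ ends e 1 = ends e' 0) → e = e'
  verts_inj : ∀ t t', Set.range (verts t) = Set.range (verts t') → t = t'
  side_spec : ∀ t s,
    (sgn t s = 1 ∧ ends (side t s) 0 = verts t s ∧ ends (side t s) 1 = verts t (s + 1)) ∨
    (sgn t s = -1 ∧ ends (side t s) 1 = verts t s ∧ ends (side t s) 0 = verts t (s + 1))

namespace OrientedComplex

variable {V E T : Type} (X : OrientedComplex V E T)

/-- The incidence number of an edge and a triangle. -/
def incidence [DecidableEq E] (e : E) (t : T) : ℤ :=
  ∑ s : Fin 3, if X.side t s = e then X.sgn t s else 0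

lemma verts_ne (t : T) (s : Fin 3) : X.verts t s ≠ X.verts t (s + 1) := by
  have h0 := X.ends_ne (X.side t s)
  rcases X.side_spec t s with ⟨-, h1, h2⟩ | ⟨-, h1, h2⟩
  · rw [← h1, ← h2]; exact h0
  · rw [← h1, ← h2]; exact h0.symm

lemma verts_injective (t : T) : Function.Injective (X.verts t) := by
  have h0 := X.verts_ne t 0
  have h1 := X.verts_ne t 1
  have h2 := X.verts_ne t 2
  have a0 : (0 : Fin 3) + 1 = 1 := by decide
  have a1 : (1 : Fin 3) + 1 = 2 := by decide
  have a2 : (2 : Fin 3) + 1 = 0 := by decide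
  rw [a0] at h0; rw [a1] at h1; rw [a2] at h2
  intro i j hij
  fin_cases i <;> fin_cases j <;> simp_all

lemma ends_injective (e : E) : Function.Injective (X.ends e) := by
  intro i j hij
  have := X.ends_ne e
  fin_cases i <;> fin_cases j <;> simp_all

lemma sgn_eq (t : T) (s : Fin 3) : X.sgn t s = 1 ∨ X.sgn t s = -1 := by
  rcases X.side_spec t s with ⟨h, -⟩ | ⟨h, -⟩ <;> simp [h]

lemma side_injective (t : T) : Function.Injective (X.side t) := by
  have key : ∀ s, Set.range (X.ends (X.side t s)) = {X.verts t s, X.verts t (s + 1)} := by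
    intro s
    have hr : Set.range (X.ends (X.side t s)) =
        {X.ends (X.side t s) 0, X.ends (X.side t s) 1} := by
      ext v; simp [Fin.exists_fin_two, eq_comm]
    rw [hr]
    rcases X.side_spec t s with ⟨-, h1, h2⟩ | ⟨-, h1, h2⟩
    · rw [h1, h2]
    · rw [h1, h2, Set.pair_comm]
  intro s s' hss
  have h := (key s).symm.trans ((congrArg (fun e => Set.range (X.ends e)) hss).trans (key s'))
  have hi := X.verts_injective t
  rw [← Set.image_pair, ← Set.image_pair, Set.image_eq_image hi] at h
  have h3 : ({s, s + 1} : Finset (Fin 3)) = {s', s' + 1} := by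
    rw [← Finset.coe_inj]; simpa using h
  clear h hss
  revert s s'; decide

variable [DecidableEq V] [DecidableEq E]

/-- The finite sets of vertices below some edge or triangle. -/
def toComplex (φ : V → ℕ) : PreAbstractSimplicialComplex ℕ where
  faces := {s | s.Nonempty ∧ ((∃ e, s ⊆ Finset.univ.image (φ ∘ X.ends e)) ∨
    ∃ t, s ⊆ Finset.univ.image (φ ∘ X.verts t))}
  isRelLowerSet_faces := by
    intro s hs
    refine ⟨hs.1, fun t hts ht => ⟨ht, ?_⟩⟩
    rcases hs.2 with ⟨e, he⟩ | ⟨e, he⟩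
    · exact Or.inl ⟨e, hts.trans he⟩
    · exact Or.inr ⟨e, hts.trans he⟩

/-- Up to the enumeration of edges and triangles, the incidence numbers form a boundary matrix. -/
lemma boundaryMatrices_of_equiv [Countable V] {d n : ℕ} (eE : E ≃ Fin d) (eT : T ≃ Fin n)
    (t₀ : T) : boundaryMatrices d n fun i j => X.incidence (eE.symm i) (eT.symm j) := by
  obtain ⟨φ, hφ⟩ := exists_injective_nat V
  have hEc : ∀ e, (Finset.univ.image (φ ∘ X.ends e)).card = 2 := fun e => by
    rw [Finset.card_image_of_injective _ (hφ.comp (X.ends_injective e))]; simp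
  have hTc : ∀ t, (Finset.univ.image (φ ∘ X.verts t)).card = 3 := fun t => by
    rw [Finset.card_image_of_injective _ (hφ.comp (X.verts_injective t))]; simp
  have hEn : ∀ e, Finset.univ.image (φ ∘ X.ends e) = {φ (X.ends e 0), φ (X.ends e 1)} := by
    intro e; ext v; simp [Fin.exists_fin_two, eq_comm]
  have hsidesub : ∀ t s, Finset.univ.image (φ ∘ X.ends (X.side t s)) =
      {φ (X.verts t s), φ (X.verts t (s + 1))} := by
    intro t s
    rw [hEn]
    rcases X.side_spec t s with ⟨-, h1, h2⟩ | ⟨-, h1, h2⟩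
    · rw [h1, h2]
    · rw [h1, h2, Finset.pair_comm]
  -- a two-element subset of a triangle is one of its sides
  have hpair : ∀ t (u : Finset ℕ), u.card = 2 → u ⊆ Finset.univ.image (φ ∘ X.verts t) →
      ∃ s, u = Finset.univ.image (φ ∘ X.ends (X.side t s)) := by
    intro t u hu hut
    obtain ⟨w, hwu, rfl⟩ := Finset.subset_image_iff.1 hut
    rw [Finset.card_image_of_injective _ (hφ.comp (X.verts_injective t))] at hu
    have : ∀ w : Finset (Fin 3), w.card = 2 → ∃ s, w = {s, s + 1} := by decide
    obtain ⟨s, rfl⟩ := this w hu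
    refine ⟨s, ?_⟩
    rw [hsidesub, Finset.image_insert, Finset.image_singleton]; rfl
  refine ⟨X.toComplex φ, ?_, ?_, ?_, ?_, ?_, ?_⟩
  · have hE : Finite E := Finite.of_equiv _ eE.symm
    have hT : Finite T := Finite.of_equiv _ eT.symm
    refine Set.Finite.subset (s := (⋃ e, {s : Finset ℕ | s ⊆ Finset.univ.image (φ ∘ X.ends e)}) ∪
      ⋃ t, {s : Finset ℕ | s ⊆ Finset.univ.image (φ ∘ X.verts t)}) ?_ ?_
    · refine Set.Finite.union (Set.finite_iUnion fun e => ?_) (Set.finite_iUnion fun e => ?_)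
      · exact (Finset.finite_toSet (Finset.univ.image (φ ∘ X.ends e)).powerset).subset
          (fun s hs => Finset.mem_coe.2 (Finset.mem_powerset.2 hs))
      · exact (Finset.finite_toSet (Finset.univ.image (φ ∘ X.verts e)).powerset).subset
          (fun s hs => Finset.mem_coe.2 (Finset.mem_powerset.2 hs))
    · rintro s ⟨-, ⟨e, he⟩ | ⟨e, he⟩⟩
      · exact Or.inl (Set.mem_iUnion.2 ⟨e, he⟩)
      · exact Or.inr (Set.mem_iUnion.2 ⟨e, he⟩)
  · exact ⟨_, ⟨by simp, Or.inr ⟨t₀, subset_rfl⟩⟩, hTc t₀⟩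
  · rintro s ⟨-, ⟨e, he⟩ | ⟨e, he⟩⟩
    · exact (Finset.card_le_card he).trans (by rw [hEc]; norm_num)
    · exact (Finset.card_le_card he).trans (by rw [hTc])
  · refine ⟨fun i k => φ (X.ends (eE.symm i) k), fun i => hφ.comp (X.ends_injective _), ?_, ?_, ?_⟩
    · intro i _
      exact ⟨⟨by simp, Or.inl ⟨eE.symm i, subset_rfl⟩⟩, hEc _⟩
    · intro i _ j _ hij
      have h : ({φ (X.ends (eE.symm i) 0), φ (X.ends (eE.symm i) 1)} : Finset ℕ) =
          {φ (X.ends (eE.symm j) 0), φ (X.ends (eE.symm j) 1)} := by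
        rw [← hEn, ← hEn]; exact hij
      have h' : s(φ (X.ends (eE.symm i) 0), φ (X.ends (eE.symm i) 1)) =
          s(φ (X.ends (eE.symm j) 0), φ (X.ends (eE.symm j) 1)) := by
        have h2 := congrArg (fun s : Finset ℕ => (s : Set ℕ)) h
        simp only [Finset.coe_insert, Finset.coe_singleton] at h2
        apply SetLike.coe_injective
        simpa using h2
      rw [Sym2.eq_iff] at h'
      apply eE.symm.injective
      apply X.ends_inj
      simpa [hφ.eq_iff] using h'
    · rintro s ⟨⟨hs, ⟨e, he⟩ | ⟨t, ht⟩⟩, hc⟩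
      · refine ⟨eE e, trivial, ?_⟩
        simp only [Equiv.symm_apply_apply]
        exact (Finset.eq_of_subset_of_card_le he (by rw [hEc, hc])).symm
      · obtain ⟨k, hk⟩ := hpair t s hc ht
        refine ⟨eE (X.side t k), trivial, ?_⟩
        simp only [Equiv.symm_apply_apply]
        exact hk.symm
  · refine ⟨fun i k => φ (X.verts (eT.symm i) k), fun i => hφ.comp (X.verts_injective _),
      ?_, ?_, ?_⟩
    · intro i _
      exact ⟨⟨by simp, Or.inr ⟨eT.symm i, subset_rfl⟩⟩, hTc _⟩
    · intro i _ j _ hij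
      apply eT.symm.injective
      apply X.verts_inj
      have h2 := congrArg (fun s : Finset ℕ => (s : Set ℕ)) hij
      simp only [Finset.coe_image, Finset.coe_univ, Set.image_univ] at h2
      change Set.range (φ ∘ X.verts (eT.symm i)) = Set.range (φ ∘ X.verts (eT.symm j)) at h2
      rw [Set.range_comp, Set.range_comp] at h2
      exact (Set.image_injective.2 hφ) h2
    · rintro s ⟨⟨hs, ⟨e, he⟩ | ⟨t, ht⟩⟩, hc⟩
      · have := Finset.card_le_card he
        rw [hEc, hc] at this
        omega
      · refine ⟨eT t, trivial, ?_⟩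
        simp only [Equiv.symm_apply_apply]
        exact (Finset.eq_of_subset_of_card_le ht (by rw [hTc, hc])).symm
  · intro i j
    rw [boundaryCoeff_edge_triangle]
    refine Finset.sum_congr rfl fun s _ => ?_
    simp only [hφ.eq_iff]
    set t := eT.symm j
    set e := eE.symm i
    by_cases hse : X.side t s = e
    · have hne := X.verts_ne t s
      rcases X.side_spec t s with ⟨h, h1, h2⟩ | ⟨h, h1, h2⟩
      · rw [hse] at h1 h2
        simp [hse, h, h1, h2, hne]
      · rw [hse] at h1 h2
        simp [hse, h, h1, h2, hne]
    · have n1 : ¬ (X.verts t s = X.ends e 0 ∧ X.verts t (s + 1) = X.ends e 1) := by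
        rintro ⟨g1, g2⟩
        apply hse
        apply X.ends_inj
        rcases X.side_spec t s with ⟨h, h1, h2⟩ | ⟨h, h1, h2⟩
        · exact Or.inl ⟨h1.trans g1, h2.trans g2⟩
        · exact Or.inr ⟨h2.trans g2, h1.trans g1⟩
      have n2 : ¬ (X.verts t s = X.ends e 1 ∧ X.verts t (s + 1) = X.ends e 0) := by
        rintro ⟨g1, g2⟩
        apply hse
        apply X.ends_inj
        rcases X.side_spec t s with ⟨h, h1, h2⟩ | ⟨h, h1, h2⟩
        · exact Or.inr ⟨h1.trans g1, h2.trans g2⟩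
        · exact Or.inl ⟨h2.trans g2, h1.trans g1⟩
      simp [hse, n1, n2]

end OrientedComplex

/-! ### The complex of a scaffold -/

/-- Combinatorial data encoding a sparse integer matrix with `d` rows and `n` columns in binary.
Leg `k` stands for one binary digit of an entry in column `col k` and row `(loop k).2`; the digit
has weight `2 ^ (loop k).1`, counted negatively if `flip k`. The map `next` arranges the legs of
each column in a ring, and `rep j` is some leg of column `j`. No leg is attached to a rim of the highest
level `L`. -/
structure Scaffold (d n L N : ℕ) where
  loop : Fin N → Fin (L + 1) × Fin d
  flip : Fin N → Bool
  col : Fin N → Fin n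
  next : Fin N → Fin N
  rep : Fin n → Fin N
  next_injective : Function.Injective next
  col_next : ∀ k, col (next k) = col k
  col_rep : ∀ j, col (rep j) = j
  reach : ∀ k, ∃ m ≤ N, next^[m] k = rep (col k)
  level_lt : ∀ k, ((loop k).1 : ℕ) < L

namespace Scaffold

/-- The vertices: two poles, three vertices on each rim, four inner vertices in each leg. -/
abbrev Vertex (d L N : ℕ) : Type :=
  Bool ⊕ ((Fin (L + 1) × Fin d) × Fin 3) ⊕ (Fin N × Fin 4)

/-- The edges: three on each rim, nine in each doubling gadget, eighteen in each leg. -/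
abbrev Edge (d L N : ℕ) : Type :=
  ((Fin (L + 1) × Fin d) × Fin 3) ⊕ ((Fin L × Fin d) × Fin 9) ⊕ (Fin N × Fin 18)

/-- The triangles: nine in each doubling gadget, thirteen in each leg. -/
abbrev Tri (d L N : ℕ) : Type :=
  ((Fin L × Fin d) × Fin 9) ⊕ (Fin N × Fin 13)

/-- The rim around which a doubling gadget winds twice. -/
def lower {d L : ℕ} (g : Fin L × Fin d) : Fin (L + 1) × Fin d := (g.1.castSucc, g.2)

/-- The rim around which a doubling gadget winds once, backwards. -/
def upper {d L : ℕ} (g : Fin L × Fin d) : Fin (L + 1) × Fin d := (g.1.succ, g.2)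

lemma lower_injective {d L : ℕ} : Function.Injective (lower (d := d) (L := L)) := by
  rintro ⟨a, b⟩ ⟨a', b'⟩ h
  simpa [lower] using h

lemma upper_injective {d L : ℕ} : Function.Injective (upper (d := d) (L := L)) := by
  rintro ⟨a, b⟩ ⟨a', b'⟩ h
  simpa [upper] using h

lemma lower_ne_upper {d L : ℕ} (g : Fin L × Fin d) : lower g ≠ upper g := by
  intro h
  have := congrArg (fun x : Fin (L + 1) × Fin d => (x.1 : ℕ)) h
  simp [lower, upper] at this

/-- The vertices of a doubling gadget are written `0, 1, 2` (lower rim) and `3, 4, 5`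
(upper rim). -/
def gadgetVert : Fin 9 → Fin 3 → Fin 6 :=
  ![![0, 1, 3], ![1, 2, 3], ![3, 2, 4], ![2, 0, 4], ![0, 1, 4], ![4, 1, 5], ![1, 2, 5], ![2, 0, 5],
    ![5, 0, 3]]

/-- The ends of the cross edges of a doubling gadget. The edge `e` separates the triangles `e` and
`e + 1`. -/
def gadgetEnds : Fin 9 → Fin 2 → Fin 6 :=
  ![![1, 3], ![2, 3], ![2, 4], ![0, 4], ![1, 4], ![1, 5], ![2, 5], ![0, 5], ![0, 3]]

/-- The sides of the triangles of a doubling gadget: edges of the lower rim, cross edges, edges of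
the upper rim. -/
def gadgetSide : Fin 9 → Fin 3 → Fin 3 ⊕ Fin 9 ⊕ Fin 3 :=
  ![![.inl 0, .inr (.inl 0), .inr (.inl 8)],
    ![.inl 1, .inr (.inl 1), .inr (.inl 0)],
    ![.inr (.inl 1), .inr (.inl 2), .inr (.inr 0)],
    ![.inl 2, .inr (.inl 3), .inr (.inl 2)],
    ![.inl 0, .inr (.inl 4), .inr (.inl 3)],
    ![.inr (.inl 4), .inr (.inl 5), .inr (.inr 1)],
    ![.inl 1, .inr (.inl 6), .inr (.inl 5)],
    ![.inl 2, .inr (.inl 7), .inr (.inl 6)],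
    ![.inr (.inl 7), .inr (.inl 8), .inr (.inr 2)]]

/-- The signs of the sides of the triangles of a doubling gadget. -/
def gadgetSgn : Fin 9 → Fin 3 → ℤ :=
  ![![1, 1, -1], ![1, 1, -1], ![-1, 1, -1], ![1, 1, -1], ![1, 1, -1], ![-1, 1, -1], ![1, 1, -1],
    ![1, 1, -1], ![-1, 1, -1]]

/-- The vertices of the triangles of a leg: a lune between two poles, bounded by the paths from pole
to pole over the last inner vertices of this leg and of the next one, with a hole. The symbols are
`0, 1, 2` for the rim, `3, 4` for the poles, `5, 6, 7, 8` for the four inner vertices and `9` for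
the last inner vertex of the next leg. The triangles `0, …, 5` form a collar between the rim and the
hole. -/
def legVert : Fin 13 → Fin 3 → Fin 10 :=
  ![![0, 1, 5], ![5, 1, 6], ![1, 2, 6], ![6, 2, 7], ![2, 0, 7], ![7, 0, 5], ![8, 5, 3], ![3, 5, 6],
    ![3, 6, 9], ![9, 6, 4], ![4, 6, 7], ![4, 7, 8], ![8, 7, 5]]

/-- The ends of the edges of a leg; the edges `16` and `17` are shared with the previous leg. -/
def legEnds : Fin 18 → Fin 2 → Fin 10 :=
  ![![0, 5], ![1, 5], ![1, 6], ![2, 6], ![2, 7], ![0, 7], ![5, 6], ![6, 7], ![7, 5], ![8, 5],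
    ![3, 5], ![3, 6], ![9, 6], ![4, 6], ![4, 7], ![8, 7], ![3, 8], ![4, 8]]

/-- The sides of the triangles of a leg: edges of the rim, of the leg, of the next leg. -/
def legSide : Fin 13 → Fin 3 → Fin 3 ⊕ Fin 18 ⊕ Fin 18 :=
  ![![.inl 0, .inr (.inl 1), .inr (.inl 0)],
    ![.inr (.inl 1), .inr (.inl 2), .inr (.inl 6)],
    ![.inl 1, .inr (.inl 3), .inr (.inl 2)],
    ![.inr (.inl 3), .inr (.inl 4), .inr (.inl 7)],
    ![.inl 2, .inr (.inl 5), .inr (.inl 4)],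
    ![.inr (.inl 5), .inr (.inl 0), .inr (.inl 8)],
    ![.inr (.inl 9), .inr (.inl 10), .inr (.inl 16)],
    ![.inr (.inl 10), .inr (.inl 6), .inr (.inl 11)],
    ![.inr (.inl 11), .inr (.inl 12), .inr (.inr 16)],
    ![.inr (.inl 12), .inr (.inl 13), .inr (.inr 17)],
    ![.inr (.inl 13), .inr (.inl 7), .inr (.inl 14)],
    ![.inr (.inl 14), .inr (.inl 15), .inr (.inl 17)],
    ![.inr (.inl 15), .inr (.inl 8), .inr (.inl 9)]]

/-- The signs of the sides of the triangles of an unflipped leg. -/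
def legSgn : Fin 13 → Fin 3 → ℤ :=
  ![![1, 1, -1], ![-1, 1, -1], ![1, 1, -1], ![-1, 1, -1], ![1, 1, -1], ![-1, 1, -1], ![1, -1, 1],
    ![1, 1, -1], ![1, -1, -1], ![1, -1, 1], ![1, 1, -1], ![1, -1, -1], ![1, 1, -1]]

variable {d n L N : ℕ} (S : Scaffold d n L N)

/-- The vertex of the complex denoted by a symbol in a doubling gadget. -/
def gadgetSym (N : ℕ) (g : Fin L × Fin d) : Fin 6 → Vertex d L N :=
  ![.inr (.inl (lower g, 0)), .inr (.inl (lower g, 1)), .inr (.inl (lower g, 2)),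
    .inr (.inl (upper g, 0)), .inr (.inl (upper g, 1)), .inr (.inl (upper g, 2))]

/-- The `i`-th vertex met when walking around the rim in the direction of a leg. -/
def turn (b : Bool) (i : Fin 3) : Fin 3 := if b then -i else i

/-- The edge of the rim from the `i`-th to the next vertex met in the direction of a leg. -/
def turnEdge (b : Bool) (i : Fin 3) : Fin 3 := if b then i.rev else i

/-- The sign of a leg. -/
def sg (k : Fin N) : ℤ := if S.flip k then -1 else 1

/-- The vertex of the complex denoted by a symbol in a leg. -/
def legSym (k : Fin N) : Fin 10 → Vertex d L N :=
  ![.inr (.inl (S.loop k, turn (S.flip k) 0)), .inr (.inl (S.loop k, turn (S.flip k) 1)),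
    .inr (.inl (S.loop k, turn (S.flip k) 2)), .inl false, .inl true,
    .inr (.inr (k, 0)), .inr (.inr (k, 1)), .inr (.inr (k, 2)), .inr (.inr (k, 3)),
    .inr (.inr (S.next k, 3))]

/-- The ends of the edges of the complex. -/
def ends : Edge d L N → Fin 2 → Vertex d L N
  | .inl (ρ, j) => ![.inr (.inl (ρ, j)), .inr (.inl (ρ, j + 1))]
  | .inr (.inl (g, e)) => fun i => gadgetSym N g (gadgetEnds e i)
  | .inr (.inr (k, e)) => fun i => S.legSym k (legEnds e i)

/-- The vertices of the triangles of the complex. -/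
def verts : Tri d L N → Fin 3 → Vertex d L N
  | .inl (g, τ) => fun i => gadgetSym N g (gadgetVert τ i)
  | .inr (k, τ) => fun i => S.legSym k (legVert τ i)

/-- The edge denoted by a symbol in a doubling gadget. -/
def gadgetEdge (N : ℕ) (g : Fin L × Fin d) : Fin 3 ⊕ Fin 9 ⊕ Fin 3 → Edge d L N
  | .inl j => .inl (lower g, j)
  | .inr (.inl e) => .inr (.inl (g, e))
  | .inr (.inr j) => .inl (upper g, j)

/-- The edge denoted by a symbol in a leg. -/
def legEdge (k : Fin N) : Fin 3 ⊕ Fin 18 ⊕ Fin 18 → Edge d L N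
  | .inl j => .inl (S.loop k, turnEdge (S.flip k) j)
  | .inr (.inl e) => .inr (.inr (k, e))
  | .inr (.inr e) => .inr (.inr (S.next k, e))

/-- The sides of the triangles of the complex. -/
def side : Tri d L N → Fin 3 → Edge d L N
  | .inl (g, τ) => fun s => gadgetEdge N g (gadgetSide τ s)
  | .inr (k, τ) => fun s => S.legEdge k (legSide τ s)

/-- The signs of the sides of the triangles of the complex. -/
def sgn : Tri d L N → Fin 3 → ℤ
  | .inl (_, τ) => fun s => gadgetSgn τ s
  | .inr (k, τ) => fun s => if (legSide τ s).isLeft then S.sg k else legSgn τ s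

lemma gadget_side_lower : ∀ (τ : Fin 9) (s j : Fin 3), gadgetSide τ s = .inl j →
    gadgetSgn τ s = 1 ∧ (gadgetVert τ s : ℕ) = j ∧
      (gadgetVert τ (s + 1) : ℕ) = ((j + 1 : Fin 3) : ℕ) := by
  decide +kernel

lemma gadget_side_cross : ∀ (τ : Fin 9) (s : Fin 3) (e : Fin 9), gadgetSide τ s = .inr (.inl e) →
    (gadgetSgn τ s = 1 ∧ gadgetEnds e 0 = gadgetVert τ s ∧
      gadgetEnds e 1 = gadgetVert τ (s + 1)) ∨
    (gadgetSgn τ s = -1 ∧ gadgetEnds e 1 = gadgetVert τ s ∧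
      gadgetEnds e 0 = gadgetVert τ (s + 1)) := by
  decide +kernel

lemma gadget_side_upper : ∀ (τ : Fin 9) (s j : Fin 3), gadgetSide τ s = .inr (.inr j) →
    gadgetSgn τ s = -1 ∧ (gadgetVert τ (s + 1) : ℕ) = 3 + j ∧
      (gadgetVert τ s : ℕ) = 3 + ((j + 1 : Fin 3) : ℕ) := by
  decide +kernel

lemma leg_side_rim : ∀ (τ : Fin 13) (s j : Fin 3), legSide τ s = .inl j →
    (legVert τ s : ℕ) = j ∧ (legVert τ (s + 1) : ℕ) = ((j + 1 : Fin 3) : ℕ) := by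
  decide +kernel

lemma leg_side_own : ∀ (τ : Fin 13) (s : Fin 3) (e : Fin 18), legSide τ s = .inr (.inl e) →
    (legSgn τ s = 1 ∧ legEnds e 0 = legVert τ s ∧ legEnds e 1 = legVert τ (s + 1)) ∨
    (legSgn τ s = -1 ∧ legEnds e 1 = legVert τ s ∧ legEnds e 0 = legVert τ (s + 1)) := by
  decide +kernel

lemma leg_side_next : ∀ (τ : Fin 13) (s : Fin 3) (e : Fin 18), legSide τ s = .inr (.inr e) →
    legEnds e 1 = 8 ∧ (legEnds e 0 = 3 ∨ legEnds e 0 = 4) ∧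
    ((legSgn τ s = 1 ∧ legEnds e 0 = legVert τ s ∧ legVert τ (s + 1) = 9) ∨
      (legSgn τ s = -1 ∧ legVert τ s = 9 ∧ legEnds e 0 = legVert τ (s + 1))) := by
  decide +kernel

lemma gadgetSym_lower (g : Fin L × Fin d) (x : Fin 6) (j : Fin 3) (h : (x : ℕ) = j) :
    gadgetSym N g x = .inr (.inl (lower g, j)) := by
  have : x = j.castLE (by norm_num) := Fin.ext h
  subst this
  fin_cases j <;> rfl

lemma gadgetSym_upper (g : Fin L × Fin d) (x : Fin 6) (j : Fin 3) (h : (x : ℕ) = 3 + j) :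
    gadgetSym N g x = .inr (.inl (upper g, j)) := by
  have : x = j.natAdd 3 := Fin.ext h
  subst this
  fin_cases j <;> rfl

lemma legSym_rim (k : Fin N) (x : Fin 10) (j : Fin 3) (h : (x : ℕ) = j) :
    S.legSym k x = .inr (.inl (S.loop k, turn (S.flip k) j)) := by
  have : x = j.castLE (by norm_num) := Fin.ext h
  subst this
  fin_cases j <;> rfl

lemma side_spec (t : Tri d L N) (s : Fin 3) :
    (S.sgn t s = 1 ∧ S.ends (S.side t s) 0 = S.verts t s ∧
      S.ends (S.side t s) 1 = S.verts t (s + 1)) ∨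
    (S.sgn t s = -1 ∧ S.ends (S.side t s) 1 = S.verts t s ∧
      S.ends (S.side t s) 0 = S.verts t (s + 1)) := by
  rcases t with ⟨g, τ⟩ | ⟨k, τ⟩
  · simp only [side, sgn, verts]
    rcases hs : gadgetSide τ s with j | e | j <;> simp only [gadgetEdge, ends]
    · obtain ⟨h0, h1, h2⟩ := gadget_side_lower τ s j hs
      rw [gadgetSym_lower g _ j h1, gadgetSym_lower g _ _ h2]
      exact Or.inl ⟨h0, by simp, by simp⟩
    · rcases gadget_side_cross τ s e hs with ⟨h0, h1, h2⟩ | ⟨h0, h1, h2⟩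
      · exact Or.inl ⟨h0, by rw [h1], by rw [h2]⟩
      · exact Or.inr ⟨h0, by rw [h1], by rw [h2]⟩
    · obtain ⟨h0, h1, h2⟩ := gadget_side_upper τ s j hs
      rw [gadgetSym_upper g _ j h1, gadgetSym_upper g _ _ h2]
      exact Or.inr ⟨h0, by simp, by simp⟩
  · simp only [side, sgn, verts]
    rcases hs : legSide τ s with j | e | e <;>
      simp only [legEdge, ends, Sum.isLeft_inl, Sum.isLeft_inr, if_true, sg]
    · obtain ⟨h1, h2⟩ := leg_side_rim τ s j hs
      rw [S.legSym_rim k _ j h1, S.legSym_rim k _ _ h2]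
      cases S.flip k
      · left; simp [turn, turnEdge]
      · have : ∀ j : Fin 3, j.rev + 1 = -j ∧ j.rev = -(j + 1) := by decide
        right; simp [turn, turnEdge, (this j).1, ← (this j).2]
    · rcases leg_side_own τ s e hs with ⟨h0, h1, h2⟩ | ⟨h0, h1, h2⟩
      · exact Or.inl ⟨h0, by rw [h1], by rw [h2]⟩
      · exact Or.inr ⟨h0, by rw [h1], by rw [h2]⟩
    · obtain ⟨h1, h2, h3⟩ := leg_side_next τ s e hs
      have e1 : S.legSym (S.next k) (legEnds e 1) = S.legSym k 9 := by
        rw [h1]; simp [legSym]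
      have e0 : S.legSym (S.next k) (legEnds e 0) = S.legSym k (legEnds e 0) := by
        rcases h2 with h2 | h2 <;> rw [h2] <;> simp [legSym]
      rcases h3 with ⟨g0, g1, g2⟩ | ⟨g0, g1, g2⟩
      · exact Or.inl ⟨g0, by rw [e0, g1], by rw [e1, g2]⟩
      · exact Or.inr ⟨g0, by rw [e1, g1], by rw [e0, g2]⟩

/-- Reads off the symbol of a vertex of the gadget `g`. -/
def gadgetRead (g : Fin L × Fin d) : Vertex d L N → Fin 6
  | .inr (.inl (ρ, j)) => if ρ = lower g then j.castLE (by norm_num) else Fin.natAdd 3 j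
  | _ => 0

lemma gadgetRead_sym (g : Fin L × Fin d) (x : Fin 6) : gadgetRead g (gadgetSym N g x) = x := by
  have := (lower_ne_upper g).symm
  fin_cases x <;> simp [gadgetRead, gadgetSym, this]

/-- Identifies the symbols `8` and `9`, which denote the same vertex if the leg is its own
successor. -/
def collapse : Fin 10 → Fin 9 := ![0, 1, 2, 3, 4, 5, 6, 7, 8, 8]

/-- Reads off the symbol of a vertex of the leg `k`. -/
def legRead (k : Fin N) : Vertex d L N → Fin 9
  | .inr (.inl (_, j)) => (turn (S.flip k) j).castLE (by norm_num)
  | .inr (.inr (_, x)) => x.natAdd 5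
  | .inl b => if b then 4 else 3

lemma legRead_sym (k : Fin N) (x : Fin 10) : S.legRead k (S.legSym k x) = collapse x := by
  have h : ∀ b (j : Fin 3), turn b (turn b j) = j := by decide
  fin_cases x <;> simp [legRead, legSym, collapse, h]

/-- The symbols denoting the inner vertices of a leg that are not shared with other legs. -/
def IsCore (x : Fin 10) : Prop := x = 5 ∨ x = 6 ∨ x = 7

instance : DecidablePred IsCore := fun x => by unfold IsCore; infer_instance

lemma legSym_core {k k' : Fin N} {x y : Fin 10} (hx : IsCore x)
    (h : S.legSym k x = S.legSym k' y) : k = k' := by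
  rcases hx with rfl | rfl | rfl <;> fin_cases y <;> simp_all [legSym]

lemma gadget_eq_of_range {m m' : ℕ} {f : Fin m → Fin 6} {f' : Fin m' → Fin 6}
    {g g' : Fin L × Fin d} (hl : ∃ i, (f i : ℕ) < 3) (hl' : ∃ i, (f' i : ℕ) < 3)
    (h : Set.range (fun i => gadgetSym N g (f i)) = Set.range (fun i => gadgetSym N g' (f' i))) :
    g = g' := by
  have key : ∀ {m m' : ℕ} {f : Fin m → Fin 6} {f' : Fin m' → Fin 6}
    {g g' : Fin L × Fin d} (_ : ∃ i, (f i : ℕ) < 3)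
    (_ : Set.range (fun i => gadgetSym N g (f i)) ⊆ Set.range (fun i => gadgetSym N g' (f' i))),
      lower g = lower g' ∨ lower g = upper g' := by
    intro m m' f f' g g' ⟨i, hi⟩ h
    obtain ⟨i', hi'⟩ := h ⟨i, rfl⟩
    simp only at hi'
    rw [gadgetSym_lower g (f i) ⟨f i, hi⟩ rfl] at hi'
    by_cases hf : (f' i' : ℕ) < 3
    · rw [gadgetSym_lower g' (f' i') ⟨f' i', hf⟩ rfl] at hi'
      simp only [Sum.inr.injEq, Sum.inl.injEq, Prod.mk.injEq] at hi'
      exact Or.inl hi'.1.symm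
    · rw [gadgetSym_upper g' (f' i') ⟨f' i' - 3, by omega⟩ (by simp; omega)] at hi'
      simp only [Sum.inr.injEq, Sum.inl.injEq, Prod.mk.injEq] at hi'
      exact Or.inr hi'.1.symm
  rcases key hl h.le with h1 | h1
  · exact lower_injective h1
  · rcases key hl' h.ge with h2 | h2
    · exact lower_injective h2.symm
    · exfalso
      have e1 := congrArg (fun x : Fin (L + 1) × Fin d => (x.1 : ℕ)) h1
      have e2 := congrArg (fun x : Fin (L + 1) × Fin d => (x.1 : ℕ)) h2
      simp [lower, upper] at e1 e2
      omega

lemma leg_eq_of_range {m m' : ℕ} {f : Fin m → Fin 10} {f' : Fin m' → Fin 10} {k k' : Fin N}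
    (hc : ∃ i, IsCore (f i))
    (h : Set.range (fun i => S.legSym k (f i)) = Set.range (fun i => S.legSym k' (f' i))) :
    k = k' := by
  obtain ⟨i, hi⟩ := hc
  obtain ⟨i', hi'⟩ := h.le ⟨i, rfl⟩
  exact S.legSym_core hi hi'.symm

lemma gadgetSym_isRim (g : Fin L × Fin d) (x : Fin 6) :
    ∃ ρ j, gadgetSym N g x = .inr (.inl (ρ, j)) := by
  fin_cases x <;> simp [gadgetSym]

lemma image_eq_of_range {m q : ℕ} {V : Type} {f f' : Fin m → V} (r : V → Fin q)
    (h : Set.range f = Set.range f') :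
    Finset.univ.image (fun i => r (f i)) = Finset.univ.image (fun i => r (f' i)) := by
  rw [← Finset.coe_inj, Finset.coe_image, Finset.coe_image, Finset.coe_univ, Set.image_univ,
    Set.image_univ]
  exact (Set.range_comp r f).trans ((congrArg _ h).trans (Set.range_comp r f').symm)

lemma ends_eq_of_range {e e' : Edge d L N} (h : Set.range (S.ends e) = Set.range (S.ends e')) :
    e = e' := by
  have inner : ∀ (k : Fin N) (e : Fin 18), ∃ i x, S.legSym k (legEnds e i) = .inr (.inr (k, x)) ∨
      S.legSym k (legEnds e i) = .inr (.inr (S.next k, x)) := by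
    intro k e
    have : ∀ e : Fin 18, ∃ i, legEnds e i = 5 ∨ legEnds e i = 6 ∨ legEnds e i = 7 ∨
      legEnds e i = 8 := by decide
    obtain ⟨i, hi | hi | hi | hi⟩ := this e
    · exact ⟨i, 0, Or.inl (by rw [hi]; rfl)⟩
    · exact ⟨i, 1, Or.inl (by rw [hi]; rfl)⟩
    · exact ⟨i, 2, Or.inl (by rw [hi]; rfl)⟩
    · exact ⟨i, 3, Or.inl (by rw [hi]; rfl)⟩
  -- edges of rims and gadgets have no inner vertex
  have rimOnly : ∀ (ρ : Fin (L + 1) × Fin d) (j : Fin 3) (i : Fin 2),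
      ∃ ρ' j', S.ends (.inl (ρ, j)) i = .inr (.inl (ρ', j')) := by
    intro ρ j i
    fin_cases i
    · exact ⟨ρ, j, rfl⟩
    · exact ⟨ρ, j + 1, rfl⟩
  have leg_ne : ∀ (k : Fin N) (e : Fin 18) (e' : Edge d L N),
      (∀ i, ∃ ρ j, S.ends e' i = .inr (.inl (ρ, j))) →
      Set.range (S.ends (.inr (.inr (k, e)))) ≠ Set.range (S.ends e') := by
    intro k e e' he' h
    obtain ⟨i, x, hi⟩ := inner k e
    obtain ⟨i', hi'⟩ := h.le ⟨i, rfl⟩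
    obtain ⟨ρ, j, hj⟩ := he' i'
    rw [hj] at hi'
    change _ = S.legSym k (legEnds e i) at hi'
    rcases hi with hi | hi <;> rw [hi] at hi' <;> simp at hi'
  -- an edge of a gadget joins two different rims
  have rim_ne : ∀ (ρ : Fin (L + 1) × Fin d) (j : Fin 3) (g : Fin L × Fin d) (e : Fin 9),
      Set.range (S.ends (.inl (ρ, j))) ≠ Set.range (S.ends (.inr (.inl (g, e)))) := by
    intro ρ j g e h
    have rim : ∀ i, ∃ j', S.ends (.inl (ρ, j)) i = .inr (.inl (ρ, j')) := by
      intro i; fin_cases i <;> simp [ends]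
    have hE : ∀ e : Fin 9, (gadgetEnds e 0 : ℕ) < 3 ∧ 3 ≤ (gadgetEnds e 1 : ℕ) := by decide
    obtain ⟨i0, h0⟩ := h.ge ⟨0, rfl⟩
    obtain ⟨i1, h1⟩ := h.ge ⟨1, rfl⟩
    obtain ⟨j0, r0⟩ := rim i0
    obtain ⟨j1, r1⟩ := rim i1
    rw [r0] at h0; rw [r1] at h1
    change _ = gadgetSym N g (gadgetEnds e 0) at h0
    change _ = gadgetSym N g (gadgetEnds e 1) at h1
    rw [gadgetSym_lower g _ ⟨_, (hE e).1⟩ rfl] at h0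
    rw [gadgetSym_upper g _ ⟨(gadgetEnds e 1 : ℕ) - 3, by omega⟩
      (by have := (hE e).2; simp; omega)] at h1
    simp only [Sum.inr.injEq, Sum.inl.injEq, Prod.mk.injEq] at h0 h1
    exact lower_ne_upper g (h0.1.symm.trans h1.1)
  rcases e with ⟨ρ, j⟩ | ⟨g, e⟩ | ⟨k, e⟩ <;> rcases e' with ⟨ρ', j'⟩ | ⟨g', e'⟩ | ⟨k', e'⟩
  · have hr : ∀ (ρ : Fin (L + 1) × Fin d) (j : Fin 3), Set.range (S.ends (.inl (ρ, j))) =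
        {.inr (.inl (ρ, j)), .inr (.inl (ρ, j + 1))} := by
      intro ρ j; ext v; simp [ends, or_comm]
    rw [hr, hr] at h
    have hρ : ρ = ρ' := by
      have : (Sum.inr (Sum.inl (ρ, j)) : Vertex d L N) ∈
          ({.inr (.inl (ρ', j')), .inr (.inl (ρ', j' + 1))} : Set (Vertex d L N)) := by
        rw [← h]; simp
      simp only [Set.mem_insert_iff, Set.mem_singleton_iff, Sum.inr.injEq, Sum.inl.injEq,
        Prod.mk.injEq] at this
      tauto
    subst hρ
    have hi : Function.Injective (fun j : Fin 3 => (Sum.inr (Sum.inl (ρ, j)) : Vertex d L N)) := by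
      intro a b hab; simpa using hab
    have h2 : ({j, j + 1} : Set (Fin 3)) = {j', j' + 1} := by
      apply Set.image_injective.2 hi
      simpa [Set.image_pair] using h
    have h3 : ({j, j + 1} : Finset (Fin 3)) = {j', j' + 1} := by
      rw [← Finset.coe_inj]; simpa using h2
    have : ∀ j j' : Fin 3, ({j, j + 1} : Finset (Fin 3)) = {j', j' + 1} → j = j' := by decide
    rw [this j j' h3]
  · exact absurd h (rim_ne _ _ _ _)
  · exact absurd h.symm (leg_ne _ _ _ (rimOnly _ _))
  · exact absurd h.symm (rim_ne _ _ _ _)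
  · have hE : ∀ e : Fin 9, ∃ i, (gadgetEnds e i : ℕ) < 3 := by decide
    obtain rfl : g = g' := gadget_eq_of_range (hE e) (hE e') h
    have h2 := image_eq_of_range (gadgetRead g) h
    simp only [ends, gadgetRead_sym] at h2
    have : ∀ e e' : Fin 9, Finset.univ.image (fun i => gadgetEnds e i) =
      Finset.univ.image (fun i => gadgetEnds e' i) → e = e' := by decide
    rw [this e e' h2]
  · exact absurd h.symm (leg_ne _ _ _ fun i => gadgetSym_isRim _ _)
  · exact absurd h (leg_ne _ _ _ (rimOnly _ _))
  · exact absurd h (leg_ne _ _ _ fun i => gadgetSym_isRim _ _)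
  · have hk : k = k' := by
      have hE : ∀ e : Fin 18, (∃ i, IsCore (legEnds e i)) ∨
        (legEnds e 1 = 8 ∧ ((legEnds e 0 = 3) ∨ legEnds e 0 = 4)) := by decide
      rcases hE e with hc | ⟨h1, h0⟩
      · exact S.leg_eq_of_range hc h
      rcases hE e' with hc | ⟨h1', h0'⟩
      · exact (S.leg_eq_of_range hc h.symm).symm
      obtain ⟨i, hi⟩ := h.le ⟨1, rfl⟩
      change S.legSym k' (legEnds e' i) = S.legSym k (legEnds e 1) at hi
      rw [h1] at hi
      obtain rfl | rfl : i = 0 ∨ i = 1 := by omega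
      · rcases h0' with h0' | h0' <;> rw [h0'] at hi <;> simp [legSym] at hi
      · rw [h1'] at hi
        simp only [legSym] at hi
        exact (Prod.mk.inj (Sum.inr.inj (Sum.inr.inj hi))).1.symm
    subst hk
    have h2 := image_eq_of_range (S.legRead k) h
    simp only [ends, legRead_sym] at h2
    have : ∀ e e' : Fin 18, Finset.univ.image (fun i => collapse (legEnds e i)) =
      Finset.univ.image (fun i => collapse (legEnds e' i)) → e = e' := by decide +kernel
    rw [this e e' h2]

lemma verts_eq_of_range {t t' : Tri d L N} (h : Set.range (S.verts t) = Set.range (S.verts t')) :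
    t = t' := by
  have hC : ∀ τ : Fin 13, ∃ i, IsCore (legVert τ i) := by decide
  have ne : ∀ (k : Fin N) (τ : Fin 13) (g : Fin L × Fin d) (τ' : Fin 9),
      Set.range (S.verts (.inr (k, τ))) ≠ Set.range (S.verts (.inl (g, τ'))) := by
    intro k τ g τ' h
    obtain ⟨i, hi⟩ := hC τ
    obtain ⟨i', hi'⟩ := h.le ⟨i, rfl⟩
    obtain ⟨ρ, j, hρ⟩ := gadgetSym_isRim (N := N) g (gadgetVert τ' i')
    change gadgetSym N g (gadgetVert τ' i') = S.legSym k (legVert τ i) at hi'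
    rw [hρ] at hi'
    rcases hi with hi | hi | hi <;> rw [hi] at hi' <;> simp [legSym] at hi'
  rcases t with ⟨g, τ⟩ | ⟨k, τ⟩ <;> rcases t' with ⟨g', τ'⟩ | ⟨k', τ'⟩
  · have hE : ∀ e : Fin 9, ∃ i, (gadgetVert e i : ℕ) < 3 := by decide
    obtain rfl : g = g' := gadget_eq_of_range (hE τ) (hE τ') h
    have h2 := image_eq_of_range (gadgetRead g) h
    simp only [verts, gadgetRead_sym] at h2
    have : ∀ e e' : Fin 9, Finset.univ.image (fun i => gadgetVert e i) =
      Finset.univ.image (fun i => gadgetVert e' i) → e = e' := by decide +kernel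
    rw [this τ τ' h2]
  · exact absurd h.symm (ne _ _ _ _)
  · exact absurd h (ne _ _ _ _)
  · obtain rfl : k = k' := S.leg_eq_of_range (hC τ) h
    have h2 := image_eq_of_range (S.legRead k) h
    simp only [verts, legRead_sym] at h2
    have : ∀ e e' : Fin 13, Finset.univ.image (fun i => collapse (legVert e i)) =
      Finset.univ.image (fun i => collapse (legVert e' i)) → e = e' := by decide +kernel
    rw [this τ τ' h2]

/-- The two-dimensional complex of a scaffold. Every leg is a disc attached along a rim, with a hole
cut out so that the legs of a column, glued along the poles, form a sphere with one hole for each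
leg. Doubling gadgets connect consecutive levels of rims. -/
def complex : OrientedComplex (Vertex d L N) (Edge d L N) (Tri d L N) where
  ends := S.ends
  verts := S.verts
  side := S.side
  sgn := S.sgn
  ends_ne := by
    intro e h
    rcases e with ⟨ρ, j⟩ | ⟨g, e⟩ | ⟨k, e⟩
    · simp [ends] at h
    · have := congrArg (gadgetRead g) h
      simp only [ends, gadgetRead_sym] at this
      clear h
      revert this; revert e; decide
    · have := congrArg (S.legRead k) h
      simp only [ends, legRead_sym] at this
      clear h
      revert this; revert e; decide
  ends_inj := by
    intro e e' h
    apply S.ends_eq_of_range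
    ext v
    simp only [Set.mem_range, Fin.exists_fin_two]
    rcases h with ⟨h1, h2⟩ | ⟨h1, h2⟩ <;> rw [h1, h2]
    exact or_comm
  verts_inj := fun t t' => S.verts_eq_of_range
  side_spec := S.side_spec

end Scaffold

/-! ### The boundary operator of a scaffold -/

namespace Scaffold

/-- How often the triangle `τ` of a gadget traverses the edge `j` of the lower rim. -/
def lowerCoef (j : Fin 3) (τ : Fin 9) : ℤ :=
  ∑ s, if gadgetSide τ s = .inl j then gadgetSgn τ s else 0

/-- How often the triangle `τ` of a gadget traverses the edge `j` of the upper rim. -/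
def upperCoef (j : Fin 3) (τ : Fin 9) : ℤ :=
  ∑ s, if gadgetSide τ s = .inr (.inr j) then gadgetSgn τ s else 0

/-- How often the triangle `τ` of a gadget traverses the cross edge `e`. -/
def crossCoef (e τ : Fin 9) : ℤ :=
  ∑ s, if gadgetSide τ s = .inr (.inl e) then gadgetSgn τ s else 0

/-- How often the triangle `τ` of a leg traverses the edge `j` of its rim. -/
def rimCoef (j : Fin 3) (τ : Fin 13) : ℤ := ∑ s, if legSide τ s = .inl j then 1 else 0

/-- How often the triangle `τ` of a leg traverses the edge `e` of the leg. -/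
def ownCoef (e : Fin 18) (τ : Fin 13) : ℤ :=
  ∑ s, if legSide τ s = .inr (.inl e) then legSgn τ s else 0

/-- How often the triangle `τ` of a leg traverses the edge `e` of the next leg. -/
def nextCoef (e : Fin 18) (τ : Fin 13) : ℤ :=
  ∑ s, if legSide τ s = .inr (.inr e) then legSgn τ s else 0

lemma upperCoef_eq : ∀ j τ, upperCoef j τ = if τ = ![2, 5, 8] j then -1 else 0 := by
  decide +kernel

lemma crossCoef_eq : ∀ e τ, crossCoef e τ =
    (if τ = e then 1 else 0) - (if τ = e + 1 then 1 else 0) := by decide +kernel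

lemma rimCoef_eq : ∀ j τ, rimCoef j τ = if τ = ![0, 2, 4] j then 1 else 0 := by decide +kernel

/-- The triangle of a leg that traverses the edge `e` of the leg forwards. -/
def forward : Fin 18 → Fin 13 := ![5, 0, 1, 2, 3, 4, 7, 10, 12, 6, 7, 8, 9, 10, 11, 12, 6, 9]

/-- The triangle of a leg that traverses the edge `e` of the leg backwards. -/
def backward : Fin 18 → Fin 13 := ![0, 1, 2, 3, 4, 5, 1, 3, 5, 12, 6, 7, 8, 9, 10, 11, 8, 11]

lemma ownCoef_eq : ∀ e τ, ownCoef e τ = (if e ≠ 17 ∧ τ = forward e then 1 else 0) -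
    (if e ≠ 16 ∧ τ = backward e then 1 else 0) := by decide +kernel

lemma nextCoef_eq : ∀ e τ, nextCoef e τ = (if e = 17 ∧ τ = forward e then 1 else 0) -
    (if e = 16 ∧ τ = backward e then 1 else 0) := by decide +kernel

lemma turnEdge_eq_iff (b : Bool) (i j : Fin 3) : turnEdge b i = j ↔ i = turnEdge b j := by
  revert b i j; decide

variable {d n L N : ℕ} (S : Scaffold d n L N)

lemma incidence_gadget (e : Edge d L N) (g : Fin L × Fin d) (τ : Fin 9) :
    S.complex.incidence e (.inl (g, τ)) =
      ∑ s, if gadgetEdge N g (gadgetSide τ s) = e then gadgetSgn τ s else 0 := rfl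

lemma incidence_leg (e : Edge d L N) (k : Fin N) (τ : Fin 13) :
    S.complex.incidence e (.inr (k, τ)) = ∑ s, if S.legEdge k (legSide τ s) = e then
      (if (legSide τ s).isLeft then S.sg k else legSgn τ s) else 0 := rfl

lemma incidence_rim_gadget (ρ : Fin (L + 1) × Fin d) (j : Fin 3) (g : Fin L × Fin d) (τ : Fin 9) :
    S.complex.incidence (.inl (ρ, j)) (.inl (g, τ)) =
      (if lower g = ρ then lowerCoef j τ else 0) + (if upper g = ρ then upperCoef j τ else 0) := by
  have hne := lower_ne_upper g
  simp only [incidence_gadget, lowerCoef, upperCoef]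
  by_cases h1 : lower g = ρ
  · have h2 : upper g ≠ ρ := fun h => hne (h1.trans h.symm)
    rw [if_pos h1, if_neg h2, add_zero]
    refine Finset.sum_congr rfl fun s _ => ?_
    rcases gadgetSide τ s with i | e | i <;> simp [gadgetEdge, h1, h2]
  · rw [if_neg h1, zero_add]
    by_cases h2 : upper g = ρ
    · rw [if_pos h2]
      refine Finset.sum_congr rfl fun s _ => ?_
      rcases gadgetSide τ s with i | e | i <;> simp [gadgetEdge, h1, h2]
    · rw [if_neg h2]
      refine Finset.sum_eq_zero fun s _ => ?_
      rcases gadgetSide τ s with i | e | i <;> simp [gadgetEdge, h1, h2]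

lemma incidence_rim_leg (ρ : Fin (L + 1) × Fin d) (j : Fin 3) (k : Fin N) (τ : Fin 13) :
    S.complex.incidence (.inl (ρ, j)) (.inr (k, τ)) =
      if S.loop k = ρ then S.sg k * rimCoef (turnEdge (S.flip k) j) τ else 0 := by
  simp only [incidence_leg, rimCoef]
  split_ifs with h
  · rw [Finset.mul_sum]
    refine Finset.sum_congr rfl fun s _ => ?_
    rcases legSide τ s with i | e | i <;> simp [legEdge, h, turnEdge_eq_iff]
  · refine Finset.sum_eq_zero fun s _ => ?_
    rcases legSide τ s with i | e | i <;> simp [legEdge, h]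

lemma incidence_cross_gadget (g : Fin L × Fin d) (e : Fin 9) (g' : Fin L × Fin d) (τ : Fin 9) :
    S.complex.incidence (.inr (.inl (g, e))) (.inl (g', τ)) =
      if g' = g then crossCoef e τ else 0 := by
  simp only [incidence_gadget, crossCoef]
  split_ifs with h
  · refine Finset.sum_congr rfl fun s _ => ?_
    rcases gadgetSide τ s with i | e | i <;> simp [gadgetEdge, h]
  · refine Finset.sum_eq_zero fun s _ => ?_
    rcases gadgetSide τ s with i | e | i <;> simp [gadgetEdge, h]

lemma incidence_cross_leg (g : Fin L × Fin d) (e : Fin 9) (k : Fin N) (τ : Fin 13) :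
    S.complex.incidence (.inr (.inl (g, e))) (.inr (k, τ)) = 0 := by
  simp only [incidence_leg]
  refine Finset.sum_eq_zero fun s _ => ?_
  rcases legSide τ s with i | e | i <;> simp [legEdge]

lemma incidence_own_gadget (k : Fin N) (e : Fin 18) (g : Fin L × Fin d) (τ : Fin 9) :
    S.complex.incidence (.inr (.inr (k, e))) (.inl (g, τ)) = 0 := by
  simp only [incidence_gadget]
  refine Finset.sum_eq_zero fun s _ => ?_
  rcases gadgetSide τ s with i | e | i <;> simp [gadgetEdge]

lemma incidence_own_leg (k : Fin N) (e : Fin 18) (k' : Fin N) (τ : Fin 13) :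
    S.complex.incidence (.inr (.inr (k, e))) (.inr (k', τ)) =
      (if k' = k then ownCoef e τ else 0) + (if S.next k' = k then nextCoef e τ else 0) := by
  simp only [incidence_leg, ownCoef, nextCoef]
  have : ∀ (p : Prop) [Decidable p] (F : Fin 3 → ℤ),
      (if p then ∑ s, F s else 0) = ∑ s, if p then F s else 0 := by
    intro p _ F; split_ifs <;> simp
  rw [this, this, ← Finset.sum_add_distrib]
  refine Finset.sum_congr rfl fun s _ => ?_
  rcases legSide τ s with i | e | i <;> simp [legEdge, ite_and]

/-- The boundary operator with real coefficients. -/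
noncomputable def bd (f : Tri d L N → ℝ) (e : Edge d L N) : ℝ :=
  ∑ t, (S.complex.incidence e t : ℝ) * f t

lemma bd_sub (f g : Tri d L N → ℝ) (e : Edge d L N) :
    S.bd (fun t => f t - g t) e = S.bd f e - S.bd g e := by
  simp only [bd, mul_sub, Finset.sum_sub_distrib]

/-- The boundary operator and the coboundary operator are adjoint. -/
lemma sum_mul_bd (r : Edge d L N → ℝ) (f : Tri d L N → ℝ) :
    ∑ e, r e * S.bd f e = ∑ t, f t * ∑ s, (S.sgn t s : ℝ) * r (S.side t s) := by
  simp only [bd, Finset.mul_sum]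
  rw [Finset.sum_comm]
  refine Finset.sum_congr rfl fun t _ => ?_
  have : ∀ e, r e * ((S.complex.incidence e t : ℝ) * f t) =
      ∑ s, if S.side t s = e then f t * ((S.sgn t s : ℝ) * r e) else 0 := by
    intro e
    have h : (S.complex.incidence e t : ℝ) =
        ∑ s, if S.side t s = e then (S.sgn t s : ℝ) else 0 := by
      change ((∑ s, if S.side t s = e then S.sgn t s else 0 : ℤ) : ℝ) = _
      push_cast
      rfl
    rw [h, Finset.sum_mul, Finset.mul_sum]
    refine Finset.sum_congr rfl fun s _ => ?_
    split_ifs <;> ring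
  simp only [this]
  rw [Finset.sum_comm]
  refine Finset.sum_congr rfl fun s _ => ?_
  simp

/-- The boundary operator as a sum over gadgets and legs. -/
lemma bd_eq (f : Tri d L N → ℝ) (e : Edge d L N) :
    S.bd f e = ∑ g, ∑ τ, (S.complex.incidence e (.inl (g, τ)) : ℝ) * f (.inl (g, τ)) +
      ∑ k, ∑ τ, (S.complex.incidence e (.inr (k, τ)) : ℝ) * f (.inr (k, τ)) := by
  rw [bd, Fintype.sum_sum_type, Fintype.sum_prod_type (γ := ℝ) (α₁ := Fin L × Fin d),
    Fintype.sum_prod_type (γ := ℝ) (α₁ := Fin N)]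

lemma bd_cross (f : Tri d L N → ℝ) (g : Fin L × Fin d) (e : Fin 9) :
    S.bd f (.inr (.inl (g, e))) = f (.inl (g, e)) - f (.inl (g, e + 1)) := by
  rw [bd_eq]
  simp only [incidence_cross_leg, incidence_cross_gadget]
  simp only [Int.cast_zero, zero_mul, Finset.sum_const_zero, add_zero]
  rw [Finset.sum_eq_single g (by intro b _ hb; simp [hb]) (by simp)]
  simp [crossCoef_eq, sub_mul, Finset.sum_sub_distrib]

lemma sum_ownCoef_mul (F : Fin 13 → ℝ) (e : Fin 18) : ∑ τ, (ownCoef e τ : ℝ) * F τ =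
    (if e ≠ 17 then F (forward e) else 0) - (if e ≠ 16 then F (backward e) else 0) := by
  simp [ownCoef_eq, sub_mul, Finset.sum_sub_distrib, ite_and, -ne_eq]

lemma sum_nextCoef_mul (F : Fin 13 → ℝ) (e : Fin 18) : ∑ τ, (nextCoef e τ : ℝ) * F τ =
    (if e = 17 then F (forward e) else 0) - (if e = 16 then F (backward e) else 0) := by
  simp [nextCoef_eq, sub_mul, Finset.sum_sub_distrib, ite_and]

lemma bd_own (f : Tri d L N → ℝ) (k : Fin N) (e : Fin 18) :
    S.bd f (.inr (.inr (k, e))) =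
      ((if e ≠ 17 then f (.inr (k, forward e)) else 0) -
        (if e ≠ 16 then f (.inr (k, backward e)) else 0)) +
      ∑ k', if S.next k' = k then ((if e = 17 then f (.inr (k', forward e)) else 0) -
        (if e = 16 then f (.inr (k', backward e)) else 0)) else 0 := by
  rw [bd_eq]
  simp only [incidence_own_leg, incidence_own_gadget]
  simp only [Int.cast_zero, zero_mul, Finset.sum_const_zero, zero_add, Int.cast_add, add_mul,
    Finset.sum_add_distrib]
  congr 1
  · rw [Finset.sum_eq_single k (by intro b _ hb; simp [hb]) (by simp)]
    simpa using sum_ownCoef_mul (fun τ => f (.inr (k, τ))) e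
  · refine Finset.sum_congr rfl fun k' _ => ?_
    by_cases hk : S.next k' = k
    · simpa [hk] using sum_nextCoef_mul (fun τ => f (.inr (k', τ))) e
    · simp [hk]

lemma bd_own_of_ne (f : Tri d L N → ℝ) (k : Fin N) (e : Fin 18) (h16 : e ≠ 16) (h17 : e ≠ 17) :
    S.bd f (.inr (.inr (k, e))) = f (.inr (k, forward e)) - f (.inr (k, backward e)) := by
  simp [bd_own, h16, h17]

lemma bd_own_next (f : Tri d L N → ℝ) (k : Fin N) (e : Fin 18) (h : e = 16 ∨ e = 17) :
    S.bd f (.inr (.inr (S.next k, e))) =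
      if e = 16 then f (.inr (S.next k, 6)) - f (.inr (k, 8))
      else f (.inr (k, 9)) - f (.inr (S.next k, 11)) := by
  rw [bd_own, Finset.sum_eq_single k
    (by intro b _ hb; simp [S.next_injective.eq_iff, hb]) (by simp)]
  rcases h with rfl | rfl
  · simp [forward, backward, sub_eq_add_neg]
  · simp [forward, backward, sub_eq_add_neg, add_comm]

lemma bd_rim (f : Tri d L N → ℝ) (ρ : Fin (L + 1) × Fin d) (j : Fin 3) :
    S.bd f (.inl (ρ, j)) =
      ∑ g, ((if lower g = ρ then f (.inl (g, ![0, 1, 3] j)) + f (.inl (g, ![4, 6, 7] j)) else 0) -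
        (if upper g = ρ then f (.inl (g, ![2, 5, 8] j)) else 0)) +
      ∑ k, if S.loop k = ρ then S.sg k * f (.inr (k, ![0, 2, 4] (turnEdge (S.flip k) j)))
        else 0 := by
  rw [bd_eq]
  simp only [incidence_rim_gadget, incidence_rim_leg]
  congr 1
  · refine Finset.sum_congr rfl fun g _ => ?_
    have hl : ∑ τ, (lowerCoef j τ : ℝ) * f (.inl (g, τ)) =
        f (.inl (g, ![0, 1, 3] j)) + f (.inl (g, ![4, 6, 7] j)) := by
      have : ∀ τ, lowerCoef j τ = (if τ = ![0, 1, 3] j then 1 else 0) +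
          (if τ = ![4, 6, 7] j then 1 else 0) := by revert j; decide +kernel
      simp [this, add_mul, Finset.sum_add_distrib]
    have hu : ∑ τ, (upperCoef j τ : ℝ) * f (.inl (g, τ)) = - f (.inl (g, ![2, 5, 8] j)) := by
      simp [upperCoef_eq]
    split_ifs <;> simp [add_mul, Finset.sum_add_distrib, hl, hu, sub_eq_add_neg]
  · refine Finset.sum_congr rfl fun k _ => ?_
    split_ifs
    · simp [rimCoef_eq]
    · simp

end Scaffold

/-! ### Holonomies and levels -/

namespace Scaffold

variable {d n L N : ℕ} (S : Scaffold d n L N)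

/-- The matrix encoded by a scaffold. -/
def matrix : Matrix (Fin d) (Fin n) ℤ := fun i j =>
  ∑ k, if (S.loop k).2 = i ∧ S.col k = j then S.sg k * 2 ^ ((S.loop k).1 : ℕ) else 0

/-- The sum of a 1-chain along a rim. -/
def loopSum (r : Edge d L N → ℝ) (ρ : Fin (L + 1) × Fin d) : ℝ := ∑ j, r (.inl (ρ, j))

/-- The sum of a 2-chain over the three triangles of a leg along the rim. -/
def legSum (f : Tri d L N → ℝ) (k : Fin N) : ℝ :=
  f (.inr (k, 0)) + f (.inr (k, 2)) + f (.inr (k, 4))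

/-- The sum of a 2-chain over the triangles of a gadget along the lower rim. -/
def lowerSum (f : Tri d L N → ℝ) (g : Fin L × Fin d) : ℝ :=
  f (.inl (g, 0)) + f (.inl (g, 1)) + f (.inl (g, 3)) + f (.inl (g, 4)) + f (.inl (g, 6)) +
    f (.inl (g, 7))

/-- The sum of a 2-chain over the triangles of a gadget along the upper rim. -/
def upperSum (f : Tri d L N → ℝ) (g : Fin L × Fin d) : ℝ :=
  f (.inl (g, 2)) + f (.inl (g, 5)) + f (.inl (g, 8))

/-- An alternating sum of a 1-chain over cross edges of a gadget. The edges form a closed walk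
which winds twice, backwards, around the lower rim. -/
def crossDefect (r : Edge d L N → ℝ) (g : Fin L × Fin d) : ℝ :=
  (r (.inr (.inl (g, 1))) + r (.inr (.inl (g, 4))) + r (.inr (.inl (g, 7)))) -
    (r (.inr (.inl (g, 8))) + r (.inr (.inl (g, 2))) + r (.inr (.inl (g, 5))))

/-- The combination of the boundary equations of row `i` that eliminates the doubling gadgets. -/
def rowDefect (r : Edge d L N → ℝ) (i : Fin d) : ℝ :=
  ∑ l : Fin (L + 1), 2 ^ (l : ℕ) * loopSum r (l, i) -
    ∑ l : Fin L, 2 ^ (l : ℕ) * crossDefect r (l, i)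

lemma sum_matrix_mul (u : Fin n → ℝ) (i : Fin d) :
    ∑ j, (S.matrix i j : ℝ) * u j = ∑ k, if (S.loop k).2 = i then
      (S.sg k : ℝ) * 2 ^ ((S.loop k).1 : ℕ) * u (S.col k) else 0 := by
  simp only [matrix]
  push_cast
  simp only [Finset.sum_mul]
  rw [Finset.sum_comm]
  refine Finset.sum_congr rfl fun k _ => ?_
  rw [Finset.sum_eq_single (S.col k) (by intro b _ hb; simp [hb.symm]) (by simp)]
  simp

lemma loopSum_bd (f : Tri d L N → ℝ) (ρ : Fin (L + 1) × Fin d) :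
    loopSum (S.bd f) ρ =
      ∑ g, ((if lower g = ρ then lowerSum f g else 0) - (if upper g = ρ then upperSum f g else 0)) +
      ∑ k, if S.loop k = ρ then S.sg k * legSum f k else 0 := by
  simp only [loopSum, bd_rim, Finset.sum_add_distrib]
  rw [Finset.sum_comm, Finset.sum_comm (f := fun (j : Fin 3) (k : Fin N) => _)]
  congr 1
  · refine Finset.sum_congr rfl fun g _ => ?_
    simp only [Fin.sum_univ_three, lowerSum, upperSum]
    split_ifs <;> simp <;> ring
  · refine Finset.sum_congr rfl fun k _ => ?_
    split_ifs
    · simp only [legSum, Fin.sum_univ_three, turnEdge]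
      cases S.flip k
      · simp; ring
      · have h0 : (0 : Fin 3).rev = 2 := by decide
        have h1 : (1 : Fin 3).rev = 1 := by decide
        have h2 : (2 : Fin 3).rev = 0 := by decide
        simp [h0, h1, h2]; ring
    · simp

lemma crossDefect_bd (f : Tri d L N → ℝ) (g : Fin L × Fin d) :
    crossDefect (S.bd f) g = lowerSum f g - 2 * upperSum f g := by
  simp only [crossDefect, bd_cross, lowerSum, upperSum]
  have e1 : (1 : Fin 9) + 1 = 2 := by decide
  have e4 : (4 : Fin 9) + 1 = 5 := by decide
  have e7 : (7 : Fin 9) + 1 = 8 := by decide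
  have e8 : (8 : Fin 9) + 1 = 0 := by decide
  have e2 : (2 : Fin 9) + 1 = 3 := by decide
  have e5 : (5 : Fin 9) + 1 = 6 := by decide
  rw [e1, e4, e7, e8, e2, e5]
  ring

/-- Eliminating the doubling gadgets leaves three times the row `i` of the encoded matrix. -/
lemma rowDefect_bd (f : Tri d L N → ℝ) (i : Fin d) :
    rowDefect (S.bd f) i = ∑ k, if (S.loop k).2 = i then
      (S.sg k : ℝ) * 2 ^ ((S.loop k).1 : ℕ) * legSum f k else 0 := by
  simp only [rowDefect, loopSum_bd, crossDefect_bd, mul_add, Finset.mul_sum,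
    Finset.sum_add_distrib, mul_sub, Finset.sum_sub_distrib]
  have h1 : ∑ l : Fin (L + 1), ∑ g : Fin L × Fin d,
      (2 : ℝ) ^ (l : ℕ) * (if lower g = (l, i) then lowerSum f g else 0) =
      ∑ l : Fin L, 2 ^ (l : ℕ) * lowerSum f (l, i) := by
    rw [Finset.sum_comm, Fintype.sum_prod_type (γ := ℝ) (α₁ := Fin L)]
    refine Finset.sum_congr rfl fun l _ => ?_
    rw [Finset.sum_eq_single i (by intro b _ hb; simp [lower, hb]) (by simp),
      Finset.sum_eq_single l.castSucc (by intro b _ hb; simp [lower, hb.symm]) (by simp)]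
    simp [lower]
  have h2 : ∑ l : Fin (L + 1), ∑ g : Fin L × Fin d,
      (2 : ℝ) ^ (l : ℕ) * (if upper g = (l, i) then upperSum f g else 0) =
      ∑ l : Fin L, 2 ^ (l : ℕ) * (2 * upperSum f (l, i)) := by
    rw [Finset.sum_comm, Fintype.sum_prod_type (γ := ℝ) (α₁ := Fin L)]
    refine Finset.sum_congr rfl fun l _ => ?_
    rw [Finset.sum_eq_single i (by intro b _ hb; simp [upper, hb]) (by simp),
      Finset.sum_eq_single l.succ (by intro b _ hb; simp [upper, hb.symm]) (by simp)]
    simp [upper]; ring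
  rw [h1, h2]
  have h3 : ∑ l : Fin (L + 1), ∑ k, (2 : ℝ) ^ (l : ℕ) *
      (if S.loop k = (l, i) then S.sg k * legSum f k else 0) =
      ∑ k, if (S.loop k).2 = i then
        (S.sg k : ℝ) * 2 ^ ((S.loop k).1 : ℕ) * legSum f k else 0 := by
    rw [Finset.sum_comm]
    refine Finset.sum_congr rfl fun k _ => ?_
    rw [Finset.sum_eq_single (S.loop k).1 (by
      intro b _ hb
      rw [if_neg (by rintro h; exact hb (congrArg Prod.fst h).symm), mul_zero]) (by simp)]
    by_cases h : (S.loop k).2 = i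
    · have h' : S.loop k = ((S.loop k).1, i) := by rw [← h]
      rw [if_pos h, if_pos h']; ring
    · rw [if_neg h, if_neg (fun h' => h (congrArg Prod.snd h')), mul_zero]
  rw [h3]
  ring

/-- A 1-cochain that vanishes on the boundary of every triangle. -/
def IsCocycle (r : Edge d L N → ℝ) : Prop :=
  ∀ t, ∑ s, (S.sgn t s : ℝ) * r (S.side t s) = 0

variable {S}

/-- Holonomies double from the lower to the upper rim of a gadget. -/
lemma IsCocycle.gadget {r : Edge d L N → ℝ} (hr : S.IsCocycle r) (g : Fin L × Fin d) :
    loopSum r (upper g) = 2 * loopSum r (lower g) ∧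
      crossDefect r g = -2 * loopSum r (lower g) := by
  have h0 := hr (.inl (g, 0))
  have h1 := hr (.inl (g, 1))
  have h2 := hr (.inl (g, 2))
  have h3 := hr (.inl (g, 3))
  have h4 := hr (.inl (g, 4))
  have h5 := hr (.inl (g, 5))
  have h6 := hr (.inl (g, 6))
  have h7 := hr (.inl (g, 7))
  have h8 := hr (.inl (g, 8))
  simp [sgn, side, gadgetSgn, gadgetSide, gadgetEdge, Fin.sum_univ_three]
    at h0 h1 h2 h3 h4 h5 h6 h7 h8
  simp only [loopSum, crossDefect, Fin.sum_univ_three]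
  constructor <;> linarith

lemma IsCocycle.loopSum_eq {r : Edge d L N → ℝ} (hr : S.IsCocycle r) (i : Fin d)
    (l : Fin (L + 1)) : loopSum r (l, i) = 2 ^ (l : ℕ) * loopSum r (0, i) := by
  induction l using Fin.induction with
  | zero => simp
  | succ l ih =>
    have := (hr.gadget (l, i)).1
    simp only [upper, lower] at this
    rw [this, ih, Fin.val_castSucc, Fin.val_succ, pow_succ]
    ring

/-- The weight with which the holonomy of a cocycle enters the row defect. -/
noncomputable def slackWeight (L : ℕ) : ℝ :=
  ∑ l : Fin (L + 1), 2 ^ (l : ℕ) * 2 ^ (l : ℕ) + ∑ l : Fin L, 2 ^ (l : ℕ) * (2 * 2 ^ (l : ℕ))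

/-- On a cocycle the row defect is a fixed multiple of the holonomy around the lowest rim: the
alternating sums over cross edges are holonomies, so no information beyond the homology class
enters. -/
lemma IsCocycle.rowDefect_eq {r : Edge d L N → ℝ} (hr : S.IsCocycle r) (i : Fin d) :
    rowDefect r i = slackWeight L * loopSum r (0, i) := by
  rw [rowDefect, slackWeight, add_mul, Finset.sum_mul, Finset.sum_mul, sub_eq_add_neg,
    ← Finset.sum_neg_distrib]
  congr 1
  · refine Finset.sum_congr rfl fun l _ => ?_
    rw [hr.loopSum_eq]; ring
  · refine Finset.sum_congr rfl fun l _ => ?_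
    rw [(hr.gadget (l, i)).2, lower, hr.loopSum_eq, Fin.val_castSucc]; ring

variable (S)

/-- The 2-chain that is constant on the legs of each column and on each gadget. -/
def layered (u : Fin n → ℝ) (T : Fin L × Fin d → ℝ) : Tri d L N → ℝ
  | .inl (g, _) => T g
  | .inr (k, _) => u (S.col k)

lemma bd_layered_inr (u : Fin n → ℝ) (T : Fin L × Fin d → ℝ)
    (e : ((Fin L × Fin d) × Fin 9) ⊕ (Fin N × Fin 18)) :
    S.bd (S.layered u T) (.inr e) = 0 := by
  rcases e with ⟨g, e⟩ | ⟨k, e⟩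
  · simp [bd_cross, layered]
  · by_cases h : e = 16 ∨ e = 17
    · obtain ⟨k', rfl⟩ := Finite.injective_iff_surjective.1 S.next_injective k
      rw [bd_own_next _ _ _ _ h]
      simp [layered, S.col_next]
    · rw [not_or] at h
      rw [bd_own_of_ne _ _ _ _ h.1 h.2]
      simp [layered]

lemma bd_layered_rim (u : Fin n → ℝ) (T : Fin L × Fin d → ℝ) (ρ : Fin (L + 1) × Fin d)
    (j : Fin 3) : S.bd (S.layered u T) (.inl (ρ, j)) =
      ∑ g, ((if lower g = ρ then 2 * T g else 0) - (if upper g = ρ then T g else 0)) +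
      ∑ k, if S.loop k = ρ then S.sg k * u (S.col k) else 0 := by
  rw [bd_rim]
  simp only [layered, two_mul]

/-- The holonomies of a cocycle around the lowest rims are orthogonal to the columns of the encoded
matrix: the legs of a column bound in the complex. -/
lemma IsCocycle.sum_loopSum_mul {r : Edge d L N → ℝ} (hr : S.IsCocycle r) (u : Fin n → ℝ) :
    ∑ i, loopSum r (0, i) * ∑ j, (S.matrix i j : ℝ) * u j = 0 := by
  have h0 : ∑ e, r e * S.bd (S.layered u 0) e = 0 := by
    rw [sum_mul_bd]
    exact Finset.sum_eq_zero fun t _ => by rw [hr t, mul_zero]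
  rw [Fintype.sum_sum_type, Fintype.sum_prod_type (γ := ℝ) (α₁ := Fin (L + 1) × Fin d)] at h0
  simp only [bd_layered_inr, bd_layered_rim, mul_zero, Finset.sum_const_zero, add_zero,
    Pi.zero_apply, ite_self, sub_zero, zero_add, ← Finset.sum_mul] at h0
  rw [← h0]
  simp only [sum_matrix_mul, Finset.mul_sum]
  rw [Finset.sum_comm, Finset.sum_comm (f := fun (ρ : Fin (L + 1) × Fin d) (k : Fin N) => _)]
  refine Finset.sum_congr rfl fun k _ => ?_
  rw [Finset.sum_eq_single (S.loop k).2 (by intro b _ hb; simp [hb.symm]) (by simp),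
    Finset.sum_eq_single (S.loop k) (by intro b _ hb; simp [hb.symm]) (by simp)]
  have := hr.loopSum_eq (S.loop k).2 (S.loop k).1
  rw [Prod.mk.eta] at this
  simp only [if_true]
  change _ = loopSum r (S.loop k) * _
  rw [this]
  ring

/-- The right-hand side with the entries of `b` around the lowest rims. -/
def rhsChain (N : ℕ) {L : ℕ} (b : Fin d → ℝ) : Edge d L N → ℝ
  | .inl (ρ, _) => if ρ.1 = 0 then b ρ.2 else 0
  | .inr _ => 0

lemma rowDefect_rhsChain (b : Fin d → ℝ) (i : Fin d) :
    rowDefect (rhsChain N (L := L) b) i = 3 * b i := by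
  simp only [rowDefect, loopSum, crossDefect, rhsChain, Fin.sum_univ_three, add_zero, sub_zero,
    mul_zero, Finset.sum_const_zero]
  rw [Finset.sum_eq_single 0 (by intro b _ hb; simp [hb]) (by simp)]
  simp
  ring

lemma rowDefect_sub (r r' : Edge d L N → ℝ) (i : Fin d) :
    rowDefect (fun e => r e - r' e) i = rowDefect r i - rowDefect r' i := by
  have h1 : ∀ ρ, loopSum (fun e => r e - r' e) ρ = loopSum r ρ - loopSum r' ρ := fun ρ => by
    simp only [loopSum, Finset.sum_sub_distrib]
  have h2 : ∀ g, crossDefect (fun e => r e - r' e) g = crossDefect r g - crossDefect r' g :=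
    fun g => by simp only [crossDefect]; ring
  simp only [rowDefect, h1, h2, mul_sub, Finset.sum_sub_distrib]
  ring

/-- The part of row `i` of the encoded matrix, applied to `u`, on the levels up to `l`. -/
def partialRow (u : Fin n → ℝ) (l : ℕ) (i : Fin d) : ℝ :=
  ∑ k, if (S.loop k).2 = i ∧ ((S.loop k).1 : ℕ) ≤ l then
    (S.sg k : ℝ) * 2 ^ ((S.loop k).1 : ℕ) * u (S.col k) else 0

/-- The values on the gadgets for which the layered chain satisfies all equations except those on
the highest rims. -/
noncomputable def carry (u : Fin n → ℝ) (b : Fin d → ℝ) (g : Fin L × Fin d) : ℝ :=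
  (b g.2 - S.partialRow u g.1 g.2) / 2 ^ ((g.1 : ℕ) + 1)

/-- With the values `carry` on the gadgets, the residual lives on the highest rims and is that of
the encoded equations divided by `2 ^ L`. -/
lemma bd_layered_carry (hL : 0 < L) (u : Fin n → ℝ) (b : Fin d → ℝ) (ρ : Fin (L + 1) × Fin d)
    (j : Fin 3) :
    rhsChain N b (.inl (ρ, j)) - S.bd (S.layered u (S.carry u b)) (.inl (ρ, j)) =
      if ρ.1 = Fin.last L then (b ρ.2 - ∑ k, (S.matrix ρ.2 k : ℝ) * u k) / 2 ^ L else 0 := by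
  obtain ⟨l, i⟩ := ρ
  have hlow : ∑ g : Fin L × Fin d, (if lower g = (l, i) then 2 * S.carry u b g else 0) =
      if h : (l : ℕ) < L then 2 * S.carry u b (⟨l, h⟩, i) else 0 := by
    split_ifs with h
    · rw [Finset.sum_eq_single ((⟨l, h⟩ : Fin L), i)]
      · rw [if_pos]; rfl
      · rintro g - hg
        rw [if_neg]
        intro h'
        exact hg (lower_injective (h'.trans rfl))
      · simp
    · refine Finset.sum_eq_zero fun g _ => ?_
      rw [if_neg]
      intro h'
      have := congrArg (fun x : Fin (L + 1) × Fin d => (x.1 : ℕ)) h'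
      simp only [lower, Fin.val_castSucc] at this
      have := g.1.isLt
      omega
  have hup : ∑ g : Fin L × Fin d, (if upper g = (l, i) then S.carry u b g else 0) =
      if h : 0 < (l : ℕ) then S.carry u b (⟨l - 1, by omega⟩, i) else 0 := by
    split_ifs with h
    · have hu : upper ((⟨l - 1, by omega⟩ : Fin L), i) = (l, i) := by
        ext
        · simp [upper]; omega
        · rfl
      rw [Finset.sum_eq_single ((⟨l - 1, by omega⟩ : Fin L), i)]
      · rw [if_pos hu]
      · rintro g - hg
        rw [if_neg]
        intro h'
        exact hg (upper_injective (h'.trans hu.symm))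
      · simp
    · refine Finset.sum_eq_zero fun g _ => ?_
      rw [if_neg]
      intro h'
      have := congrArg (fun x : Fin (L + 1) × Fin d => (x.1 : ℕ)) h'
      simp only [upper, Fin.val_succ] at this
      omega
  have hstep : ∀ l' : ℕ, S.partialRow u (l' + 1) i - S.partialRow u l' i =
      2 ^ (l' + 1) * ∑ k, if (S.loop k).2 = i ∧ ((S.loop k).1 : ℕ) = l' + 1 then
        S.sg k * u (S.col k) else 0 := by
    intro l'
    rw [partialRow, partialRow, ← Finset.sum_sub_distrib, Finset.mul_sum]
    refine Finset.sum_congr rfl fun k _ => ?_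
    by_cases h1 : (S.loop k).2 = i
    · rcases lt_trichotomy ((S.loop k).1 : ℕ) (l' + 1) with h | h | h
      · simp [h1, h.le, Nat.lt_succ_iff.1 h, h.ne]
      · simp [h1, h]; ring
      · have h2 : ¬ ((S.loop k).1 : ℕ) ≤ l' := by omega
        have h3 : ¬ ((S.loop k).1 : ℕ) ≤ l' + 1 := by omega
        simp [h1, h2, h3, h.ne']
    · simp [h1]
  have hzero : S.partialRow u 0 i = ∑ k, if (S.loop k).2 = i ∧ ((S.loop k).1 : ℕ) = 0 then
      S.sg k * u (S.col k) else 0 := by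
    refine Finset.sum_congr rfl fun k _ => ?_
    by_cases h : (S.loop k).2 = i ∧ ((S.loop k).1 : ℕ) = 0
    · rw [if_pos h, if_pos ⟨h.1, h.2.le⟩, h.2]; ring
    · rw [if_neg h, if_neg (fun h' => h ⟨h'.1, Nat.le_zero.1 h'.2⟩)]
  have htop : S.partialRow u (L - 1) i = ∑ k, (S.matrix i k : ℝ) * u k := by
    rw [sum_matrix_mul]
    refine Finset.sum_congr rfl fun k _ => ?_
    have := S.level_lt k
    by_cases h : (S.loop k).2 = i
    · rw [if_pos h, if_pos ⟨h, by omega⟩]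
    · rw [if_neg h, if_neg (fun h' => h h'.1)]
  have hleg : ∑ k, (if S.loop k = (l, i) then S.sg k * u (S.col k) else 0) =
      ∑ k, if (S.loop k).2 = i ∧ ((S.loop k).1 : ℕ) = l then S.sg k * u (S.col k) else 0 := by
    refine Finset.sum_congr rfl fun k _ => ?_
    congr 1
    rw [Prod.ext_iff, Fin.ext_iff, and_comm]
  rw [bd_layered_rim, Finset.sum_sub_distrib, hlow, hup, hleg]
  simp only [rhsChain, carry, Fin.ext_iff (a := l), Fin.val_last, Fin.val_zero]
  rcases Nat.eq_zero_or_pos (l : ℕ) with h0 | h0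
  · rw [h0, dif_pos hL, dif_neg (by omega), if_pos rfl, if_neg (by omega), hzero]
    push_cast
    ring
  · obtain ⟨l', hl'⟩ : ∃ l', (l : ℕ) = l' + 1 := ⟨l - 1, by omega⟩
    have h2 := hstep l'
    have hp : (2 : ℝ) ^ (l' + 1) ≠ 0 := by positivity
    rw [if_neg (by omega), dif_pos h0]
    have e1 : (l : ℕ) - 1 = l' := by omega
    simp only [hl', Nat.add_sub_cancel]
    by_cases hlt : l' + 1 < L
    · rw [dif_pos hlt, if_neg (by omega), pow_succ 2 (l' + 1)]
      field_simp
      linarith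
    · have hL' : L = l' + 1 := by have := l.isLt; omega
      have hL1 : L - 1 = l' := by omega
      have hpow : (2 : ℝ) ^ L = 2 ^ (l' + 1) := congrArg _ hL'
      rw [dif_neg hlt, if_pos hL'.symm, ← htop, hL1, hpow]
      have hX : ∑ k, (if (S.loop k).2 = i ∧ ((S.loop k).1 : ℕ) = l' + 1 then
          (S.sg k : ℝ) * u (S.col k) else 0) = 0 := by
        refine Finset.sum_eq_zero fun k _ => if_neg ?_
        have := S.level_lt k
        omega
      rw [hX]
      ring

end Scaffold

/-! ### Chains with small boundary -/

namespace Scaffold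

variable {d n L N : ℕ} (S : Scaffold d n L N)

lemma leg_close {f : Tri d L N → ℝ} {β : ℝ} (h : ∀ e, |S.bd f (.inr e)| ≤ β) (k : Fin N)
    (τ : Fin 13) : |f (.inr (k, τ)) - f (.inr (k, 0))| ≤ 6 * β := by
  have hs : ∀ e : Fin 18, e ≠ 16 → e ≠ 17 →
      |f (.inr (k, forward e)) - f (.inr (k, backward e))| ≤ β := fun e h1 h2 => by
    rw [← S.bd_own_of_ne f k e h1 h2]; exact h _
  have h0 := abs_le.1 (hs 0 (by decide) (by decide))
  have h1 := abs_le.1 (hs 1 (by decide) (by decide))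
  have h2 := abs_le.1 (hs 2 (by decide) (by decide))
  have h4 := abs_le.1 (hs 4 (by decide) (by decide))
  have h5 := abs_le.1 (hs 5 (by decide) (by decide))
  have h6 := abs_le.1 (hs 6 (by decide) (by decide))
  have h7 := abs_le.1 (hs 7 (by decide) (by decide))
  have h8 := abs_le.1 (hs 8 (by decide) (by decide))
  have h9 := abs_le.1 (hs 9 (by decide) (by decide))
  have h11 := abs_le.1 (hs 11 (by decide) (by decide))
  have h12 := abs_le.1 (hs 12 (by decide) (by decide))
  have h14 := abs_le.1 (hs 14 (by decide) (by decide))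
  simp [forward, backward] at h0 h1 h2 h4 h5 h6 h7 h8 h9 h11 h12 h14
  fin_cases τ <;> refine abs_le.2 ⟨?_, ?_⟩ <;> simp <;> linarith

lemma next_close {f : Tri d L N → ℝ} {β : ℝ} (h : ∀ e, |S.bd f (.inr e)| ≤ β) (k : Fin N) :
    |f (.inr (S.next k, 0)) - f (.inr (k, 0))| ≤ 13 * β := by
  have h1 := abs_le.1 (h (.inr (S.next k, 16)))
  rw [S.bd_own_next f k 16 (Or.inl rfl), if_pos rfl] at h1
  have h2 := abs_le.1 (S.leg_close h (S.next k) 6)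
  have h3 := abs_le.1 (S.leg_close h k 8)
  rw [abs_le]
  constructor <;> linarith

/-- A 2-chain whose boundary is small off the rims is almost constant on the legs of a column. -/
lemma rep_close {f : Tri d L N → ℝ} {β : ℝ} (h : ∀ e, |S.bd f (.inr e)| ≤ β) (k : Fin N)
    (τ : Fin 13) : |f (.inr (k, τ)) - f (.inr (S.rep (S.col k), 0))| ≤ 19 * N * β := by
  have hβ : 0 ≤ β := (abs_nonneg _).trans (h (.inr (k, 0)))
  have iter : ∀ m : ℕ, |f (.inr (S.next^[m] k, 0)) - f (.inr (k, 0))| ≤ 13 * m * β := by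
    intro m
    induction m with
    | zero => simp
    | succ m ih =>
      rw [Function.iterate_succ_apply']
      have h1 := abs_le.1 (S.next_close h (S.next^[m] k))
      have h2 := abs_le.1 ih
      push_cast
      rw [abs_le]
      constructor <;> linarith
  obtain ⟨m, hm, hk⟩ := S.reach k
  have h1 := iter m
  rw [hk] at h1
  have h2 := abs_le.1 (S.leg_close h k τ)
  have hN : (1 : ℝ) ≤ N := by exact_mod_cast (Nat.one_le_iff_ne_zero.2 (by have := k.isLt; omega))
  have hm' : (m : ℝ) ≤ N := by exact_mod_cast hm
  have h3 : 13 * (m : ℝ) * β ≤ 13 * N * β := by gcongr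
  have h4 : 6 * β ≤ 6 * N * β := by nlinarith
  have h5 := abs_le.1 h1
  rw [abs_le]
  constructor <;> linarith

/-- The sum of the absolute values of the digits, with their weights. -/
def weight : ℕ := ∑ k, 2 ^ ((S.loop k).1 : ℕ)

lemma abs_sg (k : Fin N) : |(S.sg k : ℝ)| = 1 := by
  unfold sg; split_ifs <;> simp

/-- The values of a 2-chain on representatives of the columns satisfy the encoded equations up to
the row defect of the boundary and an error controlled by the boundary off the rims. -/
lemma sum_abs_row_sub_le {f : Tri d L N → ℝ} {β : ℝ} (h : ∀ e, |S.bd f (.inr e)| ≤ β) :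
    ∑ i, |∑ j, (S.matrix i j : ℝ) * f (.inr (S.rep j, 0)) - rowDefect (S.bd f) i / 3| ≤
      S.weight * (19 * N * β) := by
  have hrow : ∀ i, |∑ j, (S.matrix i j : ℝ) * f (.inr (S.rep j, 0)) - rowDefect (S.bd f) i / 3| ≤
      ∑ k, if (S.loop k).2 = i then 2 ^ ((S.loop k).1 : ℕ) * (19 * N * β) else 0 := by
    intro i
    rw [S.sum_matrix_mul (fun j => f (.inr (S.rep j, 0))), rowDefect_bd, Finset.sum_div,
      ← Finset.sum_sub_distrib]
    refine (Finset.abs_sum_le_sum_abs _ _).trans (Finset.sum_le_sum fun k _ => ?_)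
    split_ifs
    · have h0 := abs_le.1 (S.rep_close h k 0)
      have h2 := abs_le.1 (S.rep_close h k 2)
      have h4 := abs_le.1 (S.rep_close h k 4)
      have e : (S.sg k : ℝ) * 2 ^ ((S.loop k).1 : ℕ) * f (.inr (S.rep (S.col k), 0)) -
          S.sg k * 2 ^ ((S.loop k).1 : ℕ) * legSum f k / 3 = S.sg k * 2 ^ ((S.loop k).1 : ℕ) *
            (f (.inr (S.rep (S.col k), 0)) - legSum f k / 3) := by ring
      rw [e, abs_mul, abs_mul, abs_sg, one_mul, abs_of_nonneg (by positivity)]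
      refine mul_le_mul_of_nonneg_left ?_ (by positivity)
      rw [legSum, abs_le]
      constructor <;> linarith
    · simp
  refine (Finset.sum_le_sum fun i _ => hrow i).trans ?_
  rw [Finset.sum_comm]
  simp [weight, Finset.sum_mul]

lemma abs_rowDefect_le {r : Edge d L N → ℝ} {δ : ℝ} (h : ∀ e, |r e| ≤ δ) (i : Fin d) :
    |rowDefect r i| ≤ 12 * 2 ^ L * δ := by
  have hδ : 0 ≤ δ := (abs_nonneg _).trans (h (.inl ((0, i), 0)))
  have h1 : ∀ ρ, |loopSum r ρ| ≤ 3 * δ := by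
    intro ρ
    have a0 := abs_le.1 (h (.inl (ρ, 0)))
    have a1 := abs_le.1 (h (.inl (ρ, 1)))
    have a2 := abs_le.1 (h (.inl (ρ, 2)))
    rw [loopSum, Fin.sum_univ_three, abs_le]
    constructor <;> linarith
  have h2 : ∀ g, |crossDefect r g| ≤ 6 * δ := by
    intro g
    have a0 := abs_le.1 (h (.inr (.inl (g, 1))))
    have a1 := abs_le.1 (h (.inr (.inl (g, 4))))
    have a2 := abs_le.1 (h (.inr (.inl (g, 7))))
    have a3 := abs_le.1 (h (.inr (.inl (g, 8))))
    have a4 := abs_le.1 (h (.inr (.inl (g, 2))))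
    have a5 := abs_le.1 (h (.inr (.inl (g, 5))))
    rw [crossDefect, abs_le]
    constructor <;> linarith
  have geom : ∀ m : ℕ, ∑ l : Fin m, (2 : ℝ) ^ (l : ℕ) ≤ 2 ^ m := by
    intro m
    rw [Fin.sum_univ_eq_sum_range (fun l => (2 : ℝ) ^ l), geom_sum_eq (by norm_num)]
    norm_num
  have h3 : |∑ l : Fin (L + 1), 2 ^ (l : ℕ) * loopSum r (l, i)| ≤ 2 ^ (L + 1) * (3 * δ) := by
    refine (Finset.abs_sum_le_sum_abs _ _).trans ?_
    refine le_trans (Finset.sum_le_sum (g := fun l : Fin (L + 1) => (2 : ℝ) ^ (l : ℕ) * (3 * δ))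
      fun l _ => ?_) ?_
    · rw [abs_mul, abs_of_nonneg (by positivity : (0 : ℝ) ≤ 2 ^ (l : ℕ))]
      exact mul_le_mul_of_nonneg_left (h1 _) (by positivity)
    · rw [← Finset.sum_mul]
      exact mul_le_mul_of_nonneg_right (geom _) (by positivity)
  have h4 : |∑ l : Fin L, 2 ^ (l : ℕ) * crossDefect r (l, i)| ≤ 2 ^ L * (6 * δ) := by
    refine (Finset.abs_sum_le_sum_abs _ _).trans ?_
    refine le_trans (Finset.sum_le_sum (g := fun l : Fin L => (2 : ℝ) ^ (l : ℕ) * (6 * δ))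
      fun l _ => ?_) ?_
    · rw [abs_mul, abs_of_nonneg (by positivity : (0 : ℝ) ≤ 2 ^ (l : ℕ))]
      exact mul_le_mul_of_nonneg_left (h2 _) (by positivity)
    · rw [← Finset.sum_mul]
      exact mul_le_mul_of_nonneg_right (geom _) (by positivity)
  rw [rowDefect]
  refine (abs_sub _ _).trans ((add_le_add h3 h4).trans (le_of_eq ?_))
  ring

lemma gadget_close {f : Tri d L N → ℝ} {β : ℝ} (h : ∀ e, |S.bd f e| ≤ β)
    (g : Fin L × Fin d) (τ : Fin 9) : |f (.inl (g, τ)) - f (.inl (g, 2))| ≤ 8 * β := by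
  have hs : ∀ e : Fin 9, |f (.inl (g, e)) - f (.inl (g, e + 1))| ≤ β := fun e => by
    rw [← S.bd_cross f g e]; exact h _
  have h0 := abs_le.1 (hs 0)
  have h1 := abs_le.1 (hs 1)
  have h2 := abs_le.1 (hs 2)
  have h3 := abs_le.1 (hs 3)
  have h4 := abs_le.1 (hs 4)
  have h5 := abs_le.1 (hs 5)
  have h6 := abs_le.1 (hs 6)
  have h7 := abs_le.1 (hs 7)
  have e0 : (0 : Fin 9) + 1 = 1 := by decide
  have e1 : (1 : Fin 9) + 1 = 2 := by decide
  have e2 : (2 : Fin 9) + 1 = 3 := by decide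
  have e3 : (3 : Fin 9) + 1 = 4 := by decide
  have e4 : (4 : Fin 9) + 1 = 5 := by decide
  have e5 : (5 : Fin 9) + 1 = 6 := by decide
  have e6 : (6 : Fin 9) + 1 = 7 := by decide
  have e7 : (7 : Fin 9) + 1 = 8 := by decide
  rw [e0] at h0; rw [e1] at h1; rw [e2] at h2; rw [e3] at h3; rw [e4] at h4; rw [e5] at h5
  rw [e6] at h6; rw [e7] at h7
  fin_cases τ <;> refine abs_le.2 ⟨?_, ?_⟩ <;> simp <;> linarith

/-- A 2-chain with small boundary and small values on representatives of the columns is small: the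
values on the gadgets are controlled level by level, starting from the free highest rims. -/
lemma abs_le_of_bd {f : Tri d L N → ℝ} {β ξ : ℝ} (hβ : 0 ≤ β) (hξ : 0 ≤ ξ)
    (h : ∀ e, |S.bd f e| ≤ β) (hx : ∀ j, |f (.inr (S.rep j, 0))| ≤ ξ) (t : Tri d L N) :
    |f t| ≤ 2 ^ L * (9 * β + (N + 1) * (ξ + 19 * N * β)) := by
  set Y := ξ + 19 * N * β with hY
  have hY0 : 0 ≤ Y := by positivity
  set B := 9 * β + (N + 1) * Y with hB
  have hleg : ∀ k τ, |f (.inr (k, τ))| ≤ Y := by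
    intro k τ
    have h1 := abs_le.1 (S.rep_close (fun e => h _) k τ)
    have h2 := abs_le.1 (hx (S.col k))
    rw [abs_le]
    constructor <;> linarith
  have hlegs : ∀ ρ j, |∑ k, if S.loop k = ρ then
      S.sg k * f (.inr (k, ![0, 2, 4] (turnEdge (S.flip k) j))) else 0| ≤ N * Y := by
    intro ρ j
    refine (Finset.abs_sum_le_sum_abs _ _).trans ?_
    refine (Finset.sum_le_sum (g := fun _ => Y) fun k _ => ?_).trans (by simp)
    split_ifs
    · rw [abs_mul, abs_sg, one_mul]; exact hleg _ _
    · simpa using hY0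
  have hgad : ∀ m : ℕ, ∀ g : Fin L × Fin d, L ≤ (g.1 : ℕ) + m → ∀ τ,
      |f (.inl (g, τ))| ≤ (2 ^ m - 1) * B := by
    intro m
    induction m with
    | zero => intro g hg; have := g.1.isLt; omega
    | succ m ih =>
      rintro ⟨l, i⟩ hg τ
      simp only at hg
      have hrim := S.bd_rim f (l.succ, i) 0
      have hup : ∑ g : Fin L × Fin d, (if upper g = (l.succ, i) then
          f (.inl (g, ![2, 5, 8] 0)) else 0) = f (.inl ((l, i), 2)) := by
        rw [Finset.sum_eq_single ((l, i) : Fin L × Fin d)]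
        · rw [if_pos (show upper (l, i) = (l.succ, i) from rfl)]; rfl
        · rintro g - hg
          exact if_neg fun h' => hg (upper_injective (h'.trans rfl))
        · simp
      have hlow : |∑ g : Fin L × Fin d, (if lower g = (l.succ, i) then
          f (.inl (g, ![0, 1, 3] 0)) + f (.inl (g, ![4, 6, 7] 0)) else 0)| ≤
          2 * ((2 ^ m - 1) * B) := by
        by_cases hl : (l : ℕ) + 1 < L
        · have hle : L ≤ (l : ℕ) + 1 + m := by omega
          rw [Finset.sum_eq_single ((⟨l + 1, hl⟩, i) : Fin L × Fin d)]
          · rw [if_pos (by rfl)]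
            refine (abs_add_le _ _).trans ?_
            have a := ih (⟨l + 1, hl⟩, i) hle (![0, 1, 3] 0)
            have b := ih (⟨l + 1, hl⟩, i) hle (![4, 6, 7] 0)
            linarith
          · rintro g - hg
            exact if_neg fun h' => hg (lower_injective (h'.trans rfl))
          · simp
        · rw [Finset.sum_eq_zero]
          · rw [abs_zero]
            have : (1 : ℝ) ≤ 2 ^ m := one_le_pow₀ (by norm_num)
            have : 0 ≤ (2 ^ m - 1 : ℝ) := by linarith
            positivity
          · rintro g -
            refine if_neg fun h' => ?_
            have := congrArg (fun x : Fin (L + 1) × Fin d => (x.1 : ℕ)) h'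
            simp only [lower, Fin.val_castSucc, Fin.val_succ] at this
            have := g.1.isLt
            omega
      rw [Finset.sum_sub_distrib, hup] at hrim
      have a1 := abs_le.1 (h (.inl ((l.succ, i), 0)))
      have a2 := abs_le.1 hlow
      have a3 := abs_le.1 (hlegs (l.succ, i) 0)
      have a4 := abs_le.1 (S.gadget_close h (l, i) τ)
      have e : ((2 : ℝ) ^ (m + 1) - 1) * B = 2 * ((2 ^ m - 1) * B) + B := by ring
      rw [e, abs_le]
      constructor <;> nlinarith
  have hB0 : 0 ≤ B := by positivity
  rcases t with ⟨g, τ⟩ | ⟨k, τ⟩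
  · refine (hgad L g (by omega) τ).trans ?_
    nlinarith
  · refine (hleg k τ).trans ?_
    have h1 : (1 : ℝ) ≤ 2 ^ L := one_le_pow₀ (by norm_num)
    have h2 : Y ≤ B := by
      have : 0 ≤ (N : ℝ) * Y := by positivity
      nlinarith
    nlinarith

end Scaffold

/-! ### Singular values -/

namespace LinearMap

variable {E F : Type*} [NormedAddCommGroup E] [InnerProductSpace ℝ E] [FiniteDimensional ℝ E]
  [NormedAddCommGroup F] [InnerProductSpace ℝ F] [FiniteDimensional ℝ F] (T : E →ₗ[ℝ] F)

/-- An orthonormal basis of right singular vectors. -/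
noncomputable def singularBasis : OrthonormalBasis (Fin (Module.finrank ℝ E)) ℝ E :=
  T.isSymmetric_adjoint_comp_self.eigenvectorBasis rfl

lemma inner_apply_singularBasis (i : Fin (Module.finrank ℝ E)) (v : E) :
    inner ℝ (T (T.singularBasis i)) (T v) =
      T.singularValues i ^ 2 * inner ℝ (T.singularBasis i) v := by
  have h : adjoint T (T (T.singularBasis i)) = T.singularValues i ^ 2 • T.singularBasis i := by
    have := T.isSymmetric_adjoint_comp_self.apply_eigenvectorBasis rfl i
    rw [T.sq_singularValues_fin rfl i]
    exact this
  rw [← adjoint_inner_left, h, real_inner_smul_left]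

lemma norm_sq_apply_eq_sum (v : E) :
    ‖T v‖ ^ 2 = ∑ i : Fin (Module.finrank ℝ E),
      T.singularValues i ^ 2 * inner ℝ (T.singularBasis i) v ^ 2 := by
  have hv : T v = ∑ i, inner ℝ (T.singularBasis i) v • T (T.singularBasis i) := by
    conv_lhs => rw [← T.singularBasis.sum_repr' v, map_sum]
    simp only [map_smul]
  rw [← real_inner_self_eq_norm_sq]
  nth_rewrite 1 [hv]
  rw [sum_inner]
  refine Finset.sum_congr rfl fun i _ => ?_
  rw [real_inner_smul_left, inner_apply_singularBasis]
  ring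

lemma norm_apply_singularBasis (i : Fin (Module.finrank ℝ E)) :
    ‖T (T.singularBasis i)‖ = T.singularValues i := by
  have h := T.inner_apply_singularBasis i (T.singularBasis i)
  rw [real_inner_self_eq_norm_sq, real_inner_self_eq_norm_sq, T.singularBasis.norm_eq_one] at h
  rw [one_pow, mul_one] at h
  exact (pow_left_inj₀ (norm_nonneg _) (T.singularValues_nonneg i) two_ne_zero).1 h

lemma finite_range_singularValues : (Set.range T.singularValues).Finite := by
  refine ((T.singularValues.support.image T.singularValues).finite_toSet.union
    (Set.finite_singleton 0)).subset ?_
  rintro _ ⟨i, rfl⟩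
  by_cases h : T.singularValues i = 0
  · exact Or.inr h
  · exact Or.inl (by
      simp only [Finset.coe_image]
      exact ⟨i, by simpa [-support_singularValues] using h, rfl⟩)

lemma norm_apply_le_sSup (v : E) : ‖T v‖ ≤ sSup (Set.range T.singularValues) * ‖v‖ := by
  have hb := T.finite_range_singularValues.bddAbove
  have h0 : 0 ≤ sSup (Set.range T.singularValues) :=
    (T.singularValues_nonneg 0).trans (le_csSup hb ⟨0, rfl⟩)
  refine le_of_sq_le_sq ?_ (by positivity)
  rw [norm_sq_apply_eq_sum, mul_pow, ← T.singularBasis.sum_sq_inner_right v, Finset.mul_sum]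
  refine Finset.sum_le_sum fun i _ => ?_
  refine mul_le_mul_of_nonneg_right ?_ (sq_nonneg _)
  exact pow_le_pow_left₀ (T.singularValues_nonneg i) (le_csSup hb ⟨i, rfl⟩) 2

lemma sInf_mul_norm_le {v : E} (hv : v ∈ (ker T)ᗮ) :
    sInf {t : ℝ | t ≠ 0 ∧ t ∈ Set.range T.singularValues} * ‖v‖ ≤ ‖T v‖ := by
  set S := {t : ℝ | t ≠ 0 ∧ t ∈ Set.range T.singularValues} with hS
  have hb : BddBelow S := (T.finite_range_singularValues.subset fun t ht => ht.2).bddBelow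
  have h0 : 0 ≤ sInf S := Real.sInf_nonneg (by
    rintro _ ⟨-, i, rfl⟩; exact T.singularValues_nonneg i)
  refine le_of_sq_le_sq ?_ (norm_nonneg _)
  rw [norm_sq_apply_eq_sum, mul_pow, ← T.singularBasis.sum_sq_inner_right v, Finset.mul_sum]
  refine Finset.sum_le_sum fun i _ => ?_
  by_cases hi : T.singularValues i = 0
  · have : inner ℝ (T.singularBasis i) v = 0 := by
      refine (Submodule.mem_orthogonal _ _).1 hv _ ?_
      rw [mem_ker, ← norm_eq_zero, norm_apply_singularBasis, hi]
    rw [this]; simp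
  · exact mul_le_mul_of_nonneg_right (pow_le_pow_left₀ h0 (csInf_le hb ⟨hi, i, rfl⟩) 2)
      (sq_nonneg _)

lemma exists_singularValues_ne_zero (hT : T ≠ 0) : ∃ i, T.singularValues i ≠ 0 := by
  by_contra! h
  exact hT (T.singularValues_eq_zero_iff.1 (Finsupp.ext h))

lemma sInf_singularValues_pos (hT : T ≠ 0) :
    0 < sInf {t : ℝ | t ≠ 0 ∧ t ∈ Set.range T.singularValues} := by
  obtain ⟨i, hi⟩ := T.exists_singularValues_ne_zero hT
  have hne : {t : ℝ | t ≠ 0 ∧ t ∈ Set.range T.singularValues}.Nonempty := ⟨_, hi, i, rfl⟩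
  have hmem := hne.csInf_mem (T.finite_range_singularValues.subset fun t ht => ht.2)
  obtain ⟨j, hj⟩ := hmem.2
  exact lt_of_le_of_ne (hj ▸ T.singularValues_nonneg j) hmem.1.symm

/-- Every vector can be replaced by one with the same image whose norm is controlled by the norm of
the image, the condition number and the operator norm. -/
lemma exists_apply_eq_norm_le (hT : T ≠ 0) {c : ℝ} (hc : 0 < c)
    (hle : c ≤ sSup (Set.range T.singularValues)) (v : E) :
    ∃ w, T w = T v ∧ ‖w‖ ≤ sSup (Set.range T.singularValues) /
      sInf {t : ℝ | t ≠ 0 ∧ t ∈ Set.range T.singularValues} * ‖T v‖ / c := by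
  set m := sInf {t : ℝ | t ≠ 0 ∧ t ∈ Set.range T.singularValues} with hm
  have hm0 : 0 < m := T.sInf_singularValues_pos hT
  set w := v - (ker T).starProjection v with hw
  have hTw : T w = T v := by
    have : T ((ker T).starProjection v) = 0 := (ker T).starProjection_apply_mem v
    rw [hw, map_sub, this, sub_zero]
  refine ⟨w, hTw, ?_⟩
  have h1 := T.sInf_mul_norm_le ((ker T).sub_starProjection_mem_orthogonal v)
  change m * ‖w‖ ≤ ‖T w‖ at h1
  rw [hTw] at h1
  rw [div_mul_eq_mul_div, div_div, le_div_iff₀ (by positivity)]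
  calc ‖w‖ * (m * c) = (m * ‖w‖) * c := by ring
    _ ≤ ‖T v‖ * sSup (Set.range T.singularValues) := by gcongr
    _ = _ := by ring

lemma cond_le (hT : T ≠ 0) {C M : ℝ} (hC : 0 ≤ C) (hM : 0 < M) (h1 : ∀ v, ‖T v‖ ≤ C * ‖v‖)
    (h2 : ∀ v, ∃ w, T w = T v ∧ ‖w‖ ≤ M * ‖T v‖) :
    sSup (Set.range T.singularValues) /
      sInf {t : ℝ | t ≠ 0 ∧ t ∈ Set.range T.singularValues} ≤ C * M := by
  have hlt : ∀ i, T.singularValues i ≠ 0 → i < Module.finrank ℝ E := by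
    intro i hi
    by_contra! h
    exact hi (T.singularValues_of_finrank_le h)
  have hup : sSup (Set.range T.singularValues) ≤ C := by
    refine csSup_le (Set.range_nonempty _) ?_
    rintro _ ⟨i, rfl⟩
    by_cases hi : T.singularValues i = 0
    · rw [hi]; exact hC
    · have h := h1 (T.singularBasis ⟨i, hlt i hi⟩)
      rwa [norm_apply_singularBasis, T.singularBasis.norm_eq_one, mul_one] at h
  obtain ⟨i₀, hi₀⟩ := T.exists_singularValues_ne_zero hT
  have hlow : M⁻¹ ≤ sInf {t : ℝ | t ≠ 0 ∧ t ∈ Set.range T.singularValues} := by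
    refine le_csInf ⟨_, hi₀, i₀, rfl⟩ ?_
    rintro _ ⟨hi, i, rfl⟩
    set j : Fin (Module.finrank ℝ E) := ⟨i, hlt i hi⟩
    have hpos : 0 < T.singularValues i := (T.singularValues_pos_iff_ne_zero i).2 hi
    obtain ⟨w, hw, hwn⟩ := h2 (T.singularBasis j)
    rw [norm_apply_singularBasis] at hwn
    have e1 := T.inner_apply_singularBasis j w
    rw [hw, real_inner_self_eq_norm_sq, norm_apply_singularBasis] at e1
    have e2 : inner ℝ (T.singularBasis j) w = (1 : ℝ) := by
      have : T.singularValues i ^ 2 ≠ 0 := by positivity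
      exact mul_left_cancel₀ this (by rw [mul_one]; exact e1.symm)
    have e3 := real_inner_le_norm (T.singularBasis j) w
    rw [e2, T.singularBasis.norm_eq_one, one_mul] at e3
    rw [inv_le_iff_one_le_mul₀ hM, mul_comm]
    exact e3.trans hwn
  have hpos : 0 < M⁻¹ := by positivity
  rw [div_le_iff₀ (hpos.trans_le hlow)]
  refine hup.trans ?_
  calc C = C * M * M⁻¹ := by field_simp
    _ ≤ _ := by gcongr

end LinearMap

/-! ### The instance of a scaffold -/

namespace LEAInstance

lemma linMap_apply (I : LEAInstance) (x : EuclideanSpace ℝ (Fin I.n)) (i : Fin I.d) :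
    I.linMap x i = ∑ j, (I.A i j : ℝ) * x j := by
  rw [linMap, Matrix.toLpLin_apply]
  rfl

end LEAInstance

namespace Scaffold

/-- The number of edges of the complex. -/
abbrev numEdges (d L N : ℕ) : ℕ := (L + 1) * d * 3 + (L * d * 9 + N * 18)

/-- The number of triangles of the complex. -/
abbrev numTris (d L N : ℕ) : ℕ := L * d * 9 + N * 13

/-- The enumeration of the edges: rims level by level, then gadgets, then legs. -/
def edgeEquiv (d L N : ℕ) : Edge d L N ≃ Fin (numEdges d L N) :=
  (Equiv.sumCongr ((finProdFinEquiv.prodCongr (Equiv.refl _)).trans finProdFinEquiv)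
    ((Equiv.sumCongr ((finProdFinEquiv.prodCongr (Equiv.refl _)).trans finProdFinEquiv)
      finProdFinEquiv).trans finSumFinEquiv)).trans finSumFinEquiv

/-- The enumeration of the triangles: gadgets level by level, then legs. -/
def triEquiv (d L N : ℕ) : Tri d L N ≃ Fin (numTris d L N) :=
  (Equiv.sumCongr ((finProdFinEquiv.prodCongr (Equiv.refl _)).trans finProdFinEquiv)
      finProdFinEquiv).trans finSumFinEquiv

variable {d n L N : ℕ}

lemma edgeEquiv_rim (ρ : Fin (L + 1) × Fin d) (j : Fin 3) :
    (edgeEquiv d L N (.inl (ρ, j)) : ℕ) = 3 * (d * ρ.1 + ρ.2) + j := by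
  simp [edgeEquiv]; ring

lemma edgeEquiv_cross (g : Fin L × Fin d) (e : Fin 9) :
    (edgeEquiv d L N (.inr (.inl (g, e))) : ℕ) =
      (L + 1) * d * 3 + 9 * (d * g.1 + g.2) + e := by
  simp [edgeEquiv]; ring

lemma edgeEquiv_own (k : Fin N) (e : Fin 18) :
    (edgeEquiv d L N (.inr (.inr (k, e))) : ℕ) =
      (L + 1) * d * 3 + L * d * 9 + 18 * k + e := by
  simp [edgeEquiv]; ring

lemma triEquiv_gadget (g : Fin L × Fin d) (τ : Fin 9) :
    (triEquiv d L N (.inl (g, τ)) : ℕ) = 9 * (d * g.1 + g.2) + τ := by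
  simp [triEquiv]; ring

lemma triEquiv_leg (k : Fin N) (τ : Fin 13) :
    (triEquiv d L N (.inr (k, τ)) : ℕ) = L * d * 9 + 13 * k + τ := by
  simp [triEquiv]; ring

variable (S : Scaffold d n L N)

/-- The integral 1-chain with the value `b i` on the three edges of the lowest rim of row `i`. -/
def rhsInt (N : ℕ) {L : ℕ} (b : Fin d → ℤ) : Edge d L N → ℤ
  | .inl (ρ, _) => if ρ.1 = 0 then b ρ.2 else 0
  | .inr _ => 0

lemma rhsInt_cast (b : Fin d → ℤ) (e : Edge d L N) :
    (rhsInt N b e : ℝ) = rhsChain N (fun i => (b i : ℝ)) e := by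
  rcases e with ⟨ρ, j⟩ | e
  · simp only [rhsInt, rhsChain]; split_ifs <;> simp
  · simp [rhsInt, rhsChain]

/-- The linear equation approximation problem over the boundary matrix of a scaffold. -/
abbrev toInstance (b : Fin d → ℤ) (ε : ℝ) (h0 : 0 < ε) (h1 : ε ≤ 1) : LEAInstance where
  d := numEdges d L N
  n := numTris d L N
  A := fun i j => S.complex.incidence ((edgeEquiv d L N).symm i) ((triEquiv d L N).symm j)
  b := fun i => rhsInt N b ((edgeEquiv d L N).symm i)
  ε := ε
  ε_pos := h0
  ε_le_one := h1

lemma toInstance_mem (b : Fin d → ℤ) (ε : ℝ) (h0 : 0 < ε) (h1 : ε ≤ 1) (hN : 0 < N) :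
    boundaryMatrices (S.toInstance b ε h0 h1).d (S.toInstance b ε h0 h1).n
      (S.toInstance b ε h0 h1).A :=
  S.complex.boundaryMatrices_of_equiv _ _ (.inr (⟨0, hN⟩, 0))

lemma incidence_side (t : Tri d L N) (s : Fin 3) :
    S.complex.incidence (S.side t s) t = S.sgn t s := by
  rw [OrientedComplex.incidence, Finset.sum_eq_single s]
  · exact if_pos rfl
  · intro s' _ hs
    exact if_neg fun h => hs (S.complex.side_injective t h)
  · simp

lemma incidence_eq_zero {e : Edge d L N} {t : Tri d L N} (h : ∀ s, S.side t s ≠ e) :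
    S.complex.incidence e t = 0 :=
  Finset.sum_eq_zero fun s _ => if_neg (h s)

lemma sgn_ne_zero (t : Tri d L N) (s : Fin 3) : S.sgn t s ≠ 0 := by
  rcases S.complex.sgn_eq t s with h | h <;>
    · change S.sgn t s = _ at h
      rw [h]; norm_num

lemma natAbs_incidence_le (e : Edge d L N) (t : Tri d L N) :
    (S.complex.incidence e t).natAbs ≤ 1 := by
  by_cases h : ∃ s, S.side t s = e
  · obtain ⟨s, rfl⟩ := h
    rw [incidence_side]
    rcases S.complex.sgn_eq t s with h | h <;>
      · change S.sgn t s = _ at h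
        rw [h]; norm_num
  · push Not at h
    rw [S.incidence_eq_zero h]; norm_num

section Instance

variable (b : Fin d → ℤ) (ε : ℝ) (h0 : 0 < ε) (h1 : ε ≤ 1)

/-- The position of the `s`-th side of a triangle in the matrix. -/
def position (p : Tri d L N × Fin 3) : Fin (numEdges d L N) × Fin (numTris d L N) :=
  (edgeEquiv d L N (S.side p.1 p.2), triEquiv d L N p.1)

lemma position_injective : Function.Injective S.position := by
  rintro ⟨t, s⟩ ⟨t', s'⟩ h
  simp only [position, Prod.mk.injEq, EmbeddingLike.apply_eq_iff_eq] at h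
  obtain ⟨h, rfl⟩ := h
  rw [S.complex.side_injective t h]

lemma toInstance_support :
    (S.toInstance b ε h0 h1).support = Finset.univ.image S.position := by
  ext ⟨i, j⟩
  simp only [LEAInstance.support, Finset.mem_filter, Finset.mem_univ, true_and, Finset.mem_image]
  constructor
  · intro h
    by_contra hne
    refine h (S.incidence_eq_zero fun s hs => hne ⟨((triEquiv d L N).symm j, s), ?_⟩)
    simp only [position, hs]
    simp
  · rintro ⟨⟨t, s⟩, h⟩
    simp only [position, Prod.mk.injEq] at h
    obtain ⟨rfl, rfl⟩ := h
    rw [Equiv.symm_apply_apply, Equiv.symm_apply_apply, incidence_side]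
    exact S.sgn_ne_zero t s

lemma toInstance_nnz : (S.toInstance b ε h0 h1).nnz = numTris d L N * 3 := by
  rw [LEAInstance.nnz, toInstance_support, Finset.card_image_of_injective _ S.position_injective,
    Finset.card_univ, Fintype.card_prod, Fintype.card_congr (triEquiv d L N)]
  simp

lemma toInstance_entrySize_le {B : ℕ} (hB : 1 ≤ B) (hb : ∀ i, (b i).natAbs ≤ B) :
    (S.toInstance b ε h0 h1).entrySize ≤ B := by
  refine max_le (Finset.sup_le fun p _ => (S.natAbs_incidence_le _ _).trans hB)
    (Finset.sup_le fun i _ => ?_)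
  change (rhsInt N b _).natAbs ≤ B
  rcases (edgeEquiv d L N).symm i with ⟨ρ, j⟩ | e
  · simp only [rhsInt]; split_ifs
    · exact hb _
    · simp
  · simp [rhsInt]

lemma toInstance_storedAt {o : ℕ} {s : RAMState} (hd : s.nat o 0 = numEdges d L N)
    (hn : s.nat o 1 = numTris d L N) (hz : s.nat o 2 = numTris d L N * 3)
    (hA : ∀ (t : Tri d L N) (x : Fin 3),
      s.nat (o + 1) (3 * triEquiv d L N t + x) = edgeEquiv d L N (S.side t x) ∧
      s.nat (o + 2) (3 * triEquiv d L N t + x) = triEquiv d L N t ∧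
      s.real o (3 * triEquiv d L N t + x) = S.sgn t x)
    (hb : ∀ e, s.real (o + 1) (edgeEquiv d L N e) = rhsInt N b e)
    (hε : s.real (o + 2) 0 = ε) : (S.toInstance b ε h0 h1).StoredAt o s := by
  have hnnz := S.toInstance_nnz b ε h0 h1
  let num : Tri d L N × Fin 3 ≃ Fin (S.toInstance b ε h0 h1).nnz :=
    (((triEquiv d L N).prodCongr (Equiv.refl _)).trans finProdFinEquiv).trans
      (finCongr hnnz.symm)
  have hnum : ∀ t x, (num (t, x) : ℕ) = 3 * triEquiv d L N t + x := by
    intro t x; simp [num]; ring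
  refine ⟨hd, hn, hz.trans hnnz.symm, ⟨fun k => S.position (num.symm k), ?_, ?_⟩, ?_, hε⟩
  · rw [toInstance_support]
    refine ⟨fun k _ => by simp, fun k _ k' _ h => num.symm.injective (S.position_injective h), ?_⟩
    intro p hp
    simp only [Finset.coe_image, Finset.coe_univ, Set.image_univ, Set.mem_range] at hp
    obtain ⟨y, rfl⟩ := hp
    exact ⟨num y, trivial, by simp⟩
  · intro k
    obtain ⟨⟨t, x⟩, rfl⟩ := num.surjective k
    obtain ⟨a1, a2, a3⟩ := hA t x
    rw [hnum, a1, a2, a3]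
    simp only [Equiv.symm_apply_apply, position]
    rw [incidence_side]
    exact ⟨trivial, trivial, rfl⟩
  · intro i
    obtain ⟨e, rfl⟩ := (edgeEquiv d L N).surjective i
    rw [hb]
    simp

lemma toInstance_linMap_apply (y : EuclideanSpace ℝ (Fin (S.toInstance b ε h0 h1).n))
    (e : Edge d L N) :
    (S.toInstance b ε h0 h1).linMap y (edgeEquiv d L N e) =
      S.bd (fun t => y (triEquiv d L N t)) e := by
  rw [LEAInstance.linMap_apply, bd, ← (triEquiv d L N).sum_comp]
  refine Finset.sum_congr rfl fun t _ => ?_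
  simp

lemma toInstance_rhs_apply (e : Edge d L N) :
    (S.toInstance b ε h0 h1).rhs (edgeEquiv d L N e) = rhsChain N (fun i => (b i : ℝ)) e := by
  rw [← rhsInt_cast]
  simp [toInstance, LEAInstance.rhs]

/-- A linear equation approximation problem whose matrix is the boundary matrix of a scaffold and
whose right-hand side is the chain with the values `b` on the lowest rims. -/
structure Model (S : Scaffold d n L N) (b : Fin d → ℤ) (J : LEAInstance) where
  edge : Edge d L N ≃ Fin J.d
  tri : Tri d L N ≃ Fin J.n
  linMap_apply : ∀ y e, J.linMap y (edge e) = S.bd (fun t => y (tri t)) e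
  rhs_apply : ∀ e, J.rhs (edge e) = rhsChain N (fun i => (b i : ℝ)) e

end Instance

end Scaffold

/-! ### Solutions and condition number of the instance -/

lemma EuclideanSpace.abs_apply_le_norm {ι : Type*} [Fintype ι] (x : EuclideanSpace ℝ ι) (i : ι) :
    |x i| ≤ ‖x‖ := by
  simpa using PiLp.norm_apply_le x i

lemma EuclideanSpace.norm_le_sum_abs {ι : Type*} [Fintype ι] (x : EuclideanSpace ℝ ι) :
    ‖x‖ ≤ ∑ i, |x i| := by
  rw [EuclideanSpace.norm_eq]
  refine Real.sqrt_le_iff.2 ⟨Finset.sum_nonneg fun i _ => abs_nonneg _, ?_⟩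
  simp only [Real.norm_eq_abs]
  exact Finset.sum_sq_le_sq_sum_of_nonneg fun i _ => abs_nonneg _

lemma EuclideanSpace.inner_eq_sum {ι : Type*} [Fintype ι] (x y : EuclideanSpace ℝ ι) :
    inner ℝ x y = ∑ i, x i * y i := by
  simp [PiLp.inner_apply, mul_comm]

namespace LEAInstance

variable (I : LEAInstance)

lemma projRhs_mem : I.projRhs ∈ LinearMap.range I.linMap :=
  Submodule.starProjection_apply_mem _ _

lemma rhs_sub_projRhs_mem : I.rhs - I.projRhs ∈ (LinearMap.range I.linMap)ᗮ :=
  Submodule.sub_starProjection_mem_orthogonal _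

lemma norm_projRhs_le : ‖I.projRhs‖ ≤ ‖I.rhs‖ :=
  Submodule.norm_starProjection_apply_le _ _

lemma norm_rhs_sub_projRhs_le (x : EuclideanSpace ℝ (Fin I.n)) :
    ‖I.rhs - I.projRhs‖ ≤ ‖I.rhs - I.linMap x‖ := by
  have hmem : I.projRhs - I.linMap x ∈ LinearMap.range I.linMap :=
    sub_mem I.projRhs_mem ⟨x, rfl⟩
  have h0 : inner ℝ (I.rhs - I.projRhs) (I.projRhs - I.linMap x) = (0 : ℝ) := by
    rw [real_inner_comm]
    exact (Submodule.mem_orthogonal _ _).1 I.rhs_sub_projRhs_mem _ hmem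
  have h := norm_add_sq_eq_norm_sq_add_norm_sq_of_inner_eq_zero _ _ h0
  rw [sub_add_sub_cancel] at h
  nlinarith [norm_nonneg (I.rhs - I.projRhs), norm_nonneg (I.rhs - I.linMap x),
    norm_nonneg (I.projRhs - I.linMap x)]

end LEAInstance

namespace Scaffold

variable {L N : ℕ}

section Analysis

variable {d n : ℕ} {S : Scaffold d n L N} {b : Fin d → ℤ} {J : LEAInstance}

lemma Model.isCocycle_of_mem_orthogonal (m : S.Model b J)
    {r : EuclideanSpace ℝ (Fin J.d)}
    (hr : r ∈ (LinearMap.range J.linMap)ᗮ) :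
    S.IsCocycle fun e => r (m.edge e) := by
  intro t
  set y : EuclideanSpace ℝ (Fin J.n) :=
    WithLp.toLp 2 (Pi.single (m.tri t) 1) with hy
  have h := (Submodule.mem_orthogonal _ _).1 hr _ ⟨y, rfl⟩
  rw [EuclideanSpace.inner_eq_sum, ← (m.edge).sum_comp] at h
  simp only [m.linMap_apply] at h
  have h2 := S.sum_mul_bd (fun e => r (m.edge e)) (fun t => y (m.tri t))
  simp only [mul_comm (r _)] at h2
  rw [h, Finset.sum_eq_single t] at h2
  · simpa [hy, mul_comm] using h2.symm
  · intro t' _ ht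
    simp [hy, ht]
  · simp

lemma Model.norm_rhs (m : S.Model b J) :
    ‖J.rhs‖ ^ 2 = 3 * ∑ i, (b i : ℝ) ^ 2 := by
  rw [EuclideanSpace.norm_sq_eq, ← (m.edge).sum_comp]
  simp only [m.rhs_apply, Real.norm_eq_abs, sq_abs]
  rw [Fintype.sum_sum_type]
  simp only [rhsChain, Fintype.sum_prod_type, Fin.sum_univ_three]
  rw [Finset.sum_eq_single 0 (by intro l _ hl; simp [hl]) (by simp)]
  simp [Finset.mul_sum]
  exact Finset.sum_congr rfl fun i _ => by ring

/-- The residual of the optimal solution is small: the equations can be satisfied except on the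
highest rims, where an error has been halved `L` times. -/
lemma Model.norm_residual (m : S.Model b J) (hL : 0 < L) :
    ‖J.rhs - J.projRhs‖ ^ 2 ≤
      3 * (∑ i, (b i : ℝ) ^ 2) / (2 ^ L) ^ 2 := by
  set c : Fin d → ℝ := fun i => (b i : ℝ)
  set y : EuclideanSpace ℝ (Fin J.n) :=
    WithLp.toLp 2 (fun j => S.layered 0 (S.carry 0 c) ((m.tri).symm j)) with hy
  have hye : ∀ e, J.linMap y (m.edge e) = S.bd (S.layered 0 (S.carry 0 c)) e := by
    intro e
    rw [m.linMap_apply]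
    simp [hy]
  have h := J.norm_rhs_sub_projRhs_le y
  refine (pow_le_pow_left₀ (norm_nonneg _) h 2).trans ?_
  rw [EuclideanSpace.norm_sq_eq, ← (m.edge).sum_comp]
  have hrhs : ∀ e, J.rhs (m.edge e) = rhsChain N c e := fun e => by
    rw [m.rhs_apply]
  simp only [PiLp.sub_apply, hye, hrhs, Real.norm_eq_abs, sq_abs]
  rw [Fintype.sum_sum_type]
  simp only [bd_layered_inr, S.bd_layered_carry hL 0 c, Fintype.sum_prod_type, Fin.sum_univ_three]
  rw [Finset.sum_eq_single (Fin.last L) (by intro l _ hl; simp [hl]) (by simp)]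
  simp [rhsChain, div_pow, Finset.mul_sum, Finset.sum_div]
  exact Finset.sum_le_sum fun i _ => le_of_eq (by ring)

end Analysis

lemma norm_toLp_le_of_sum {d : ℕ} {c : ℝ} {e : Fin d → ℝ} (h : ∑ i, |e i| ≤ c) :
    ‖(WithLp.toLp 2 e : EuclideanSpace ℝ (Fin d))‖ ≤ c :=
  (EuclideanSpace.norm_le_sum_abs _).trans h

/-- The part of a solution on representatives of the columns is a solution of the encoded problem.
The residual of the optimal solution is a cocycle, which contributes to the encoded equations a
vector orthogonal to the image of the encoded matrix; all other errors are small. -/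
lemma Model.norm_linMap_sub_projRhs_le (I : LEAInstance) (S : Scaffold I.d I.n L N)
    (hS : S.matrix = I.A) (hL : 0 < L) {J : LEAInstance} (m : S.Model I.b J)
    (y : EuclideanSpace ℝ (Fin J.n)) (hy : J.IsSolution y) :
    ‖I.linMap (WithLp.toLp 2 fun j => y (m.tri (.inr (S.rep j, 0)))) - I.projRhs‖ ≤
      (S.weight * (19 * N) * (1 / 2 ^ L + J.ε) + I.d * (4 * 2 ^ L) * J.ε) * (2 * ‖I.rhs‖) := by
  set x : EuclideanSpace ℝ (Fin I.n) :=
    WithLp.toLp 2 fun j => y (m.tri (.inr (S.rep j, 0))) with hx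
  have hb : ∑ i, (I.b i : ℝ) ^ 2 = ‖I.rhs‖ ^ 2 := by
    rw [EuclideanSpace.norm_sq_eq]
    simp [LEAInstance.rhs]
  have hJr : ‖J.rhs‖ ≤ 2 * ‖I.rhs‖ := by
    have h := m.norm_rhs
    rw [hb] at h
    refine le_of_sq_le_sq ?_ (by positivity)
    nlinarith [sq_nonneg ‖I.rhs‖]
  have hres : ‖J.rhs - J.projRhs‖ ≤ 2 * ‖I.rhs‖ * (1 / 2 ^ L) := by
    have h := m.norm_residual hL
    rw [hb] at h
    refine le_of_sq_le_sq (h.trans ?_) (by positivity)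
    rw [mul_pow, div_pow, one_pow, mul_one_div]
    gcongr
    nlinarith [sq_nonneg ‖I.rhs‖]
  have hδ : ‖J.projRhs - J.linMap y‖ ≤ 2 * ‖I.rhs‖ * J.ε := by
    rw [norm_sub_rev]
    refine le_trans hy ?_
    rw [mul_comm]
    exact mul_le_mul_of_nonneg_right (J.norm_projRhs_le.trans hJr) J.ε_pos.le
  set f : Tri I.d L N → ℝ := fun t => y (m.tri t) with hf
  set rs : Edge I.d L N → ℝ := fun e => (J.rhs - J.projRhs) (m.edge e) with hrs
  set rd : Edge I.d L N → ℝ := fun e => (J.projRhs - J.linMap y) (m.edge e) with hrd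
  have hcoc : S.IsCocycle rs := m.isCocycle_of_mem_orthogonal J.rhs_sub_projRhs_mem
  have hdec : S.bd f = fun e => (fun e => rhsChain N (fun i => (I.b i : ℝ)) e - rs e) e - rd e := by
    funext e
    simp only [hrs, hrd, PiLp.sub_apply]
    rw [m.rhs_apply, m.linMap_apply]
    ring
  have hrs1 : ∀ e, |rs e| ≤ 2 * ‖I.rhs‖ * (1 / 2 ^ L) := fun e =>
    (EuclideanSpace.abs_apply_le_norm _ _).trans hres
  have hrd1 : ∀ e, |rd e| ≤ 2 * ‖I.rhs‖ * J.ε := fun e =>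
    (EuclideanSpace.abs_apply_le_norm _ _).trans hδ
  have hβ : ∀ e, |S.bd f (.inr e)| ≤ 2 * ‖I.rhs‖ * (1 / 2 ^ L + J.ε) := by
    intro e
    rw [hdec]
    simp only [rhsChain, zero_sub]
    rw [mul_add]
    refine (abs_sub _ _).trans ?_
    rw [abs_neg]
    exact add_le_add (hrs1 _) (hrd1 _)
  set h : Fin I.d → ℝ := fun i => loopSum rs (0, i) with hh
  set lam : ℝ := slackWeight L / 3 with hlam
  set e : Fin I.d → ℝ := fun i => I.linMap x i - I.b i + lam * h i with he
  have hrow : ∀ i, rowDefect (S.bd f) i = 3 * I.b i - slackWeight L * h i - rowDefect rd i := by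
    intro i
    rw [hdec, rowDefect_sub, rowDefect_sub, rowDefect_rhsChain, hcoc.rowDefect_eq]
  have hxi : ∀ i, I.linMap x i = ∑ j, (S.matrix i j : ℝ) * f (.inr (S.rep j, 0)) := by
    intro i
    rw [LEAInstance.linMap_apply, hS]
  have hesum : ∑ i, |e i| ≤
      (S.weight * (19 * N) * (1 / 2 ^ L + J.ε) + I.d * (4 * 2 ^ L) * J.ε) * (2 * ‖I.rhs‖) := by
    have a1 := S.sum_abs_row_sub_le hβ
    have a2 := fun i => abs_rowDefect_le hrd1 i
    have : ∀ i, |e i| ≤ |∑ j, (S.matrix i j : ℝ) * f (.inr (S.rep j, 0)) -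
        rowDefect (S.bd f) i / 3| + 12 * 2 ^ L * (2 * ‖I.rhs‖ * J.ε) / 3 := by
      intro i
      have : e i = (∑ j, (S.matrix i j : ℝ) * f (.inr (S.rep j, 0)) -
        rowDefect (S.bd f) i / 3) - rowDefect rd i / 3 := by
        rw [he, hrow, ← hxi]; simp only [hlam]; ring
      rw [this]
      refine (abs_sub _ _).trans ?_
      gcongr
      rw [abs_div, abs_of_pos (by norm_num : (0 : ℝ) < 3)]
      gcongr
      exact a2 i
    refine (Finset.sum_le_sum fun i _ => this i).trans ?_
    rw [Finset.sum_add_distrib, Finset.sum_const, Finset.card_univ, Fintype.card_fin, nsmul_eq_mul]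
    refine (add_le_add a1 le_rfl).trans (le_of_eq ?_)
    ring
  refine le_trans ?_ (norm_toLp_le_of_sum hesum)
  set v := I.linMap x - I.projRhs with hv
  have hvmem : v ∈ LinearMap.range I.linMap := sub_mem ⟨x, rfl⟩ I.projRhs_mem
  have hvh : ∑ i, v i * h i = 0 := by
    obtain ⟨u, hu⟩ := hvmem
    rw [← hu, ← hcoc.sum_loopSum_mul S (fun j => u j), hS]
    refine Finset.sum_congr rfl fun i _ => ?_
    rw [LEAInstance.linMap_apply, mul_comm]
  have hvb : ∑ i, v i * (I.rhs - I.projRhs) i = 0 := by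
    rw [← EuclideanSpace.inner_eq_sum]
    exact (Submodule.mem_orthogonal _ _).1 I.rhs_sub_projRhs_mem _ hvmem
  set E : EuclideanSpace ℝ (Fin I.d) := WithLp.toLp 2 e with hE
  have hvv : inner ℝ v v = (inner ℝ v E : ℝ) := by
    rw [EuclideanSpace.inner_eq_sum, EuclideanSpace.inner_eq_sum]
    have : ∀ i, v i * v i = v i * E i - lam * (v i * h i) + v i * (I.rhs - I.projRhs) i := by
      intro i
      simp only [hv, hE, he, LEAInstance.rhs, PiLp.sub_apply]
      ring
    simp only [this, Finset.sum_add_distrib, Finset.sum_sub_distrib, ← Finset.mul_sum, hvh, hvb]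
    ring
  by_cases hv0 : ‖v‖ = 0
  · rw [hv0]; positivity
  · have := real_inner_le_norm v E
    rw [← hvv, real_inner_self_eq_norm_sq, sq] at this
    exact le_of_mul_le_mul_left this (by positivity)

lemma Model.numTris_eq {d n : ℕ} {S : Scaffold d n L N} {b : Fin d → ℤ} {J : LEAInstance}
    (m : S.Model b J) : J.n = numTris d L N := by
  have := Fintype.card_congr (m.tri.symm.trans (triEquiv d L N))
  simpa using this

lemma sum_abs_incidence_le {d n : ℕ} (S : Scaffold d n L N) (t : Tri d L N) :
    ∑ e, |(S.complex.incidence e t : ℝ)| ≤ 3 := by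
  have : ∀ e, |(S.complex.incidence e t : ℝ)| ≤ ∑ s : Fin 3, if S.side t s = e then 1 else 0 := by
    intro e
    rw [OrientedComplex.incidence]
    push_cast
    refine (Finset.abs_sum_le_sum_abs _ _).trans (Finset.sum_le_sum fun s _ => ?_)
    change |if S.side t s = e then (S.complex.sgn t s : ℝ) else 0| ≤ _
    split_ifs
    · rcases S.complex.sgn_eq t s with h | h <;> rw [h] <;> simp
    · simp
  refine (Finset.sum_le_sum fun e _ => this e).trans ?_
  rw [Finset.sum_comm]
  simp

lemma Model.norm_linMap_le {d n : ℕ} {S : Scaffold d n L N} {b : Fin d → ℤ} {J : LEAInstance}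
    (m : S.Model b J) (y : EuclideanSpace ℝ (Fin J.n)) : ‖J.linMap y‖ ≤ 3 * J.n * ‖y‖ := by
  refine (EuclideanSpace.norm_le_sum_abs _).trans ?_
  rw [← m.edge.sum_comp]
  simp only [m.linMap_apply, bd]
  have : ∀ e, |∑ t, (S.complex.incidence e t : ℝ) * y (m.tri t)| ≤
      ∑ t, |(S.complex.incidence e t : ℝ)| * ‖y‖ := by
    intro e
    refine (Finset.abs_sum_le_sum_abs _ _).trans (Finset.sum_le_sum fun t _ => ?_)
    rw [abs_mul]
    gcongr
    exact EuclideanSpace.abs_apply_le_norm _ _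
  refine (Finset.sum_le_sum fun e _ => this e).trans ?_
  rw [Finset.sum_comm]
  simp only [← Finset.sum_mul]
  gcongr
  refine (Finset.sum_le_sum fun t _ => S.sum_abs_incidence_le t).trans (le_of_eq ?_)
  rw [Finset.sum_const, Finset.card_univ, m.numTris_eq, Fintype.card_congr (triEquiv d L N)]
  simp [mul_comm]

lemma Model.linMap_ne_zero {d n : ℕ} {S : Scaffold d n L N} {b : Fin d → ℤ} {J : LEAInstance}
    (m : S.Model b J) (t : Tri d L N) : J.linMap ≠ 0 := by
  intro h
  have h1 := m.linMap_apply (WithLp.toLp 2 (Pi.single (m.tri t) 1)) (S.side t 0)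
  rw [h, bd, Finset.sum_eq_single t] at h1
  · simp [incidence_side] at h1
    exact S.sgn_ne_zero t 0 (by exact_mod_cast h1.symm)
  · intro t' _ ht
    simp [ht]
  · simp

/-- The condition number of the instance is polynomially bounded. After subtracting an element of
the kernel, a 2-chain is controlled by its boundary: its values on representatives of the columns
can be replaced by a short vector with the same image under the encoded matrix. -/
lemma Model.cond_le {I : LEAInstance} {S : Scaffold I.d I.n L N} {J : LEAInstance}
    (m : S.Model I.b J) (hS : S.matrix = I.A) (hL : 0 < L) (hN : 0 < N) (hI : I.linMap ≠ 0)
    (hσ : 1 ≤ sSup (Set.range I.linMap.singularValues)) :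
    J.cond ≤ 3 * J.n * (J.n * (2 ^ L * (9 + (N + 1) *
      (I.cond * (I.d * (4 * 2 ^ L) + S.weight * (19 * N)) + 19 * N)))) := by
  have hκ : 0 ≤ I.cond := div_nonneg (zero_le_one.trans hσ)
    (LinearMap.sInf_singularValues_pos _ hI).le
  have hJn : (0 : ℝ) < J.n := by
    rw [m.numTris_eq]
    have : 0 < numTris I.d L N := by unfold numTris; omega
    exact_mod_cast this
  refine LinearMap.cond_le _ (m.linMap_ne_zero (.inr (⟨0, hN⟩, 0))) (by positivity)
    (by positivity) m.norm_linMap_le fun y => ?_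
  set f : Tri I.d L N → ℝ := fun t => y (m.tri t) with hf
  set β := ‖J.linMap y‖ with hβ
  have hβ0 : 0 ≤ β := norm_nonneg _
  have hbd : ∀ e, |S.bd f e| ≤ β := fun e => by
    rw [← m.linMap_apply]; exact EuclideanSpace.abs_apply_le_norm _ _
  set x : EuclideanSpace ℝ (Fin I.n) := WithLp.toLp 2 fun j => f (.inr (S.rep j, 0)) with hx
  have hxi : ∀ i, I.linMap x i = ∑ j, (S.matrix i j : ℝ) * f (.inr (S.rep j, 0)) := by
    intro i
    rw [LEAInstance.linMap_apply, hS]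
  have hAx : ‖I.linMap x‖ ≤ (I.d * (4 * 2 ^ L) + S.weight * (19 * N)) * β := by
    refine (EuclideanSpace.norm_le_sum_abs _).trans ?_
    have : ∀ i, |I.linMap x i| ≤ 12 * 2 ^ L * β / 3 +
        |∑ j, (S.matrix i j : ℝ) * f (.inr (S.rep j, 0)) - rowDefect (S.bd f) i / 3| := by
      intro i
      have a1 := abs_rowDefect_le hbd i
      rw [← hxi]
      have a2 : |rowDefect (S.bd f) i / 3| ≤ 12 * 2 ^ L * β / 3 := by
        rw [abs_div, abs_of_pos (by norm_num : (0 : ℝ) < 3)]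
        gcongr
      have a3 := abs_add_le (rowDefect (S.bd f) i / 3) (I.linMap x i - rowDefect (S.bd f) i / 3)
      rw [add_sub_cancel] at a3
      linarith
    refine (Finset.sum_le_sum fun i _ => this i).trans ?_
    rw [Finset.sum_add_distrib, Finset.sum_const, Finset.card_univ, Fintype.card_fin, nsmul_eq_mul]
    refine (add_le_add le_rfl (S.sum_abs_row_sub_le fun e => hbd _)).trans (le_of_eq ?_)
    ring
  obtain ⟨w, hw, hwn⟩ := I.linMap.exists_apply_eq_norm_le hI one_pos hσ x
  rw [div_one] at hwn
  change ‖w‖ ≤ I.cond * _ at hwn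
  set ξ := I.cond * ((I.d * (4 * 2 ^ L) + S.weight * (19 * N)) * β) with hξ
  have hwξ : ‖w‖ ≤ ξ := hwn.trans (mul_le_mul_of_nonneg_left hAx hκ)
  set u : Fin I.n → ℝ := fun j => x j - w j with hu
  have hAu : ∀ i, ∑ k, (S.matrix i k : ℝ) * u k = 0 := by
    intro i
    have : I.linMap (x - w) i = 0 := by rw [map_sub, hw, sub_self]; rfl
    rw [LEAInstance.linMap_apply] at this
    rw [hS]
    exact this
  set f' : Tri I.d L N → ℝ := fun t => f t - S.layered u (S.carry u 0) t with hf'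
  have hker : ∀ e, S.bd (S.layered u (S.carry u 0)) e = 0 := by
    rintro (⟨ρ, j⟩ | e)
    · have h := S.bd_layered_carry hL u 0 ρ j
      rw [hAu] at h
      simpa [rhsChain] using h
    · exact S.bd_layered_inr _ _ e
  have hbd' : ∀ e, S.bd f' e = S.bd f e := fun e => by rw [hf', bd_sub, hker, sub_zero]
  have hle : ∀ t, |f' t| ≤ 2 ^ L * (9 * β + (N + 1) * (ξ + 19 * N * β)) := by
    refine S.abs_le_of_bd hβ0 (by positivity) (fun e => by rw [hbd']; exact hbd e) fun j => ?_
    have : f' (.inr (S.rep j, 0)) = w j := by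
      simp [hf', layered, S.col_rep, hu, hx]
    rw [this]
    exact (EuclideanSpace.abs_apply_le_norm _ _).trans hwξ
  refine ⟨WithLp.toLp 2 fun j => f' (m.tri.symm j), ?_, ?_⟩
  · ext i
    obtain ⟨e, rfl⟩ := m.edge.surjective i
    rw [m.linMap_apply, m.linMap_apply]
    simpa using hbd' e
  · refine (EuclideanSpace.norm_le_sum_abs _).trans ?_
    refine (Finset.sum_le_sum fun i _ => hle _).trans (le_of_eq ?_)
    rw [Finset.sum_const, Finset.card_univ, Fintype.card_fin, nsmul_eq_mul, hξ]
    ring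

end Scaffold

/-! ### Running programs -/

namespace RAMState

@[simp] lemma setNat_nat (s : RAMState) (a k v b : ℕ) :
    (s.setNat a k v).nat b = if b = a then Function.update (s.nat a) k v else s.nat b := by
  simp [setNat, Function.update_apply]

@[simp] lemma setNat_real (s : RAMState) (a k v : ℕ) : (s.setNat a k v).real = s.real := rfl

@[simp] lemma setReal_real (s : RAMState) (a k : ℕ) (v : ℝ) (b : ℕ) :
    (s.setReal a k v).real b = if b = a then Function.update (s.real a) k v else s.real b := by
  simp [setReal, Function.update_apply]

@[simp] lemma setReal_nat (s : RAMState) (a k : ℕ) (v : ℝ) : (s.setReal a k v).nat = s.nat := rfl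

end RAMState

namespace Program

/-- The program contains a write to the `a`-th array of naturals. -/
def writesNat (a : ℕ) : Program → Bool
  | skip => false
  | setNat b _ _ => a == b
  | setReal _ _ _ => false
  | seq p q => p.writesNat a || q.writesNat a
  | ite _ p q => p.writesNat a || q.writesNat a
  | loop _ p => p.writesNat a

/-- The program contains a write to the `a`-th array of reals. -/
def writesReal (a : ℕ) : Program → Bool
  | skip => false
  | setNat _ _ _ => false
  | setReal b _ _ => a == b
  | seq p q => p.writesReal a || q.writesReal a
  | ite _ p q => p.writesReal a || q.writesReal a
  | loop _ p => p.writesReal a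

/-- The program contains no loop. -/
def loopFree : Program → Bool
  | skip => true
  | setNat _ _ _ => true
  | setReal _ _ _ => true
  | seq p q => p.loopFree && q.loopFree
  | ite _ p q => p.loopFree && q.loopFree
  | loop _ _ => false

open Classical in
/-- The effect of a program without loops. -/
noncomputable def exec : Program → RAMState → RAMState
  | skip, s => s
  | setNat a i e, s => s.setNat a (i.eval s) (e.eval s)
  | setReal a i e, s => s.setReal a (i.eval s) (e.eval s)
  | seq p q, s => q.exec (p.exec s)
  | ite c p q, s => if c.Holds s then p.exec s else q.exec s
  | loop _ _, s => s

/-- A bound for the number of operations of a program without loops. -/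
def maxCost : Program → ℕ
  | skip => 1
  | setNat _ i e => i.cost + e.cost + 1
  | setReal _ i e => i.cost + e.cost + 1
  | seq p q => p.maxCost + q.maxCost
  | ite c p q => c.cost + (p.maxCost + q.maxCost) + 1
  | loop _ _ => 0

end Program

lemma Runs.nat_eq {p : Program} {s s' : RAMState} {t : ℕ} (h : Runs p s s' t) {a : ℕ}
    (ha : p.writesNat a = false) : s'.nat a = s.nat a := by
  induction h with
  | skip | loopDone => rfl
  | setNat b i e s => simp [Program.writesNat] at ha; simp [ha]
  | setReal b i e s => rfl
  | seq _ _ ih1 ih2 =>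
    simp [Program.writesNat] at ha
    rw [ih2 ha.2, ih1 ha.1]
  | iteTrue _ _ ih => simp [Program.writesNat] at ha; exact ih ha.1
  | iteFalse _ _ ih => simp [Program.writesNat] at ha; exact ih ha.2
  | loopStep _ _ _ ih1 ih2 => rw [ih2 ha, ih1 ha]

lemma Runs.real_eq {p : Program} {s s' : RAMState} {t : ℕ} (h : Runs p s s' t) {a : ℕ}
    (ha : p.writesReal a = false) : s'.real a = s.real a := by
  induction h with
  | skip | loopDone => rfl
  | setReal b i e s => simp [Program.writesReal] at ha; simp [ha]
  | setNat b i e s => rfl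
  | seq _ _ ih1 ih2 =>
    simp [Program.writesReal] at ha
    rw [ih2 ha.2, ih1 ha.1]
  | iteTrue _ _ ih => simp [Program.writesReal] at ha; exact ih ha.1
  | iteFalse _ _ ih => simp [Program.writesReal] at ha; exact ih ha.2
  | loopStep _ _ _ ih1 ih2 => rw [ih2 ha, ih1 ha]

/-- Started in `s`, the program `p` halts after at most `T` operations in a state with the
property `Q`. -/
def Reaches (p : Program) (s : RAMState) (T : ℕ) (Q : RAMState → Prop) : Prop :=
  ∃ s' t, Runs p s s' t ∧ t ≤ T ∧ Q s'

/-- The states differ only in arrays to which the program writes. -/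
structure Frame (p : Program) (s s' : RAMState) : Prop where
  nat_eq : ∀ {a}, p.writesNat a = false → s'.nat a = s.nat a
  real_eq : ∀ {a}, p.writesReal a = false → s'.real a = s.real a

lemma Frame.refl (p : Program) (s : RAMState) : Frame p s s := ⟨fun _ => rfl, fun _ => rfl⟩

lemma Frame.trans {p : Program} {s s' s'' : RAMState} (h : Frame p s s') (h' : Frame p s' s'') :
    Frame p s s'' :=
  ⟨fun ha => (h'.nat_eq ha).trans (h.nat_eq ha), fun ha => (h'.real_eq ha).trans (h.real_eq ha)⟩

lemma Runs.frame {p : Program} {s s' : RAMState} {t : ℕ} (h : Runs p s s' t) : Frame p s s' :=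
  ⟨fun ha => h.nat_eq ha, fun ha => h.real_eq ha⟩

namespace Reaches

variable {p q : Program} {s : RAMState} {T T' : ℕ} {Q Q' : RAMState → Prop}

lemma mono (h : Reaches p s T Q) (hT : T ≤ T') (hQ : ∀ s', Q s' → Frame p s s' → Q' s') :
    Reaches p s T' Q' := by
  obtain ⟨s', t, h1, h2, h3⟩ := h
  exact ⟨s', t, h1, h2.trans hT, hQ s' h3 h1.frame⟩

lemma seq (h : Reaches p s T Q) (h' : ∀ s', Q s' → Frame p s s' → Reaches q s' T' Q') :
    Reaches (.seq p q) s (T + T') Q' := by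
  obtain ⟨s', t, h1, h2, h3⟩ := h
  obtain ⟨s'', t', h4, h5, h6⟩ := h' s' h3 h1.frame
  exact ⟨s'', t + t', h1.seq h4, add_le_add h2 h5, h6⟩

lemma of_loopFree (hp : p.loopFree = true) (h : Q (p.exec s)) : Reaches p s p.maxCost Q := by
  suffices H : ∃ t, Runs p s (p.exec s) t ∧ t ≤ p.maxCost from
    let ⟨t, h1, h2⟩ := H; ⟨_, t, h1, h2, h⟩
  clear h
  induction p generalizing s with
  | skip => exact ⟨_, .skip s, le_rfl⟩
  | setNat a i e => exact ⟨_, .setNat a i e s, le_rfl⟩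
  | setReal a i e => exact ⟨_, .setReal a i e s, le_rfl⟩
  | seq p q ihp ihq =>
    simp [Program.loopFree] at hp
    obtain ⟨t, h1, h2⟩ := ihp (s := s) hp.1
    obtain ⟨t', h3, h4⟩ := ihq (s := p.exec s) hp.2
    exact ⟨_, h1.seq h3, add_le_add h2 h4⟩
  | ite c p q ihp ihq =>
    simp [Program.loopFree] at hp
    by_cases hc : c.Holds s
    · obtain ⟨t, h1, h2⟩ := ihp (s := s) hp.1
      simp only [Program.exec, Program.maxCost, if_pos hc]
      exact ⟨_, .iteTrue hc h1, by omega⟩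
    · obtain ⟨t, h1, h2⟩ := ihq (s := s) hp.2
      simp only [Program.exec, Program.maxCost, if_neg hc]
      exact ⟨_, .iteFalse hc h1, by omega⟩
  | loop c p => simp [Program.loopFree] at hp

lemma ite {c : Test} (h : c.Holds s → Reaches p s T Q) (h' : ¬ c.Holds s → Reaches q s T Q) :
    Reaches (.ite c p q) s (c.cost + T + 1) Q := by
  by_cases hc : c.Holds s
  · obtain ⟨s', t, h1, h2, h3⟩ := h hc
    exact ⟨s', _, .iteTrue hc h1, by omega, h3⟩
  · obtain ⟨s', t, h1, h2, h3⟩ := h' hc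
    exact ⟨s', _, .iteFalse hc h1, by omega, h3⟩

/-- A loop that is passed `n` times, by means of an invariant `R`. -/
lemma loop {c : Test} (n : ℕ) (R : ℕ → RAMState → Prop) (h0 : R 0 s)
    (hstep : ∀ k < n, ∀ s', R k s' → Frame p s s' → c.Holds s' ∧ Reaches p s' T (R (k + 1)))
    (hend : ∀ s', R n s' → Frame p s s' → ¬ c.Holds s') :
    Reaches (.loop c p) s (n * (T + c.cost + 1) + c.cost + 1) (R n) := by
  suffices H : ∀ m k, k + m = n → ∀ s', R k s' → Frame p s s' →
      Reaches (.loop c p) s' (m * (T + c.cost + 1) + c.cost + 1) (R n) from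
    H n 0 (zero_add n) s h0 (Frame.refl p s)
  intro m
  induction m with
  | zero =>
    intro k hk s' hR hf
    obtain rfl : k = n := hk
    exact ⟨s', _, .loopDone (hend s' hR hf), by omega, hR⟩
  | succ m ih =>
    intro k hk s' hR hf
    obtain ⟨hc, s1, t1, r1, b1, R1⟩ := hstep k (by omega) s' hR hf
    obtain ⟨s2, t2, r2, b2, R2⟩ := ih (k + 1) (by omega) s1 R1 (hf.trans r1.frame)
    refine ⟨s2, _, .loopStep hc r1 r2, ?_, R2⟩
    have : (m + 1) * (T + c.cost + 1) = m * (T + c.cost + 1) + (T + c.cost + 1) := by ring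
    omega

end Reaches

namespace NatExpr

/-- The first cell of an array of naturals, used as a register. -/
def reg (a : ℕ) : NatExpr := .read a (.lit 0)

/-- A fixed multiple of an expression. -/
def times (e : NatExpr) : ℕ → NatExpr
  | 0 => .lit 0
  | c + 1 => .add (e.times c) e

@[simp] lemma eval_reg (a : ℕ) (s : RAMState) : (reg a).eval s = s.nat a 0 := rfl

@[simp] lemma eval_times (e : NatExpr) (c : ℕ) (s : RAMState) :
    (e.times c).eval s = c * e.eval s := by
  induction c with
  | zero => simp [times, eval]
  | succ c ih => simp [times, eval, ih]; ring

end NatExpr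

/-- The first cell of an array of reals, used as a register. -/
def RealExpr.reg (a : ℕ) : RealExpr := .read a (.lit 0)

@[simp] lemma RealExpr.eval_reg (a : ℕ) (s : RAMState) : (RealExpr.reg a).eval s = s.real a 0 := rfl

namespace Program

/-- Repeat `body` with the values `0, 1, …` less than the value of `e` in the register `a`. -/
def forTo (a : ℕ) (e : NatExpr) (body : Program) : Program :=
  .seq (.setNat a (.lit 0) (.lit 0))
    (.loop (.natLE (.add (.reg a) (.lit 1)) e)
      (.seq body (.setNat a (.lit 0) (.add (.reg a) (.lit 1)))))

@[simp] lemma writesNat_forTo (b a : ℕ) (e : NatExpr) (body : Program) :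
    (forTo a e body).writesNat b = (b == a || body.writesNat b) := by
  simp [forTo, writesNat, Bool.or_comm]

@[simp] lemma writesReal_forTo (b a : ℕ) (e : NatExpr) (body : Program) :
    (forTo a e body).writesReal b = body.writesReal b := by
  simp [forTo, writesReal]

end Program

/-- A counting loop, by means of an invariant `R` that does not depend on the counter. -/
lemma Reaches.forTo {a : ℕ} {e : NatExpr} {body : Program} {s : RAMState} {T : ℕ} (n : ℕ)
    (R : ℕ → RAMState → Prop) (ha : body.writesNat a = false)
    (he : ∀ s', Frame (.forTo a e body) s s' → e.eval s' = n)
    (hctr : ∀ k s' v, R k s' → R k (s'.setNat a 0 v)) (h0 : R 0 s)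
    (hstep : ∀ k < n, ∀ s', R k s' → s'.nat a 0 = k → Frame (.forTo a e body) s s' →
      Reaches body s' T (R (k + 1))) :
    Reaches (.forTo a e body) s (n * (T + e.cost + 12) + e.cost + 9) (R n) := by
  set p := Program.forTo a e body with hp
  have h1 : Reaches (.setNat a (.lit 0) (.lit 0)) s 3 (fun s' => R 0 s' ∧ s'.nat a 0 = 0) :=
    Reaches.of_loopFree (p := .setNat a (.lit 0) (.lit 0)) rfl
      ⟨hctr 0 s 0 h0, by simp [Program.exec, NatExpr.eval]⟩
  have hle : ∀ s' s'', Frame (.setNat a (.lit 0) (.lit 0)) s' s'' → Frame p s' s'' := by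
    intro s' s'' h
    exact ⟨fun {b} hb => h.nat_eq (by simp [hp] at hb; simp [Program.writesNat, hb.1]),
      fun {b} hb => h.real_eq rfl⟩
  have hle2 : ∀ s' s'',
      Frame (.seq body (.setNat a (.lit 0) (.add (.reg a) (.lit 1)))) s' s'' → Frame p s' s'' := by
    intro s' s'' h
    refine ⟨fun {b} hb => h.nat_eq (by simp [hp] at hb; simp [Program.writesNat, hb]),
      fun {b} hb => h.real_eq (by simp [hp] at hb; simp [Program.writesReal, hb])⟩
  refine (h1.seq (T' := n * (T + e.cost + 12) + e.cost + 6)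
    (Q' := R n) fun s1 hR1 hf1 => ?_).mono (by omega) (fun _ h _ => h)
  refine (Reaches.loop (T := T + 6) n (fun k s' => R k s' ∧ s'.nat a 0 = k) hR1 ?_ ?_).mono ?_
    (fun _ h _ => h.1)
  · intro k hk s' hR hf
    have hf' : Frame p s s' := (hle _ _ hf1).trans (hle2 _ _ hf)
    refine ⟨?_, (hstep k hk s' hR.1 hR.2 hf').seq fun s'' hR'' hf'' => ?_⟩
    · simp only [Test.Holds, NatExpr.eval, NatExpr.eval_reg, hR.2, he s' hf']
      omega
    · have hk'' : s''.nat a 0 = k := by rw [hf''.nat_eq ha, hR.2]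
      refine Reaches.of_loopFree (p := .setNat a (.lit 0) (.add (.reg a) (.lit 1))) rfl ?_
      refine ⟨hctr _ _ _ hR'', ?_⟩
      simp [Program.exec, NatExpr.eval, hk'']
  · intro s' hR hf
    have hf' : Frame p s s' := (hle _ _ hf1).trans (hle2 _ _ hf)
    simp only [Test.Holds, NatExpr.eval, NatExpr.eval_reg, hR.2, he s' hf']
    omega
  · simp only [Test.cost, NatExpr.cost, NatExpr.reg]
    have : T + 6 + (1 + 1 + 1 + 1 + e.cost + 1) + 1 = T + e.cost + 12 := by omega
    rw [this]
    omega

/-! ### Binary digits of the entries -/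

/-- The positions below `l` of the digits 1 in the greedy binary expansion of `m`, in decreasing
order. -/
def bits : ℕ → ℕ → List ℕ
  | 0, _ => []
  | l + 1, m => if 2 ^ l ≤ m then l :: bits l (m - 2 ^ l) else bits l m

lemma lt_of_mem_bits {l m x : ℕ} (h : x ∈ bits l m) : x < l := by
  induction l generalizing m with
  | zero => simp [bits] at h
  | succ l ih =>
    rw [bits] at h
    split_ifs at h
    · rcases List.mem_cons.1 h with rfl | h
      · omega
      · exact (ih h).trans (Nat.lt_succ_self l)
    · exact (ih h).trans (Nat.lt_succ_self l)

lemma sum_bits {l m : ℕ} (h : m < 2 ^ l) : ((bits l m).map (2 ^ ·)).sum = m := by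
  induction l generalizing m with
  | zero => simp at h; simp [bits, h]
  | succ l ih =>
    rw [bits]
    split_ifs with h1
    · rw [List.map_cons, List.sum_cons, ih (by rw [pow_succ] at h; omega)]
      omega
    · exact ih (by omega)

lemma length_bits_le (l m : ℕ) : (bits l m).length ≤ l := by
  induction l generalizing m with
  | zero => simp [bits]
  | succ l ih =>
    rw [bits]
    split_ifs
    · simpa using ih _
    · exact (ih m).trans (Nat.le_succ l)

/-- A binary digit 1 of an entry of a matrix. -/
structure Digit where
  level : ℕ
  row : ℕ
  col : ℕ
  neg : Bool

/-- The contents of the memory when a problem with `m` nonzero entries is loaded. -/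
structure Sparse where
  d : ℕ
  n : ℕ
  m : ℕ
  row : ℕ → ℕ
  col : ℕ → ℕ
  val : ℕ → ℤ
  rhs : ℕ → ℤ
  ε : ℝ

namespace Sparse

variable (X : Sparse)

/-- The problem is loaded. -/
structure Loaded (s : RAMState) : Prop where
  rows : s.nat 0 0 = X.d
  cols : s.nat 0 1 = X.n
  size : s.nat 0 2 = X.m
  row : ∀ k < X.m, s.nat 1 k = X.row k
  col : ∀ k < X.m, s.nat 2 k = X.col k
  val : ∀ k < X.m, s.real 0 k = X.val k
  rhs : ∀ i < X.d, s.real 1 i = X.rhs i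
  accuracy : s.real 2 0 = X.ε

/-- A measure of the size of the problem that is easy to compute. -/
noncomputable def bulk : ℝ :=
  X.m + 1 / X.ε + ∑ k ∈ Finset.range X.m, (X.val k : ℝ) * X.val k +
    ∑ i ∈ Finset.range X.d, (X.rhs i : ℝ) * X.rhs i

/-- The order of magnitude from which on a power of two is precise enough. -/
noncomputable def threshold : ℝ := 100 * X.bulk * X.bulk * X.bulk * X.bulk

lemma exists_threshold_le : ∃ L : ℕ, X.threshold ≤ 2 ^ L :=
  (pow_unbounded_of_one_lt X.threshold one_lt_two).imp fun _ h => h.le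

open Classical in
/-- The number of levels. -/
noncomputable def levels : ℕ := Nat.find X.exists_threshold_le

lemma threshold_le : X.threshold ≤ 2 ^ X.levels := by
  classical exact Nat.find_spec X.exists_threshold_le

lemma lt_threshold {l : ℕ} (h : l < X.levels) : 2 ^ l < X.threshold := by
  classical exact not_le.1 (Nat.find_min X.exists_threshold_le h)

/-- The binary digits of the `k`-th entry. -/
noncomputable def digitsAt (k : ℕ) : List Digit :=
  (bits X.levels (X.val k).natAbs).map fun l => ⟨l, X.row k, X.col k, decide (X.val k < 0)⟩

/-- The binary digits of the first `k` entries. -/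
noncomputable def digitsBelow (k : ℕ) : List Digit := (List.range k).flatMap X.digitsAt

/-- The binary digits of all entries. -/
noncomputable def digits : List Digit := X.digitsBelow X.m

lemma digitsBelow_succ (k : ℕ) : X.digitsBelow (k + 1) = X.digitsBelow k ++ X.digitsAt k := by
  simp [digitsBelow, List.range_succ]

/-! ### The common part of the programs -/

/-!
An array is called a register if only its first cell is used. The naturals `8` and `9` are loop
counters, `10` is the number of levels, `11` the table of the multiples of the number of rows, `12`
the number of legs, `13`, `14`, `15` are the rims, signs and columns of the legs, `16` is the last
leg met in each column, `17` the table of the successors of the legs, and `20` the sign of the entry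
that is being expanded. The real `8` is the bulk, `9` the table of the powers of two, `10` what is
left of the entry that is being expanded, `13` the threshold, and `11` and `12` serve the test
whether the solution is zero.
-/

/-- Computes the bulk in the register `8`. -/
def bulkProg : Program :=
  .seq (.setReal 8 (.lit 0) (.add (.ofNat (.read 0 (.lit 2))) (.div (.ofNat (.lit 1)) (.reg 2))))
    (.seq
      (.forTo 8 (.read 0 (.lit 2)) (.setReal 8 (.lit 0)
        (.add (.reg 8) (.mul (.read 0 (.reg 8)) (.read 0 (.reg 8))))))
      (.forTo 8 (.read 0 (.lit 0)) (.setReal 8 (.lit 0)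
        (.add (.reg 8) (.mul (.read 1 (.reg 8)) (.read 1 (.reg 8)))))))

variable {X}

lemma Loaded.congr {s s' : RAMState} (h : X.Loaded s) (hn : ∀ a < 3, s'.nat a = s.nat a)
    (hr : ∀ a < 3, s'.real a = s.real a) : X.Loaded s' := by
  obtain ⟨h1, h2, h3, h4, h5, h6, h7, h8⟩ := h
  constructor <;> simp only [hn 0 (by norm_num), hn 1 (by norm_num), hn 2 (by norm_num),
    hr 0 (by norm_num), hr 1 (by norm_num), hr 2 (by norm_num)] <;> assumption

lemma Loaded.frame {s s' : RAMState} {p : Program} (h : X.Loaded s) (hf : Frame p s s')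
    (hn : ∀ a < 3, p.writesNat a = false := by decide)
    (hr : ∀ a < 3, p.writesReal a = false := by decide) : X.Loaded s' :=
  h.congr (fun a ha => hf.nat_eq (hn a ha)) (fun a ha => hf.real_eq (hr a ha))

lemma bulkProg_spec {s : RAMState} (h : X.Loaded s) :
    Reaches bulkProg s (40 * X.m + 40 * X.d + 60) fun s' => s'.real 8 0 = X.bulk := by
  have h1 := Reaches.of_loopFree (s := s)
    (p := .setReal 8 (.lit 0) (.add (.ofNat (.read 0 (.lit 2))) (.div (.ofNat (.lit 1)) (.reg 2))))
    (Q := fun s' => s'.real 8 0 = X.m + 1 / X.ε) rfl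
    (by simp [Program.exec, RealExpr.eval, NatExpr.eval, h.size, h.accuracy])
  refine (h1.seq fun s1 hs1 hf1 => Reaches.seq (Reaches.forTo (T := 14) X.m (fun k s' =>
    s'.real 8 0 = X.m + 1 / X.ε + ∑ k ∈ Finset.range k, (X.val k : ℝ) * X.val k) rfl ?_ ?_ ?_ ?_)
      fun s2 hs2 hf2 => Reaches.forTo (T := 14) X.d (fun i s' =>
    s'.real 8 0 = X.m + 1 / X.ε + ∑ k ∈ Finset.range X.m, (X.val k : ℝ) * X.val k +
      ∑ i ∈ Finset.range i, (X.rhs i : ℝ) * X.rhs i) rfl ?_ ?_ ?_ ?_).mono ?_ ?_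
  · exact fun s' hf => ((h.frame hf1).frame hf).size
  · exact fun k s' v hR => hR
  · simpa using hs1
  · intro k hk s' hR hc hf
    refine (Reaches.of_loopFree rfl ?_).mono (T := _) (by decide) fun _ h _ => h
    have := ((h.frame hf1).frame hf).val k hk
    simp [Program.exec, RealExpr.eval, NatExpr.eval, hc, hR, this, Finset.sum_range_succ]
    ring
  · exact fun s' hf => (((h.frame hf1).frame hf2).frame hf).rows
  · exact fun k s' v hR => hR
  · simpa using hs2
  · intro k hk s' hR hc hf
    refine (Reaches.of_loopFree rfl ?_).mono (T := _) (by decide) fun _ h _ => h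
    have := (((h.frame hf1).frame hf2).frame hf).rhs k hk
    simp [Program.exec, RealExpr.eval, NatExpr.eval, hc, hR, this, Finset.sum_range_succ]
    ring
  · simp only [Program.maxCost, NatExpr.cost, RealExpr.cost, RealExpr.reg]
    omega
  · exact fun s' hs' _ => hs'

/-- Computes the number of levels in the register `10`, and tables of the powers of two and of the
multiples of the number of rows. -/
def levelProg : Program :=
  .seq
    (.seq (.setReal 13 (.lit 0)
      (.mul (.mul (.mul (.mul (.ofNat (.lit 100)) (.reg 8)) (.reg 8)) (.reg 8)) (.reg 8)))
    (.seq (.setReal 9 (.lit 0) (.ofNat (.lit 1)))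
    (.seq (.setNat 11 (.lit 0) (.lit 0)) (.setNat 10 (.lit 0) (.lit 0)))))
    (.loop (.neg (.realLE (.reg 13) (.read 9 (.reg 10))))
      (.seq (.setReal 9 (.add (.reg 10) (.lit 1)) (.add (.read 9 (.reg 10)) (.read 9 (.reg 10))))
      (.seq (.setNat 11 (.add (.reg 10) (.lit 1)) (.add (.read 11 (.reg 10)) (.reg 0)))
        (.setNat 10 (.lit 0) (.add (.reg 10) (.lit 1))))))

variable (X) in
/-- The tables computed by `levelProg` up to the level `k`. -/
structure Tables (k : ℕ) (s : RAMState) : Prop where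
  top : s.nat 10 0 = k
  pow : ∀ l ≤ k, s.real 9 l = 2 ^ l
  mul : ∀ l ≤ k, s.nat 11 l = X.d * l

lemma levelProg_spec {s : RAMState} (h : X.Loaded s) (h8 : s.real 8 0 = X.bulk) :
    Reaches levelProg s (50 * X.levels + 60) (X.Tables X.levels) := by
  refine (Reaches.seq (Q := fun s1 => s1.real 13 0 = X.threshold ∧ X.Tables 0 s1)
    (Reaches.of_loopFree rfl ⟨?_, ?_⟩) fun s1 hs1 hf1 =>
    Reaches.loop (T := 30) X.levels X.Tables hs1.2 ?_ ?_).mono ?_ fun _ h _ => h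
  · simp [Program.exec, RealExpr.eval, NatExpr.eval, h8, threshold]
  · constructor <;> simp [Program.exec, RealExpr.eval, NatExpr.eval]
  · intro k hk s' hR hf
    have hd : s'.nat 0 0 = X.d := ((h.frame hf1).frame hf).rows
    have ht : s'.real 13 0 = X.threshold := (congrFun (hf.real_eq rfl) 0).trans hs1.1
    refine ⟨?_, (Reaches.of_loopFree rfl ?_).mono (T := _) (by decide) fun _ h _ => h⟩
    · simp only [Test.Holds, RealExpr.eval, RealExpr.eval_reg, NatExpr.eval_reg, hR.top, ht,
        hR.pow k le_rfl, not_le]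
      exact X.lt_threshold hk
    · constructor
      · simp [Program.exec, NatExpr.eval, hR.top]
      · intro l hl
        simp only [Program.exec, NatExpr.eval, hR.top, RealExpr.eval, NatExpr.eval_reg,
          hR.pow k le_rfl, RAMState.setReal_real, RAMState.setNat_real, if_true]
        rw [Function.update_apply]
        split_ifs with h
        · rw [h]; ring
        · exact hR.pow l (by omega)
      · intro l hl
        simp [Program.exec, NatExpr.eval, hR.top, hR.mul k le_rfl, hd]
        rw [Function.update_apply]
        split_ifs with h
        · rw [h]; ring
        · exact hR.mul l (by omega)
  · intro s' hR hf
    have ht : s'.real 13 0 = X.threshold := (congrFun (hf.real_eq rfl) 0).trans hs1.1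
    simp only [Test.Holds, RealExpr.eval, RealExpr.eval_reg, NatExpr.eval_reg, hR.top, ht,
      hR.pow _ le_rfl, not_not]
    exact X.threshold_le
  · simp only [Program.maxCost, NatExpr.cost, RealExpr.cost, Test.cost, NatExpr.reg, RealExpr.reg]
    omega

/-- Appends the binary digits of all entries to the list in the arrays `13`, `14`, `15`, whose
length is in the register `12`. -/
def digitProg : Program :=
  .seq (.setNat 12 (.lit 0) (.lit 0))
    (.forTo 8 (.read 0 (.lit 2))
      (.seq
        (.seq (.setNat 9 (.lit 0) (.reg 10))
          (.ite (.realLE (.ofNat (.lit 0)) (.read 0 (.reg 8)))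
            (.seq (.setNat 20 (.lit 0) (.lit 0)) (.setReal 10 (.lit 0) (.read 0 (.reg 8))))
            (.seq (.setNat 20 (.lit 0) (.lit 1))
              (.setReal 10 (.lit 0) (.sub (.ofNat (.lit 0)) (.read 0 (.reg 8)))))))
        (.loop (.natLE (.lit 1) (.reg 9))
          (.seq (.setNat 9 (.lit 0) (.sub (.reg 9) (.lit 1)))
            (.ite (.realLE (.read 9 (.reg 9)) (.reg 10))
              (.seq (.setReal 10 (.lit 0) (.sub (.reg 10) (.read 9 (.reg 9))))
              (.seq (.setNat 13 (.reg 12) (.add (.read 11 (.reg 9)) (.read 1 (.reg 8))))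
              (.seq (.setNat 14 (.reg 12) (.reg 20))
              (.seq (.setNat 15 (.reg 12) (.read 2 (.reg 8)))
                (.setNat 12 (.lit 0) (.add (.reg 12) (.lit 1)))))))
              .skip)))))

variable (X) in
/-- A list of digits is stored. -/
structure Listed (ls : List Digit) (s : RAMState) : Prop where
  length : s.nat 12 0 = ls.length
  loop : ∀ i x, ls[i]? = some x → s.nat 13 i = X.d * x.level + x.row
  neg : ∀ i x, ls[i]? = some x → s.nat 14 i = if x.neg then 1 else 0
  col : ∀ i x, ls[i]? = some x → s.nat 15 i = x.col

lemma Listed.congr {ls : List Digit} {s s' : RAMState} (h : X.Listed ls s)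
    (h12 : s'.nat 12 = s.nat 12) (h13 : s'.nat 13 = s.nat 13) (h14 : s'.nat 14 = s.nat 14)
    (h15 : s'.nat 15 = s.nat 15) : X.Listed ls s' := by
  obtain ⟨h1, h2, h3, h4⟩ := h
  constructor <;> simp only [h12, h13, h14, h15] <;> assumption

lemma getElem?_append_singleton {ls : List Digit} {x y : Digit} {i : ℕ}
    (h : (ls ++ [x])[i]? = some y) :
    (i = ls.length ∧ y = x) ∨ (i ≠ ls.length ∧ ls[i]? = some y) := by
  rcases lt_trichotomy i ls.length with hi | rfl | hi
  · rw [List.getElem?_append_left hi] at h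
    exact Or.inr ⟨hi.ne, h⟩
  · simp at h
    exact Or.inl ⟨rfl, h.symm⟩
  · rw [List.getElem?_eq_none (by simp; omega)] at h
    cases h

lemma Tables.congr {k : ℕ} {s s' : RAMState} (h : X.Tables k s) (h10 : s'.nat 10 = s.nat 10)
    (h11 : s'.nat 11 = s.nat 11) (h9 : s'.real 9 = s.real 9) : X.Tables k s' := by
  obtain ⟨h1, h2, h3⟩ := h
  constructor <;> simp only [h10, h11, h9] <;> assumption

variable (X) in
/-- The list of digits of the current entry is complete except for those below the level `l`. -/
def Pending (k l : ℕ) (s : RAMState) : Prop :=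
  s.nat 9 0 = l ∧ ∃ ls r, X.Listed ls s ∧ s.real 10 0 = (r : ℕ) ∧
    ls ++ (bits l r).map (fun l => ⟨l, X.row k, X.col k, decide (X.val k < 0)⟩) =
      X.digitsBelow (k + 1)

lemma digitProg_spec {s : RAMState} (h : X.Loaded s) (hT : X.Tables X.levels s) :
    Reaches digitProg s (X.m * (60 * X.levels + 90) + 20) (X.Listed X.digits) := by
  have h1 : Reaches (.setNat 12 (.lit 0) (.lit 0)) s 3 (X.Listed (X.digitsBelow 0)) :=
    Reaches.of_loopFree (p := .setNat 12 (.lit 0) (.lit 0)) rfl (by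
      constructor <;> simp [Program.exec, NatExpr.eval, digitsBelow])
  refine (h1.seq fun s1 hs1 hf1 => Reaches.forTo (T := 60 * X.levels + 60) X.m
    (fun k => X.Listed (X.digitsBelow k)) rfl ?_ ?_ hs1 ?_).mono ?_ fun _ h _ => h
  · exact fun s' hf => ((h.frame hf1).frame hf).size
  · exact fun k s' v hR => hR.congr rfl rfl rfl rfl
  · intro k hk s2 hR hc hf2
    have hl2 := (h.frame hf1).frame hf2
    have hT2 : X.Tables X.levels s2 := (hT.congr (hf1.nat_eq rfl) (hf1.nat_eq rfl)
      (hf1.real_eq rfl)).congr (hf2.nat_eq rfl) (hf2.nat_eq rfl) (hf2.real_eq rfl)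
    refine (Reaches.seq (Q := fun s3 => X.Pending k X.levels s3 ∧
      s3.nat 20 0 = if X.val k < 0 then 1 else 0) (Reaches.of_loopFree rfl ?_)
      fun s3 hs3 hf3 => (Reaches.loop (T := 50) X.levels
        (fun j => X.Pending k (X.levels - j)) hs3.1 ?_ ?_).mono le_rfl ?_).mono ?_ fun _ h _ => h
    · have hv := hl2.val k hk
      by_cases h0 : 0 ≤ X.val k
      · have h0' : (0 : ℝ) ≤ X.val k := by exact_mod_cast h0
        simp only [Program.exec, Test.Holds, RealExpr.eval, NatExpr.eval, NatExpr.eval_reg]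
        simp only [hv, hc, RAMState.setNat_real, RAMState.setNat_nat, Nat.cast_zero, if_pos h0',
          Nat.reduceEqDiff, if_false]
        refine ⟨⟨?_, X.digitsBelow k, (X.val k).natAbs, hR.congr rfl rfl rfl rfl, ?_, ?_⟩, ?_⟩
        · simp [hT2.top]
        · simp [Nat.cast_natAbs, abs_of_nonneg h0]
        · rw [digitsBelow_succ]; rfl
        · simp [not_lt.2 h0]
      · have h0' : ¬ (0 : ℝ) ≤ X.val k := by exact_mod_cast h0
        simp only [Program.exec, Test.Holds, RealExpr.eval, NatExpr.eval, NatExpr.eval_reg]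
        simp only [hv, hc, RAMState.setNat_real, RAMState.setNat_nat, Nat.cast_zero, if_neg h0',
          Nat.reduceEqDiff, if_false]
        refine ⟨⟨?_, X.digitsBelow k, (X.val k).natAbs, hR.congr rfl rfl rfl rfl, ?_, ?_⟩, ?_⟩
        · simp [hT2.top]
        · simp [Nat.cast_natAbs, abs_of_neg (not_le.1 h0)]
        · rw [digitsBelow_succ]; rfl
        · simp [not_le.1 h0]
    · intro j hj s4 hP hf4
      obtain ⟨h9, ls, r, hL, h10, hls⟩ := hP
      have hl4 := (hl2.frame hf3).frame hf4
      have hT4 : X.Tables X.levels s4 := (hT2.congr (hf3.nat_eq rfl) (hf3.nat_eq rfl)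
        (hf3.real_eq rfl)).congr (hf4.nat_eq rfl) (hf4.nat_eq rfl) (hf4.real_eq rfl)
      have hc4 : s4.nat 8 0 = k := by rw [hf4.nat_eq rfl, hf3.nat_eq rfl, hc]
      have h20 : s4.nat 20 0 = if X.val k < 0 then 1 else 0 := by rw [hf4.nat_eq rfl, hs3.2]
      have hsub : X.levels - j = (X.levels - (j + 1)) + 1 := by omega
      rw [hsub] at h9 hls
      set l := X.levels - (j + 1) with hl
      refine ⟨by simp [Test.Holds, NatExpr.eval, h9],
        (Reaches.of_loopFree rfl ?_).mono (T := _) (by decide) fun _ h _ => h⟩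
      have hpow := hT4.pow l (by omega)
      have hmul := hT4.mul l (by omega)
      simp only [Program.exec, Test.Holds, RealExpr.eval, NatExpr.eval, NatExpr.eval_reg,
        RealExpr.eval_reg]
      simp only [RAMState.setNat_real, RAMState.setNat_nat, if_true, Function.update_self, h9,
        Nat.add_sub_cancel, hpow, h10]
      by_cases hle : 2 ^ l ≤ r
      · have hle' : (2 : ℝ) ^ l ≤ (r : ℝ) := by exact_mod_cast hle
        rw [if_pos hle']
        rw [bits, if_pos hle, List.map_cons] at hls
        refine ⟨?_, ls ++ [⟨l, X.row k, X.col k, decide (X.val k < 0)⟩], r - 2 ^ l, ?_, ?_, ?_⟩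
        · simp
        · constructor
          · simp [hL.length]
          · intro i x hx
            simp [hL.length, hmul, hc4, hl4.row k hk, Function.update_apply]
            rcases getElem?_append_singleton hx with ⟨hi, rfl⟩ | ⟨hi, hx⟩
            · simp [hi]
            · simp [hi, hL.loop i x hx]
          · intro i x hx
            simp [hL.length, h20, Function.update_apply]
            rcases getElem?_append_singleton hx with ⟨hi, rfl⟩ | ⟨hi, hx⟩
            · simp [hi]
            · simp [hi, hL.neg i x hx]
          · intro i x hx
            simp [hL.length, hc4, hl4.col k hk, Function.update_apply]
            rcases getElem?_append_singleton hx with ⟨hi, rfl⟩ | ⟨hi, hx⟩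
            · simp [hi]
            · simp [hi, hL.col i x hx]
        · simp [Nat.cast_sub hle]
        · rw [List.append_assoc, List.singleton_append]; exact hls
      · have hle' : ¬ (2 : ℝ) ^ l ≤ (r : ℝ) := by exact_mod_cast hle
        rw [if_neg hle']
        rw [bits, if_neg hle] at hls
        exact ⟨by simp, ls, r, hL.congr rfl rfl rfl rfl, by simpa using h10, hls⟩
    · intro s4 hP hf4
      have := hP.1
      simp [Test.Holds, NatExpr.eval, this]
    · rintro s4 ⟨-, ls, r, hL, -, hls⟩ -
      rw [Nat.sub_self, bits, List.map_nil, List.append_nil] at hls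
      rwa [hls] at hL
    · simp only [Program.maxCost, NatExpr.cost, RealExpr.cost, Test.cost, NatExpr.reg]
      omega
  · simp only [NatExpr.cost]
    ring_nf
    omega

end Sparse

/-! ### The scaffold of a sparse matrix -/

/-- Started from the table `init`, the table of the last index below `k` at which `c` takes a given
value. -/
def lastIndex (c init : ℕ → ℕ) : ℕ → ℕ → ℕ
  | 0 => init
  | k + 1 => Function.update (lastIndex c init k) (c k) k

lemma lastIndex_spec (c init : ℕ → ℕ) (k j : ℕ) :
    ((∀ i < k, c i ≠ j) ∧ lastIndex c init k j = init j) ∨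
    (lastIndex c init k j < k ∧ c (lastIndex c init k j) = j ∧
      ∀ i, lastIndex c init k j < i → i < k → c i ≠ j) := by
  induction k with
  | zero => exact Or.inl ⟨by omega, rfl⟩
  | succ k ih =>
    rw [lastIndex, Function.update_apply]
    by_cases hj : j = c k
    · rw [if_pos hj]
      exact Or.inr ⟨by omega, hj.symm, by omega⟩
    · rw [if_neg hj]
      have aux : ∀ i, i < k + 1 → (i < k ∨ i = k) := by omega
      rcases ih with ⟨h1, h2⟩ | ⟨h1, h2, h3⟩
      · refine Or.inl ⟨fun i hi => ?_, h2⟩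
        rcases aux i hi with hi | rfl
        · exact h1 i hi
        · exact fun h => hj h.symm
      · refine Or.inr ⟨by omega, h2, fun i hl hi => ?_⟩
        rcases aux i hi with hi | rfl
        · exact h3 i hl hi
        · exact fun h => hj h.symm

/-- The last index below `N` at which `c` takes the value `j`. -/
def ringLast (c : ℕ → ℕ) (N j : ℕ) : ℕ := lastIndex c (fun _ => 0) N j

/-- The previous index at which `c` takes the same value; the last one for the first one. -/
def ringNext (c : ℕ → ℕ) (N k : ℕ) : ℕ := lastIndex c (ringLast c N) k (c k)

section Ring

variable {c : ℕ → ℕ} {N k : ℕ}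

lemma ringLast_spec {j : ℕ} (hk : k < N) (hj : c k = j) :
    ringLast c N j < N ∧ c (ringLast c N j) = j ∧ k ≤ ringLast c N j := by
  rcases lastIndex_spec c (fun _ => 0) N j with ⟨h, -⟩ | ⟨h1, h2, h3⟩
  · exact absurd hj (h k hk)
  · refine ⟨h1, h2, ?_⟩
    by_contra! h
    exact h3 k h hk hj

lemma ringNext_spec (c : ℕ → ℕ) (N k : ℕ) :
    ((∀ i < k, c i ≠ c k) ∧ ringNext c N k = ringLast c N (c k)) ∨
    (ringNext c N k < k ∧ c (ringNext c N k) = c k ∧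
      ∀ i, ringNext c N k < i → i < k → c i ≠ c k) :=
  lastIndex_spec c _ k (c k)

lemma ringNext_lt (hk : k < N) : ringNext c N k < N := by
  rcases ringNext_spec c N k with ⟨-, h⟩ | ⟨h, -⟩
  · rw [h]; exact (ringLast_spec hk rfl).1
  · exact h.trans hk

lemma apply_ringNext (hk : k < N) : c (ringNext c N k) = c k := by
  rcases ringNext_spec c N k with ⟨-, h⟩ | ⟨-, h, -⟩
  · rw [h]; exact (ringLast_spec hk rfl).2.1
  · exact h

lemma ringNext_ne_of_lt {k' : ℕ} (hk' : k' < N) (h : k < k') :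
    ringNext c N k ≠ ringNext c N k' := by
  intro he
  have hk := h.trans hk'
  have hc : c k = c k' :=
    (apply_ringNext (c := c) hk).symm.trans ((congrArg c he).trans (apply_ringNext hk'))
  rcases ringNext_spec c N k' with ⟨h1, -⟩ | ⟨h1, h2, h3⟩
  · exact h1 k h hc
  · have hle : k ≤ ringNext c N k' := by
      by_contra! hlt
      exact h3 k hlt h hc
    rcases ringNext_spec c N k with ⟨-, g⟩ | ⟨g1, -, -⟩
    · have := (ringLast_spec hk' hc.symm).2.2
      omega
    · omega

lemma exists_iterate_ringNext (hk : k < N) :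
    ∃ m ≤ k + 1, (ringNext c N)^[m] k = ringLast c N (c k) := by
  induction k using Nat.strong_induction_on with
  | _ k ih =>
    rcases ringNext_spec c N k with ⟨-, h⟩ | ⟨h1, h2, -⟩
    · exact ⟨1, by omega, by simpa using h⟩
    · obtain ⟨m, hm, he⟩ := ih _ h1 (h1.trans hk)
      refine ⟨m + 1, by omega, ?_⟩
      rw [Function.iterate_succ_apply, he, h2]

end Ring

namespace Sparse

variable (X : Sparse)

/-- The stored matrix has no zero columns, and its stored entries are nonzero. -/
structure Valid : Prop where
  row_lt : ∀ k < X.m, X.row k < X.d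
  col_lt : ∀ k < X.m, X.col k < X.n
  val_ne : ∀ k < X.m, X.val k ≠ 0
  exists_col : ∀ j < X.n, ∃ k < X.m, X.col k = j
  size_pos : 0 < X.m
  ε_pos : 0 < X.ε

variable {X} (hX : X.Valid)

include hX in
lemma Valid.one_le_bulk : 1 ≤ X.bulk := by
  have h1 : (1 : ℝ) ≤ X.m := by exact_mod_cast hX.size_pos
  have h2 : 0 ≤ 1 / X.ε := by have := hX.ε_pos; positivity
  have h3 : 0 ≤ ∑ k ∈ Finset.range X.m, (X.val k : ℝ) * X.val k :=
    Finset.sum_nonneg fun _ _ => mul_self_nonneg _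
  have h4 : 0 ≤ ∑ i ∈ Finset.range X.d, (X.rhs i : ℝ) * X.rhs i :=
    Finset.sum_nonneg fun _ _ => mul_self_nonneg _
  unfold bulk
  linarith

include hX in
lemma Valid.bulk_lt_threshold : X.bulk < X.threshold := by
  have h := hX.one_le_bulk
  unfold threshold
  have h2 : 1 ≤ X.bulk * X.bulk := by nlinarith
  have h3 : X.bulk ≤ X.bulk * X.bulk * X.bulk := by nlinarith
  have h4 : 1 * 1 ≤ (X.bulk * X.bulk) * (X.bulk * X.bulk) := by
    exact mul_le_mul h2 h2 (by norm_num) (by positivity)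
  nlinarith

include hX in
lemma Valid.sum_natAbs_le_bulk : (∑ k ∈ Finset.range X.m, (X.val k).natAbs : ℕ) ≤ X.bulk := by
  have h2 : 0 ≤ 1 / X.ε := by have := hX.ε_pos; positivity
  have h4 : 0 ≤ ∑ i ∈ Finset.range X.d, (X.rhs i : ℝ) * X.rhs i :=
    Finset.sum_nonneg fun _ _ => mul_self_nonneg _
  have h3 : ((∑ k ∈ Finset.range X.m, (X.val k).natAbs : ℕ) : ℝ) ≤
      ∑ k ∈ Finset.range X.m, (X.val k : ℝ) * X.val k := by
    push_cast
    refine Finset.sum_le_sum fun k _ => ?_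
    rw [Nat.cast_natAbs, Int.cast_abs, ← abs_mul_abs_self]
    have : X.val k = 0 ∨ (1 : ℝ) ≤ |(X.val k : ℝ)| := by
      by_cases h : X.val k = 0
      · exact Or.inl h
      · exact Or.inr (by exact_mod_cast Int.one_le_abs h)
    rcases this with h | h
    · simp [h]
    · nlinarith
  unfold bulk
  have : (0 : ℝ) ≤ X.m := by positivity
  linarith

include hX in
lemma Valid.natAbs_lt {k : ℕ} (hk : k < X.m) : (X.val k).natAbs < 2 ^ X.levels := by
  have h1 := Finset.single_le_sum (f := fun k => (X.val k).natAbs) (fun _ _ => Nat.zero_le _)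
    (Finset.mem_range.2 hk)
  have h2 : ((X.val k).natAbs : ℝ) < 2 ^ X.levels :=
    calc ((X.val k).natAbs : ℝ) ≤ (∑ k ∈ Finset.range X.m, (X.val k).natAbs : ℕ) := by
          exact_mod_cast h1
      _ ≤ X.bulk := hX.sum_natAbs_le_bulk
      _ < X.threshold := hX.bulk_lt_threshold
      _ ≤ _ := X.threshold_le
  exact_mod_cast h2

include hX in
lemma Valid.levels_pos : 0 < X.levels := by
  by_contra h
  have h0 : X.levels = 0 := by omega
  have h1 := X.threshold_le
  rw [h0, pow_zero] at h1
  linarith [hX.one_le_bulk, hX.bulk_lt_threshold]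

lemma mem_digits {x : Digit} (h : x ∈ X.digits) : ∃ k < X.m, x.row = X.row k ∧
    x.col = X.col k ∧ x.level < X.levels := by
  simp only [digits, digitsBelow, digitsAt, List.mem_flatMap, List.mem_range, List.mem_map] at h
  obtain ⟨k, hk, l, hl, rfl⟩ := h
  exact ⟨k, hk, rfl, rfl, lt_of_mem_bits hl⟩

include hX in
lemma Valid.exists_digit {j : ℕ} (hj : j < X.n) : ∃ x ∈ X.digits, x.col = j := by
  obtain ⟨k, hk, rfl⟩ := hX.exists_col j hj
  have hne : bits X.levels (X.val k).natAbs ≠ [] := by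
    intro h
    have := sum_bits (hX.natAbs_lt hk)
    rw [h] at this
    have h0 := hX.val_ne k hk
    simp at this
    omega
  obtain ⟨l, hl⟩ := List.exists_mem_of_ne_nil _ hne
  refine ⟨⟨l, X.row k, X.col k, decide (X.val k < 0)⟩, ?_, rfl⟩
  simp only [digits, digitsBelow, digitsAt, List.mem_flatMap, List.mem_range, List.mem_map]
  exact ⟨k, hk, l, hl, rfl⟩

variable (X) in
/-- The columns of the digits. -/
noncomputable def digitCol (k : ℕ) : ℕ := (X.digits[k]?.map Digit.col).getD 0

lemma digitCol_eq {k : ℕ} (hk : k < X.digits.length) : X.digitCol k = X.digits[k].col := by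
  simp [digitCol, hk]

include hX in
lemma Valid.exists_digitCol {j : ℕ} (hj : j < X.n) : ∃ k < X.digits.length, X.digitCol k = j := by
  obtain ⟨x, hx, rfl⟩ := hX.exists_digit hj
  obtain ⟨k, hk, rfl⟩ := List.mem_iff_getElem.1 hx
  exact ⟨k, hk, digitCol_eq hk⟩

include hX in
lemma Valid.digits_pos : 0 < X.digits.length := by
  obtain ⟨k, hk, -⟩ := hX.exists_digitCol (hX.col_lt 0 hX.size_pos)
  omega

/-- The scaffold with one leg for every binary digit of the matrix. -/
noncomputable def scaffold : Scaffold X.d X.n X.levels X.digits.length where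
  loop k := (⟨X.digits[k].level, by
      obtain ⟨_, -, -, -, h⟩ := mem_digits (List.getElem_mem k.2)
      exact h.trans (Nat.lt_succ_self _)⟩,
    ⟨X.digits[k].row, by
      obtain ⟨i, hi, h, -⟩ := mem_digits (List.getElem_mem k.2)
      exact lt_of_eq_of_lt h (hX.row_lt i hi)⟩)
  flip k := X.digits[k].neg
  col k := ⟨X.digits[k].col, by
      obtain ⟨i, hi, -, h, -⟩ := mem_digits (List.getElem_mem k.2)
      exact lt_of_eq_of_lt h (hX.col_lt i hi)⟩
  next k := ⟨ringNext X.digitCol X.digits.length k, ringNext_lt k.2⟩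
  rep j := ⟨ringLast X.digitCol X.digits.length j, by
      obtain ⟨k, hk, h⟩ := hX.exists_digitCol j.2
      exact (ringLast_spec hk h).1⟩
  next_injective := by
    intro k k' h
    simp only [Fin.mk.injEq] at h
    rcases lt_trichotomy (k : ℕ) k' with hlt | heq | hlt
    · exact absurd h (ringNext_ne_of_lt k'.2 hlt)
    · exact Fin.ext heq
    · exact absurd h.symm (ringNext_ne_of_lt k.2 hlt)
  col_next := by
    intro k
    have := apply_ringNext (c := X.digitCol) k.2
    rw [digitCol_eq (ringNext_lt k.2), digitCol_eq k.2] at this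
    exact Fin.ext this
  col_rep := by
    intro j
    obtain ⟨k, hk, h⟩ := hX.exists_digitCol j.2
    have := ringLast_spec hk h
    rw [digitCol_eq this.1] at this
    exact Fin.ext this.2.1
  reach := by
    intro k
    obtain ⟨m, hm, h⟩ := exists_iterate_ringNext (c := X.digitCol) k.2
    refine ⟨m, by omega, Fin.ext ?_⟩
    rw [digitCol_eq k.2] at h
    refine Eq.trans ?_ h
    clear h hm
    induction m with
    | zero => rfl
    | succ m ih => rw [Function.iterate_succ_apply', Function.iterate_succ_apply', ← ih]
  level_lt := by
    intro k
    obtain ⟨_, -, -, -, h⟩ := mem_digits (List.getElem_mem k.2)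
    exact h

lemma sum_map_digitsBelow {M : Type*} [AddCommMonoid M] (F : Digit → M) (k : ℕ) :
    ((X.digitsBelow k).map F).sum = ∑ i ∈ Finset.range k, ((X.digitsAt i).map F).sum := by
  induction k with
  | zero => simp [digitsBelow]
  | succ k ih => rw [digitsBelow_succ, List.map_append, List.sum_append, ih, Finset.sum_range_succ]

include hX in
lemma Valid.sum_digitsAt {k : ℕ} (hk : k < X.m) :
    ((X.digitsAt k).map fun x => (if x.neg then -1 else 1 : ℤ) * 2 ^ x.level).sum = X.val k := by
  have h := congrArg (Nat.cast (R := ℤ)) (sum_bits (hX.natAbs_lt hk))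
  rw [digitsAt, List.map_map]
  have : (fun x : Digit => (if x.neg then -1 else 1 : ℤ) * 2 ^ x.level) ∘
      (fun l => (⟨l, X.row k, X.col k, decide (X.val k < 0)⟩ : Digit)) =
      fun l => (if X.val k < 0 then -1 else 1 : ℤ) * ((2 ^ l : ℕ) : ℤ) := by
    funext l; simp
  rw [this, List.sum_map_mul_left]
  have h2 : (List.map (fun l => ((2 ^ l : ℕ) : ℤ)) (bits X.levels (X.val k).natAbs)).sum =
      |X.val k| := by
    rw [← Int.natCast_natAbs, ← h, Nat.cast_list_sum, List.map_map]
    rfl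
  rw [h2]
  split_ifs with h3
  · rw [abs_of_neg h3]; ring
  · rw [abs_of_nonneg (not_lt.1 h3)]; ring

lemma scaffold_matrix (i : Fin X.d) (j : Fin X.n) : (scaffold hX).matrix i j =
    ∑ k ∈ Finset.range X.m, if X.row k = i ∧ X.col k = j then X.val k else 0 := by
  have h := Fin.sum_univ_fun_getElem X.digits fun x => if x.row = i ∧ x.col = j then
    (if x.neg then -1 else 1 : ℤ) * 2 ^ x.level else 0
  rw [Scaffold.matrix]
  simp only [scaffold, Scaffold.sg, Fin.ext_iff]
  refine h.trans ?_
  rw [digits, sum_map_digitsBelow]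
  refine Finset.sum_congr rfl fun k hk => ?_
  rw [← hX.sum_digitsAt (Finset.mem_range.1 hk), digitsAt, List.map_map, List.map_map]
  by_cases hc : X.row k = i ∧ X.col k = j
  · rw [if_pos hc]
    congr 2
    funext l
    simp [hc]
  · rw [if_neg hc]
    refine List.sum_eq_zero fun x hx => ?_
    simp only [List.mem_map, Function.comp_apply, if_neg hc] at hx
    obtain ⟨_, -, rfl⟩ := hx
    rfl

lemma scaffold_weight :
    (scaffold hX).weight = ∑ k ∈ Finset.range X.m, (X.val k).natAbs := by
  have h := Fin.sum_univ_fun_getElem X.digits fun x => 2 ^ x.level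
  rw [Scaffold.weight]
  refine h.trans ?_
  rw [digits, sum_map_digitsBelow]
  refine Finset.sum_congr rfl fun k hk => ?_
  rw [digitsAt, List.map_map]
  exact sum_bits (hX.natAbs_lt (Finset.mem_range.1 hk))

lemma length_digits_le_weight : X.digits.length ≤ (scaffold hX).weight := by
  rw [Scaffold.weight]
  calc X.digits.length = ∑ _k : Fin X.digits.length, 1 := by simp
    _ ≤ _ := Finset.sum_le_sum fun k _ => Nat.one_le_two_pow

variable (X) in
lemma length_digits_le : X.digits.length ≤ X.m * X.levels := by
  suffices H : ∀ k, (X.digitsBelow k).length ≤ k * X.levels from H _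
  intro k
  induction k with
  | zero => simp [digitsBelow]
  | succ k ih =>
    rw [digitsBelow_succ, List.length_append, add_mul, one_mul, digitsAt, List.length_map]
    exact add_le_add ih (length_bits_le _ _)

end Sparse

/-! ### The encoding program -/

namespace Sparse

variable {X : Sparse}

variable (X) in
/-- The memory holds the problem, the tables and the list of digits. -/
structure Prepared (s : RAMState) : Prop where
  loaded : X.Loaded s
  tables : X.Tables X.levels s
  listed : X.Listed X.digits s

lemma Prepared.frame {s s' : RAMState} {p : Program} (h : X.Prepared s) (hf : Frame p s s')
    (hn : ∀ a < 3, p.writesNat a = false := by decide)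
    (hr : ∀ a < 3, p.writesReal a = false := by decide)
    (hn' : ∀ a ∈ [10, 11, 12, 13, 14, 15], p.writesNat a = false := by decide)
    (hr' : p.writesReal 9 = false := by decide) : X.Prepared s' :=
  ⟨h.loaded.frame hf hn hr,
    h.tables.congr (hf.nat_eq (hn' _ (by decide))) (hf.nat_eq (hn' _ (by decide)))
      (hf.real_eq hr'),
    h.listed.congr (hf.nat_eq (hn' _ (by decide))) (hf.nat_eq (hn' _ (by decide)))
      (hf.nat_eq (hn' _ (by decide))) (hf.nat_eq (hn' _ (by decide)))⟩

/-- The common part of both programs. -/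
def prepProg : Program := .seq bulkProg (.seq levelProg digitProg)

lemma prepProg_spec {s : RAMState} (h : X.Loaded s) :
    Reaches prepProg s (X.m * (60 * X.levels + 130) + 40 * X.d + 50 * X.levels + 140)
      X.Prepared := by
  refine ((bulkProg_spec h).seq fun s1 h1 f1 => (levelProg_spec (h.frame f1) h1).seq
    fun s2 h2 f2 => (digitProg_spec ((h.frame f1).frame f2) h2).mono le_rfl
      fun s3 h3 f3 => ⟨((h.frame f1).frame f2).frame f3, h2.congr (f3.nat_eq rfl) (f3.nat_eq rfl)
        (f3.real_eq rfl), h3⟩).mono ?_ fun _ h _ => h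
  ring_nf
  omega

/-- Computes the successors of the legs in the array `17`. -/
def ringProg : Program :=
  .seq (.forTo 8 (.reg 12) (.setNat 16 (.read 15 (.reg 8)) (.reg 8)))
    (.forTo 8 (.reg 12) (.seq (.setNat 17 (.reg 8) (.read 16 (.read 15 (.reg 8))))
      (.setNat 16 (.read 15 (.reg 8)) (.reg 8))))

lemma Prepared.col {s : RAMState} (h : X.Prepared s) {k : ℕ} (hk : k < X.digits.length) :
    s.nat 15 k = X.digitCol k := by
  rw [h.listed.col k _ (List.getElem?_eq_getElem hk), digitCol_eq hk]

lemma ringProg_spec {s : RAMState} (h : X.Prepared s) (h16 : s.nat 16 = fun _ => 0) :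
    Reaches ringProg s (60 * X.digits.length + 30) fun s' =>
      X.Prepared s' ∧ ∀ k < X.digits.length,
        s'.nat 17 k = ringNext X.digitCol X.digits.length k := by
  refine (Reaches.seq (Reaches.forTo (T := 9) X.digits.length
    (fun k s' => s'.nat 16 = lastIndex X.digitCol (fun _ => 0) k) rfl ?_ ?_ ?_ ?_)
    fun s1 h1 f1 => Reaches.forTo (T := 20) X.digits.length
    (fun k s' => s'.nat 16 = lastIndex X.digitCol (ringLast X.digitCol X.digits.length) k ∧
      ∀ i < k, s'.nat 17 i = ringNext X.digitCol X.digits.length i) rfl ?_ ?_ ?_ ?_).mono ?_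
    fun s' hs' hf => ⟨h.frame hf, hs'.2⟩
  · exact fun s' hf => (h.frame hf).listed.length
  · exact fun k s' v hR => hR
  · exact h16
  · intro k hk s' hR hc hf
    refine (Reaches.of_loopFree rfl ?_).mono (T := _) (by decide) fun _ h _ => h
    simp [Program.exec, NatExpr.eval, hc, hR, (h.frame hf).col hk, lastIndex]
  · exact fun s' hf => ((h.frame f1).frame hf).listed.length
  · exact fun k s' v hR => hR
  · exact ⟨h1, by omega⟩
  · intro k hk s' hR hc hf
    refine (Reaches.of_loopFree rfl ?_).mono (T := _) (by decide) fun _ h _ => h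
    have hcol := ((h.frame f1).frame hf).col hk
    refine ⟨?_, fun i hi => ?_⟩
    · simp [Program.exec, NatExpr.eval, hc, hR.1, hcol, lastIndex]
    · simp [Program.exec, NatExpr.eval, hc, hR.1, hcol, Function.update_apply]
      split_ifs with hik
      · rw [hik]; rfl
      · exact hR.2 i (by omega)
  · simp only [NatExpr.cost, NatExpr.reg]
    ring_nf
    omega

/-- The number of gadgets. -/
def gadgetsExpr : NatExpr := .read 11 (.reg 10)

/-- The number of edges on rims. -/
def crossBase : NatExpr := .times (.add gadgetsExpr (.reg 0)) 3

/-- The number of edges outside the legs. -/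
def ownBase : NatExpr := .add crossBase (.times gadgetsExpr 9)

/-- An integer. -/
def intExpr (z : ℤ) : RealExpr := .sub (.ofNat (.lit z.toNat)) (.ofNat (.lit (-z).toNat))

@[simp] lemma eval_intExpr (z : ℤ) (s : RAMState) : (intExpr z).eval s = z := by
  simp only [intExpr, RealExpr.eval, NatExpr.eval]
  exact_mod_cast Int.toNat_sub_toNat_neg z

lemma Prepared.gadgetsExpr {s : RAMState} (h : X.Prepared s) :
    gadgetsExpr.eval s = X.d * X.levels := by
  simp [Sparse.gadgetsExpr, NatExpr.eval, h.tables.top, h.tables.mul _ le_rfl]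

lemma Prepared.crossBase {s : RAMState} (h : X.Prepared s) :
    crossBase.eval s = (X.levels + 1) * X.d * 3 := by
  simp [Sparse.crossBase, NatExpr.eval, h.gadgetsExpr, h.loaded.rows]; ring

lemma Prepared.ownBase {s : RAMState} (h : X.Prepared s) :
    ownBase.eval s = (X.levels + 1) * X.d * 3 + X.levels * X.d * 9 := by
  simp [Sparse.ownBase, NatExpr.eval, h.gadgetsExpr, h.crossBase]; ring

/-- A matrix entry to be written: its number, row, column and value. -/
structure Entry where
  pos : NatExpr
  row : NatExpr
  col : NatExpr
  val : RealExpr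

/-- Writes a list of entries to the arrays of the output. -/
def emit : List Entry → Program
  | [] => .skip
  | x :: xs => .seq (.seq (.setNat 4 x.pos x.row) (.seq (.setNat 5 x.pos x.col)
      (.setReal 3 x.pos x.val))) (emit xs)

lemma writesNat_emit {a : ℕ} (h4 : a ≠ 4) (h5 : a ≠ 5) (xs : List Entry) :
    (emit xs).writesNat a = false := by
  induction xs with
  | nil => rfl
  | cons x xs ih => simp [emit, Program.writesNat, ih, h4, h5]

lemma writesReal_emit {a : ℕ} (h3 : a ≠ 3) (xs : List Entry) :
    (emit xs).writesReal a = false := by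
  induction xs with
  | nil => rfl
  | cons x xs ih => simp [emit, Program.writesReal, ih, h3]

lemma loopFree_emit (xs : List Entry) : (emit xs).loopFree = true := by
  induction xs with
  | nil => rfl
  | cons x xs ih => simp [emit, Program.loopFree, ih]

/-- The target matrix, as a function of the number of the entry. -/
structure Target where
  row : ℕ → ℕ
  col : ℕ → ℕ
  val : ℕ → ℝ

/-- The entry number `p` has been written. -/
def Target.Good (Y : Target) (p : ℕ) (s : RAMState) : Prop :=
  s.nat 4 p = Y.row p ∧ s.nat 5 p = Y.col p ∧ s.real 3 p = Y.val p

/-- The values of an entry are those of the target matrix at the position `p`. -/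
def Target.Fits (Y : Target) (p : ℕ) (x : Entry) (s : RAMState) : Prop :=
  x.pos.eval s = p ∧ x.row.eval s = Y.row p ∧ x.col.eval s = Y.col p ∧ x.val.eval s = Y.val p

lemma emit_spec (Y : Target) {A : Type*} (as : List A) (pos : A → ℕ) (item : A → Entry)
    {s : RAMState}
    (h : ∀ a ∈ as, ∀ s', (∀ b, b ≠ 4 → b ≠ 5 → s'.nat b = s.nat b) →
      (∀ b, b ≠ 3 → s'.real b = s.real b) → Y.Fits (pos a) (item a) s') :
    (∀ p, Y.Good p s → Y.Good p ((emit (as.map item)).exec s)) ∧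
      ∀ a ∈ as, Y.Good (pos a) ((emit (as.map item)).exec s) := by
  induction as generalizing s with
  | nil => exact ⟨fun p hp => hp, by simp⟩
  | cons a as ih =>
    simp only [List.map_cons, emit, Program.exec]
    set s1 := s.setNat 4 ((item a).pos.eval s) ((item a).row.eval s) with hs1
    set s2 := s1.setNat 5 ((item a).pos.eval s1) ((item a).col.eval s1) with hs2
    set s3 := s2.setReal 3 ((item a).pos.eval s2) ((item a).val.eval s2) with hs3
    obtain ⟨a1, a2, -, -⟩ := h a (by simp) s (fun _ _ _ => rfl) (fun _ _ => rfl)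
    obtain ⟨b1, -, b2, -⟩ := h a (by simp) s1 (fun b hb _ => by simp [hs1, hb]) (fun _ _ => rfl)
    obtain ⟨c1, -, -, c2⟩ := h a (by simp) s2 (fun b hb hb' => by simp [hs2, hs1, hb, hb'])
      (fun _ _ => rfl)
    rw [a1, a2] at hs1
    rw [b1, b2] at hs2
    rw [c1, c2] at hs3
    have hgood : ∀ p, p = pos a ∨ Y.Good p s → Y.Good p s3 := by
      intro p hp
      rw [hs3, hs2, hs1]
      by_cases hpa : p = pos a
      · simp [Target.Good, hpa]
      · have := hp.resolve_left hpa
        simpa [Target.Good, Function.update_apply, hpa] using this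
    have ih' := ih (s := s3) fun a' ha' s' hn hr => h a' (by simp [ha']) s'
      (fun b hb hb' => by rw [hn b hb hb']; simp [hs3, hs2, hs1, hb, hb'])
      (fun b hb => by rw [hr b hb]; simp [hs3, hs2, hs1, hb])
    refine ⟨fun p hp => ih'.1 p (hgood p (Or.inr hp)), fun a' ha' => ?_⟩
    rcases List.mem_cons.1 ha' with rfl | ha'
    · exact ih'.1 _ (hgood _ (Or.inl rfl))
    · exact ih'.2 a' ha'

open Scaffold in
/-- The entry for the side `x.2` of the triangle `x.1` of the gadget in register `8`. -/
def gadgetEntry (x : Fin 9 × Fin 3) : Entry where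
  pos := .add (.times (.reg 8) 27) (.lit (3 * x.1 + x.2))
  row := match gadgetSide x.1 x.2 with
    | .inl j => .add (.times (.reg 8) 3) (.lit j)
    | .inr (.inl e) => .add crossBase (.add (.times (.reg 8) 9) (.lit e))
    | .inr (.inr j) => .add (.times (.add (.reg 8) (.reg 0)) 3) (.lit j)
  col := .add (.times (.reg 8) 9) (.lit x.1)
  val := intExpr (gadgetSgn x.1 x.2)

open Scaffold in
/-- The entry for the side `x.2` of the triangle `x.1` of the leg in register `8`. -/
def legEntry (x : Fin 13 × Fin 3) : Entry where
  pos := .add (.times gadgetsExpr 27) (.add (.times (.reg 8) 39) (.lit (3 * x.1 + x.2)))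
  row := match legSide x.1 x.2 with
    | .inl j => .add (.times (.read 13 (.reg 8)) 3)
        (.add (.sub (.lit j) (.times (.read 14 (.reg 8)) j)) (.times (.read 14 (.reg 8)) (2 - j)))
    | .inr (.inl e) => .add ownBase (.add (.times (.reg 8) 18) (.lit e))
    | .inr (.inr e) => .add ownBase (.add (.times (.read 17 (.reg 8)) 18) (.lit e))
  col := .add (.times gadgetsExpr 9) (.add (.times (.reg 8) 13) (.lit x.1))
  val := if (legSide x.1 x.2).isLeft then
      .sub (.ofNat (.lit 1)) (.ofNat (.times (.read 14 (.reg 8)) 2))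
    else intExpr (legSgn x.1 x.2)

/-- Writes the matrix entries of the gadgets. -/
def gadgetProg : Program :=
  .forTo 8 gadgetsExpr (emit ((List.finRange 9 ×ˢ List.finRange 3).map gadgetEntry))

/-- Writes the matrix entries of the legs. -/
def legProg : Program :=
  .forTo 8 (.reg 12) (emit ((List.finRange 13 ×ˢ List.finRange 3).map legEntry))

variable (hX : X.Valid)

/-- The number of a matrix entry. -/
noncomputable def place (x : Scaffold.Tri X.d X.levels X.digits.length × Fin 3) : ℕ :=
  3 * Scaffold.triEquiv X.d X.levels X.digits.length x.1 + x.2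

lemma place_injective : Function.Injective (place (X := X)) := by
  rintro ⟨t, x⟩ ⟨t', x'⟩ h
  simp only [place] at h
  have h1 : (Scaffold.triEquiv X.d X.levels X.digits.length t : ℕ) =
    Scaffold.triEquiv X.d X.levels X.digits.length t' := by omega
  have h2 : (x : ℕ) = x' := by omega
  rw [(Scaffold.triEquiv _ _ _).injective (Fin.ext h1), Fin.ext h2]

/-- The boundary matrix of the scaffold. -/
noncomputable def target : Target where
  row := Function.extend place (fun x => (Scaffold.edgeEquiv X.d X.levels X.digits.length
    ((scaffold hX).side x.1 x.2) : ℕ)) 0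
  col := Function.extend place (fun x => (Scaffold.triEquiv X.d X.levels X.digits.length x.1 : ℕ)) 0
  val := Function.extend place (fun x => ((scaffold hX).sgn x.1 x.2 : ℝ)) 0

lemma scaffold_flip (k : Fin X.digits.length) :
    (scaffold hX).flip k = X.digits[(k : ℕ)].neg := rfl

lemma scaffold_sg (k : Fin X.digits.length) :
    (scaffold hX).sg k = if X.digits[(k : ℕ)].neg then -1 else 1 := by
  have : ∀ b, (scaffold hX).flip k = b → (scaffold hX).sg k = if b then -1 else 1 := by
    rintro _ rfl
    rfl
  exact this _ (scaffold_flip hX k)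

lemma scaffold_level (k : Fin X.digits.length) :
    (((scaffold hX).loop k).1 : ℕ) = X.digits[(k : ℕ)].level := rfl

lemma scaffold_row (k : Fin X.digits.length) :
    (((scaffold hX).loop k).2 : ℕ) = X.digits[(k : ℕ)].row := rfl

lemma fits_gadgetEntry {s : RAMState} (h : X.Prepared s) (g : Fin X.levels × Fin X.d)
    (hg : s.nat 8 0 = X.d * g.1 + g.2) (x : Fin 9 × Fin 3) :
    (target hX).Fits (place (.inl (g, x.1), x.2)) (gadgetEntry x) s := by
  simp only [Target.Fits, target, place_injective.extend_apply]
  refine ⟨?_, ?_, ?_, ?_⟩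
  · simp [gadgetEntry, NatExpr.eval, hg, place, Scaffold.triEquiv_gadget]; ring
  · simp only [Scaffold.side, gadgetEntry]
    rcases Scaffold.gadgetSide x.1 x.2 with j | e | j
    · simp [NatExpr.eval, hg, Scaffold.gadgetEdge, Scaffold.edgeEquiv_rim, Scaffold.lower]
    · simp [NatExpr.eval, hg, Scaffold.gadgetEdge, Scaffold.edgeEquiv_cross, h.crossBase]; ring
    · simp [NatExpr.eval, hg, Scaffold.gadgetEdge, Scaffold.edgeEquiv_rim, Scaffold.upper,
        h.loaded.rows]; ring
  · simp [gadgetEntry, NatExpr.eval, hg, Scaffold.triEquiv_gadget]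
  · simp [gadgetEntry, Scaffold.sgn]

lemma fits_legEntry {s : RAMState} (h : X.Prepared s) (k : Fin X.digits.length)
    (hk : s.nat 8 0 = k) (h17 : s.nat 17 k = ringNext X.digitCol X.digits.length k)
    (x : Fin 13 × Fin 3) :
    (target hX).Fits (place (.inr (k, x.1), x.2)) (legEntry x) s := by
  have hget : X.digits[(k : ℕ)]? = some X.digits[(k : ℕ)] := List.getElem?_eq_getElem k.2
  have h13 := h.listed.loop _ _ hget
  have h14 := h.listed.neg _ _ hget
  simp only [Target.Fits, target, place_injective.extend_apply]
  refine ⟨?_, ?_, ?_, ?_⟩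
  · simp [legEntry, NatExpr.eval, hk, place, Scaffold.triEquiv_leg, h.gadgetsExpr]; ring
  · simp only [Scaffold.side, legEntry]
    rcases Scaffold.legSide x.1 x.2 with j | e | e
    · simp only [NatExpr.eval, NatExpr.eval_times, NatExpr.eval_reg, hk, h13, h14,
        Scaffold.legEdge, Scaffold.edgeEquiv_rim, scaffold_level, scaffold_row, scaffold_flip]
      cases X.digits[(k : ℕ)].neg
      · simp [Scaffold.turnEdge]
      · simp [Scaffold.turnEdge, Fin.val_rev]
    · simp [NatExpr.eval, hk, Scaffold.legEdge, Scaffold.edgeEquiv_own, h.ownBase]; ring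
    · simp [NatExpr.eval, hk, h17, Scaffold.legEdge, Scaffold.edgeEquiv_own, h.ownBase, scaffold]
      ring
  · simp [legEntry, NatExpr.eval, hk, Scaffold.triEquiv_leg, h.gadgetsExpr]; ring
  · simp only [legEntry, Scaffold.sgn]
    by_cases hl : (Scaffold.legSide x.1 x.2).isLeft = true
    · simp only [if_pos hl, RealExpr.eval, NatExpr.eval, NatExpr.eval_times, NatExpr.eval_reg, hk,
        h14, scaffold_sg]
      cases X.digits[(k : ℕ)].neg <;> norm_num
    · simp [if_neg hl]

lemma Prepared.eval_eq {s s' : RAMState} (h : X.Prepared s)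
    (hn : ∀ b, b ≠ 4 → b ≠ 5 → s'.nat b = s.nat b) (hr : ∀ b, b ≠ 3 → s'.real b = s.real b) :
    X.Prepared s' :=
  ⟨h.loaded.congr (fun a ha => hn a (by omega) (by omega)) (fun a ha => hr a (by omega)),
    h.tables.congr (hn _ (by decide) (by decide)) (hn _ (by decide) (by decide))
      (hr _ (by decide)),
    h.listed.congr (hn _ (by decide) (by decide)) (hn _ (by decide) (by decide))
      (hn _ (by decide) (by decide)) (hn _ (by decide) (by decide))⟩

lemma writesNat_gadgetProg {a : ℕ} (h4 : a ≠ 4) (h5 : a ≠ 5) (h8 : a ≠ 8) :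
    gadgetProg.writesNat a = false := by
  simp [gadgetProg, writesNat_emit h4 h5, h8]

lemma writesReal_gadgetProg {a : ℕ} (h3 : a ≠ 3) : gadgetProg.writesReal a = false := by
  simp [gadgetProg, writesReal_emit h3]

lemma writesNat_legProg {a : ℕ} (h4 : a ≠ 4) (h5 : a ≠ 5) (h8 : a ≠ 8) :
    legProg.writesNat a = false := by
  simp [legProg, writesNat_emit h4 h5, h8]

lemma writesReal_legProg {a : ℕ} (h3 : a ≠ 3) : legProg.writesReal a = false := by
  simp [legProg, writesReal_emit h3]

lemma Prepared.frame_gadgetProg {s s' : RAMState} (h : X.Prepared s)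
    (hf : Frame gadgetProg s s') : X.Prepared s' := by
  refine h.frame hf ?_ ?_ ?_ ?_
  · exact fun a ha => writesNat_gadgetProg (by omega) (by omega) (by omega)
  · exact fun a ha => writesReal_gadgetProg (by omega)
  · intro a ha
    simp only [List.mem_cons, List.not_mem_nil, or_false] at ha
    exact writesNat_gadgetProg (by omega) (by omega) (by omega)
  · exact writesReal_gadgetProg (by omega)

lemma Prepared.frame_legProg {s s' : RAMState} (h : X.Prepared s)
    (hf : Frame legProg s s') : X.Prepared s' := by
  refine h.frame hf ?_ ?_ ?_ ?_
  · exact fun a ha => writesNat_legProg (by omega) (by omega) (by omega)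
  · exact fun a ha => writesReal_legProg (by omega)
  · intro a ha
    simp only [List.mem_cons, List.not_mem_nil, or_false] at ha
    exact writesNat_legProg (by omega) (by omega) (by omega)
  · exact writesReal_legProg (by omega)

lemma gadgetProg_spec {s : RAMState} (h : X.Prepared s) :
    Reaches gadgetProg s (X.d * X.levels * 10000 + 100) fun s' =>
      ∀ (g : Fin X.levels × Fin X.d) (τ : Fin 9) (x : Fin 3),
      (target hX).Good (place (.inl (g, τ), x)) s' := by
  refine (Reaches.forTo (T := 9900) (X.d * X.levels) (fun k s' =>
    ∀ (g : Fin X.levels × Fin X.d) τ x, X.d * g.1 + g.2 < k →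
      (target hX).Good (place (.inl (g, τ), x)) s') ?_ ?_ ?_ ?_ ?_).mono ?_ ?_
  · exact writesNat_emit (by omega) (by omega) _
  · exact fun s' hf => (h.frame_gadgetProg hf).gadgetsExpr
  · exact fun k s' v hR => hR
  · exact fun _ _ _ h => absurd h (Nat.not_lt_zero _)
  · intro k hk s' hR hc hf
    have h' := h.frame_gadgetProg hf
    obtain ⟨g₀, hg₀⟩ := finProdFinEquiv.surjective (⟨k, by rwa [mul_comm]⟩ : Fin (X.levels * X.d))
    have hg₀' : X.d * g₀.1 + g₀.2 = k := by
      have := congrArg Fin.val hg₀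
      rw [← show _ = k from this]
      simp [finProdFinEquiv]; ring
    have key := emit_spec (target hX) (List.finRange 9 ×ˢ List.finRange 3)
      (fun x => place (.inl (g₀, x.1), x.2)) gadgetEntry (s := s') fun x _ s'' hn hr =>
        fits_gadgetEntry hX (h'.eval_eq hn hr) g₀
          (by rw [hn 8 (by decide) (by decide), hc, hg₀']) x
    refine (Reaches.of_loopFree (loopFree_emit _) ?_).mono (T := _) (by decide +kernel)
      fun _ h _ => h
    intro g τ x hg
    rcases Nat.lt_succ_iff_lt_or_eq.1 hg with hg | hg
    · exact key.1 _ (hR g τ x hg)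
    · obtain rfl : g = g₀ := finProdFinEquiv.injective (by
        rw [hg₀]
        refine Fin.ext (Eq.trans ?_ hg)
        simp [finProdFinEquiv]; ring)
      exact key.2 (τ, x) (by simp [List.mem_product, List.mem_finRange])
  · simp only [gadgetsExpr, NatExpr.cost, NatExpr.reg]
    ring_nf
    omega
  · intro s' hs' _ g τ x
    refine hs' g τ x ?_
    have : (finProdFinEquiv g : ℕ) < X.levels * X.d := (finProdFinEquiv g).2
    simp [finProdFinEquiv] at this
    linarith [mul_comm X.levels X.d]

lemma legProg_spec {s : RAMState} (h : X.Prepared s) (h17 : ∀ k < X.digits.length,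
      s.nat 17 k = ringNext X.digitCol X.digits.length k) :
    Reaches legProg s (X.digits.length * 50000 + 100) fun s' =>
      (∀ p, (target hX).Good p s → (target hX).Good p s') ∧
      ∀ (k : Fin X.digits.length) (τ : Fin 13) (x : Fin 3),
        (target hX).Good (place (.inr (k, τ), x)) s' := by
  refine (Reaches.forTo (T := 49900) X.digits.length (fun k s' =>
    (∀ p, (target hX).Good p s → (target hX).Good p s') ∧
    ∀ (i : Fin X.digits.length) τ x, i < k →
      (target hX).Good (place (.inr (i, τ), x)) s') ?_ ?_ ?_ ?_ ?_).mono ?_ ?_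
  · exact writesNat_emit (by omega) (by omega) _
  · exact fun s' hf => (h.frame_legProg hf).listed.length
  · exact fun k s' v hR => hR
  · exact ⟨fun p hp => hp, fun _ _ _ h => absurd h (Nat.not_lt_zero _)⟩
  · intro k hk s' hR hc hf
    have h' := h.frame_legProg hf
    have h17' : s'.nat 17 k = ringNext X.digitCol X.digits.length k := by
      rw [hf.nat_eq (writesNat_legProg (by omega) (by omega) (by omega)), h17 k hk]
    have key := emit_spec (target hX) (List.finRange 13 ×ˢ List.finRange 3)
      (fun x => place (.inr (⟨k, hk⟩, x.1), x.2)) legEntry (s := s') fun x _ s'' hn hr =>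
        fits_legEntry hX (h'.eval_eq hn hr) ⟨k, hk⟩
          (by rw [hn 8 (by decide) (by decide), hc])
          (by rw [hn 17 (by decide) (by decide), h17']) x
    refine (Reaches.of_loopFree (loopFree_emit _) ?_).mono (T := _) (by decide +kernel)
      fun _ h _ => h
    refine ⟨fun p hp => key.1 _ (hR.1 p hp), fun i τ x hi => ?_⟩
    rcases Nat.lt_succ_iff_lt_or_eq.1 hi with hi | hi
    · exact key.1 _ (hR.2 i τ x hi)
    · obtain rfl : i = ⟨k, hk⟩ := Fin.ext hi
      exact key.2 (τ, x) (by simp [List.mem_product, List.mem_finRange])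
  · simp only [NatExpr.cost, NatExpr.reg]
    ring_nf
    omega
  · exact fun s' hs' _ => ⟨hs'.1, fun k τ x => hs'.2 k τ x k.2⟩

/-- Writes the right-hand side, the header and the accuracy of the output. -/
def finishProg : Program :=
  .seq (.forTo 8 (.reg 0)
      (.seq (.setReal 4 (.times (.reg 8) 3) (.read 1 (.reg 8)))
      (.seq (.setReal 4 (.add (.times (.reg 8) 3) (.lit 1)) (.read 1 (.reg 8)))
        (.setReal 4 (.add (.times (.reg 8) 3) (.lit 2)) (.read 1 (.reg 8))))))
    (.seq (.setNat 3 (.lit 0) (.add ownBase (.times (.reg 12) 18)))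
    (.seq (.setNat 3 (.lit 1) (.add (.times gadgetsExpr 9) (.times (.reg 12) 13)))
    (.seq (.setNat 3 (.lit 2) (.times (.read 3 (.lit 1)) 3))
      (.setReal 5 (.lit 0)
        (.div (.ofNat (.lit 1)) (.mul (.read 9 (.reg 10)) (.read 9 (.reg 10))))))))

lemma finishProg_spec {s : RAMState} (h : X.Prepared s) (h4 : s.real 4 = fun _ => 0) :
    Reaches finishProg s (X.d * 100 + 300) fun s' =>
      (∀ p, s'.real 4 p = if p < 3 * X.d then (X.rhs (p / 3) : ℝ) else 0) ∧
      s'.nat 3 0 = Scaffold.numEdges X.d X.levels X.digits.length ∧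
      s'.nat 3 1 = Scaffold.numTris X.d X.levels X.digits.length ∧
      s'.nat 3 2 = Scaffold.numTris X.d X.levels X.digits.length * 3 ∧
      s'.real 5 0 = 1 / (2 ^ X.levels * 2 ^ X.levels) := by
  refine (Reaches.seq (Reaches.forTo (T := 60) X.d (fun k s' =>
    ∀ p, s'.real 4 p = if p < 3 * k then (X.rhs (p / 3) : ℝ) else 0) rfl ?_ ?_ ?_ ?_)
    fun s1 h1 f1 => Reaches.of_loopFree rfl ?_).mono ?_ fun _ h _ => h
  · exact fun s' hf => (h.frame hf).loaded.rows
  · exact fun k s' v hR => hR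
  · simp [h4]
  · intro k hk s' hR hc hf
    refine (Reaches.of_loopFree rfl ?_).mono (T := _) (by decide) fun _ h _ => h
    intro p
    have hb := (h.frame hf).loaded.rhs k hk
    simp only [Program.exec, RealExpr.eval, NatExpr.eval, NatExpr.eval_times, NatExpr.eval_reg, hc,
      RAMState.setReal_real, RAMState.setReal_nat, if_true, Function.update_apply, hR p, hb,
      OfNat.one_ne_ofNat, if_false]
    by_cases a1 : p = 3 * k + 2
    · have e : p / 3 = k := by omega
      rw [if_pos a1, if_pos (by omega), e]
    · rw [if_neg a1]
      by_cases a2 : p = 3 * k + 1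
      · have e : p / 3 = k := by omega
        rw [if_pos a2, if_pos (by omega), e]
      · rw [if_neg a2]
        by_cases a3 : p = 3 * k
        · have e : p / 3 = k := by omega
          rw [if_pos a3, if_pos (by omega), e]
        · rw [if_neg a3]
          by_cases a4 : p < 3 * k
          · rw [if_pos a4, if_pos (by omega)]
          · rw [if_neg a4, if_neg (by omega)]
  · have h' := h.frame f1
    have e1 := h'.gadgetsExpr
    have e2 := h'.ownBase
    have e3 := h'.tables.top
    have e4 := h'.tables.pow _ le_rfl
    have e5 := h'.listed.length
    have e6 := h'.crossBase
    have e7 := h'.loaded.rows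
    have e8 := h'.tables.mul _ le_rfl
    refine ⟨fun p => ?_, ?_, ?_, ?_, ?_⟩
    · simpa [Program.exec] using h1 p
    all_goals
      simp [Program.exec, NatExpr.eval, RealExpr.eval, gadgetsExpr, ownBase, crossBase, e3, e4, e5,
        e7, e8]
    all_goals ring
  · simp only [Program.maxCost, NatExpr.cost, RealExpr.cost, NatExpr.reg, NatExpr.times,
      gadgetsExpr, ownBase, crossBase]
    ring_nf
    omega

end Sparse

namespace Sparse

variable {X : Sparse} (hX : X.Valid)

/-- The program that writes the boundary problem. -/
def encProg : Program :=
  .seq prepProg (.seq ringProg (.seq gadgetProg (.seq legProg finishProg)))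

variable (X) in
/-- The accuracy of the boundary problem. -/
noncomputable def accuracy : ℝ := 1 / (2 ^ X.levels * 2 ^ X.levels)

lemma accuracy_pos : 0 < X.accuracy := by unfold accuracy; positivity

lemma accuracy_le_one : X.accuracy ≤ 1 := by
  unfold accuracy
  rw [div_le_one (by positivity)]
  exact one_le_mul_of_one_le_of_one_le (one_le_pow₀ (by norm_num)) (one_le_pow₀ (by norm_num))

/-- The boundary problem. -/
noncomputable abbrev boundaryInstance : LEAInstance :=
  (scaffold hX).toInstance (fun i => X.rhs i) X.accuracy accuracy_pos accuracy_le_one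

lemma rhs_eq_rhsInt (e : Scaffold.Edge X.d X.levels X.digits.length) :
    (if (Scaffold.edgeEquiv X.d X.levels X.digits.length e : ℕ) < 3 * X.d then
      (X.rhs ((Scaffold.edgeEquiv X.d X.levels X.digits.length e : ℕ) / 3) : ℝ) else 0) =
      Scaffold.rhsInt X.digits.length (fun i : Fin X.d => X.rhs i) e := by
  rcases e with ⟨⟨l, i⟩, j⟩ | ⟨g, e⟩ | ⟨k, e⟩
  · rw [Scaffold.edgeEquiv_rim]
    simp only [Scaffold.rhsInt]
    have hj := j.2
    have hi := i.2
    by_cases hl : l = 0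
    · subst hl
      have h1 : 3 * (X.d * ((0 : Fin (X.levels + 1)) : ℕ) + i) + j = 3 * i + j := by simp
      have h2 : (3 * (i : ℕ) + j) / 3 = i := by omega
      rw [h1, if_pos (by omega), if_pos rfl, h2]
    · have hl' : 1 ≤ (l : ℕ) := Nat.one_le_iff_ne_zero.2 fun h => hl (Fin.ext h)
      have : X.d ≤ X.d * l := Nat.le_mul_of_pos_right _ hl'
      rw [if_neg (by omega), if_neg hl, Int.cast_zero]
  · rw [Scaffold.edgeEquiv_cross, if_neg (by
      have : X.d ≤ (X.levels + 1) * X.d := Nat.le_mul_of_pos_left _ (Nat.succ_pos _)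
      omega)]
    simp [Scaffold.rhsInt]
  · rw [Scaffold.edgeEquiv_own, if_neg (by
      have : X.d ≤ (X.levels + 1) * X.d := Nat.le_mul_of_pos_left _ (Nat.succ_pos _)
      omega)]
    simp [Scaffold.rhsInt]

/-- The encoding program writes the boundary problem in time proportional to the number of legs that
the matrix can have. -/
lemma encProg_spec {s : RAMState} (h : X.Loaded s) (hd : X.d ≤ X.m)
    (h16 : s.nat 16 = fun _ => 0) (h4 : s.real 4 = fun _ => 0) :
    Reaches encProg s (100000 * (X.m * X.levels)) ((boundaryInstance hX).StoredAt 3) := by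
  refine ((prepProg_spec h).seq fun s1 h1 f1 => (ringProg_spec h1
    (by rw [f1.nat_eq rfl, h16])).seq fun s2 h2 f2 => (gadgetProg_spec hX h2.1).seq
    fun s3 h3 f3 => (legProg_spec hX (h2.1.frame_gadgetProg f3) fun k hk => by
      rw [f3.nat_eq (writesNat_gadgetProg (by omega) (by omega) (by omega)), h2.2 k hk]).seq
    fun s4 h4' f4 => (finishProg_spec ((h2.1.frame_gadgetProg f3).frame_legProg f4) ?_).mono
      le_rfl fun s5 h5 f5 => ?_).mono ?_ fun _ h _ => h
  · rw [f4.real_eq (writesReal_legProg (by omega)), f3.real_eq (writesReal_gadgetProg (by omega)),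
      f2.real_eq rfl, f1.real_eq rfl, h4]
  · have good : ∀ (t : Scaffold.Tri X.d X.levels X.digits.length) (x : Fin 3),
        (target hX).Good (place (t, x)) s5 := by
      intro t x
      suffices H : (target hX).Good (place (t, x)) s4 by
        unfold Target.Good at H ⊢
        rwa [f5.nat_eq rfl, f5.nat_eq rfl, f5.real_eq rfl]
      rcases t with ⟨g, τ⟩ | ⟨k, τ⟩
      · exact h4'.1 _ (h3 g τ x)
      · exact h4'.2 k τ x
    refine Scaffold.toInstance_storedAt _ _ _ _ _ h5.2.1 h5.2.2.1 h5.2.2.2.1 ?_ ?_ h5.2.2.2.2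
    · intro t x
      have := good t x
      simp only [Target.Good, target, place_injective.extend_apply] at this
      exact this
    · intro e
      rw [← rhs_eq_rhsInt]
      exact h5.1 _
  · have hN := X.length_digits_le
    have hL := hX.levels_pos
    have hm := hX.size_pos
    have a1 : X.m ≤ X.m * X.levels := Nat.le_mul_of_pos_right _ hL
    have a2 : X.levels ≤ X.m * X.levels := Nat.le_mul_of_pos_left _ hm
    have a3 : X.d * X.levels ≤ X.m * X.levels := Nat.mul_le_mul_right _ hd
    have a4 : X.m * (60 * X.levels + 130) = 60 * (X.m * X.levels) + 130 * X.m := by ring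
    have a5 : X.d * X.levels * 10000 = 10000 * (X.d * X.levels) := by ring
    omega

/-! ### The decoding program -/

/-- Computes the product of the transposed matrix and the right-hand side in the array `11`, and its
norm over the stored entries in the register `12`. -/
def normalProg : Program :=
  .seq (.forTo 8 (.read 0 (.lit 2)) (.setReal 11 (.read 2 (.reg 8))
      (.add (.read 11 (.read 2 (.reg 8))) (.mul (.read 0 (.reg 8)) (.read 1 (.read 1 (.reg 8)))))))
    (.seq (.setReal 12 (.lit 0) (.ofNat (.lit 0)))
    (.forTo 8 (.read 0 (.lit 2)) (.setReal 12 (.lit 0) (.add (.reg 12)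
      (.mul (.read 11 (.read 2 (.reg 8))) (.read 11 (.read 2 (.reg 8))))))))

/-- Copies the values of the first triangles of the legs to the columns of the legs. The value of
the last leg of each column remains. -/
def copyProg : Program :=
  .forTo 8 (.reg 12) (.setReal 7 (.read 15 (.reg 8))
    (.read 6 (.add (.times gadgetsExpr 9) (.times (.reg 8) 13))))

/-- The program that reads off a solution. If the right-hand side is orthogonal to the image of the
matrix, then the solution is zero. -/
def decProg : Program :=
  .seq prepProg (.seq normalProg (.ite (.realLE (.reg 12) (.ofNat (.lit 0))) .skip copyProg))

variable (X) in
/-- The entries of the product of the transposed matrix and the right-hand side. -/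
def normalRhs (k j : ℕ) : ℤ :=
  ∑ i ∈ Finset.range k, if X.col i = j then X.val i * X.rhs (X.row i) else 0

include hX in
lemma normalProg_spec {s : RAMState} (h : X.Prepared s) (h11 : s.real 11 = fun _ => 0) :
    Reaches normalProg s (80 * X.m + 40) fun s' => s'.real 12 0 =
      ∑ k ∈ Finset.range X.m, (X.normalRhs X.m (X.col k) : ℝ) * X.normalRhs X.m (X.col k) := by
  refine (Reaches.seq (Reaches.forTo (T := 25) X.m (fun k s' =>
    ∀ j, s'.real 11 j = X.normalRhs k j) rfl ?_ ?_ ?_ ?_) fun s1 h1 f1 =>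
    Reaches.seq (Reaches.of_loopFree (Q := fun s' => s'.real 12 0 = 0) rfl ?_) fun s2 h2 f2 =>
    Reaches.forTo (T := 25) X.m (fun k s' => s'.real 12 0 =
      ∑ k ∈ Finset.range k, (X.normalRhs X.m (X.col k) : ℝ) * X.normalRhs X.m (X.col k))
      rfl ?_ ?_ ?_ ?_).mono ?_ fun _ h _ => h
  · exact fun s' hf => (h.frame hf).loaded.size
  · exact fun k s' v hR => hR
  · simp [h11, normalRhs]
  · intro k hk s' hR hc hf
    refine (Reaches.of_loopFree rfl ?_).mono (T := _) (by decide) fun _ h _ => h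
    have hl := (h.frame hf).loaded
    intro j
    simp only [Program.exec, RealExpr.eval, NatExpr.eval, NatExpr.eval_reg, hc,
      RAMState.setReal_real, if_true, Function.update_apply, hR, hl.col k hk, hl.val k hk,
      hl.row k hk, hl.rhs _ (hX.row_lt k hk)]
    have hsum : X.normalRhs (k + 1) j = X.normalRhs k j +
        if X.col k = j then X.val k * X.rhs (X.row k) else 0 := Finset.sum_range_succ _ _
    rw [hsum]
    by_cases hj : j = X.col k
    · rw [if_pos hj, if_pos hj.symm, hj]; push_cast; ring
    · rw [if_neg hj, if_neg (Ne.symm hj), add_zero]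
  · simp [Program.exec, RealExpr.eval, NatExpr.eval]
  · exact fun s' hf => (((h.frame f1).frame f2).frame hf).loaded.size
  · exact fun k s' v hR => hR
  · simpa using h2
  · intro k hk s' hR hc hf
    refine (Reaches.of_loopFree rfl ?_).mono (T := _) (by decide) fun _ h _ => h
    have hl := (((h.frame f1).frame f2).frame hf).loaded
    have h11' : s'.real 11 = s1.real 11 := (hf.real_eq rfl).trans (f2.real_eq rfl)
    simp only [Program.exec, RealExpr.eval, RealExpr.eval_reg, NatExpr.eval, NatExpr.eval_reg, hc,
      RAMState.setReal_real, if_true, Function.update_self, hR, hl.col k hk, h11', h1]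
    rw [Finset.sum_range_succ]
  · simp only [Program.maxCost, NatExpr.cost, RealExpr.cost]
    ring_nf
    omega

lemma copyProg_spec {s : RAMState} (h : X.Prepared s) :
    Reaches copyProg s (200 * X.digits.length + 20) fun s' => ∀ j,
      (∃ i < X.digits.length, X.digitCol i = j) → s'.real 7 j =
        s.real 6 (9 * (X.d * X.levels) + 13 * ringLast X.digitCol X.digits.length j) := by
  refine (Reaches.forTo (T := 180) X.digits.length (fun k s' => ∀ j,
      (∃ i < k, X.digitCol i = j) → s'.real 7 j =
        s.real 6 (9 * (X.d * X.levels) + 13 * lastIndex X.digitCol (fun _ => 0) k j))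
    rfl ?_ ?_ ?_ ?_).mono ?_ fun _ h _ => h
  · exact fun s' hf => (h.frame hf).listed.length
  · exact fun k s' v hR => hR
  · rintro j ⟨i, hi, -⟩
    omega
  · intro k hk s' hR hc hf
    refine (Reaches.of_loopFree rfl ?_).mono (T := _) (by decide) fun _ h _ => h
    have h' := h.frame hf
    have h6 : s'.real 6 = s.real 6 := hf.real_eq rfl
    rintro j ⟨i, hi, hij⟩
    simp only [Program.exec, RealExpr.eval, NatExpr.eval, NatExpr.eval_times, NatExpr.eval_reg, hc,
      RAMState.setReal_real, if_true, Function.update_apply, h'.col hk, h'.gadgetsExpr, h6,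
      lastIndex]
    split_ifs with hj
    · rfl
    · refine hR j ⟨i, ?_, hij⟩
      rcases Nat.lt_succ_iff_lt_or_eq.1 hi with hi | rfl
      · exact hi
      · exact absurd hij.symm hj
  · simp only [NatExpr.cost, NatExpr.reg]
    ring_nf
    omega

include hX in
/-- The decoding program returns zero if the right-hand side is orthogonal to the columns, and the
values of the solution on the last legs of the columns otherwise. -/
lemma decProg_spec {s : RAMState} (h : X.Loaded s) (hd : X.d ≤ X.m)
    (h11 : s.real 11 = fun _ => 0) (h7 : s.real 7 = fun _ => 0) :
    Reaches decProg s (100000 * (X.m * X.levels)) fun s' =>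
      ((∀ k < X.m, X.normalRhs X.m (X.col k) = 0) ∧ ∀ j, s'.real 7 j = 0) ∨
      ((∃ k < X.m, X.normalRhs X.m (X.col k) ≠ 0) ∧ ∀ j < X.n, s'.real 7 j =
        s.real 6 (9 * (X.d * X.levels) + 13 * ringLast X.digitCol X.digits.length j)) := by
  refine ((prepProg_spec h).seq fun s1 h1 f1 => (normalProg_spec hX h1
    (by rw [f1.real_eq rfl, h11])).seq fun s2 h2 f2 =>
    Reaches.ite (T := 200 * X.digits.length + 20) (fun hc => ?_) fun hc => ?_).mono ?_
    fun _ h _ => h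
  · refine (Reaches.of_loopFree (Q := fun s' => s' = s2) rfl rfl).mono
      (by simp [Program.maxCost]) ?_
    rintro _ rfl -
    left
    simp only [Test.Holds, RealExpr.eval, RealExpr.eval_reg, NatExpr.eval, Nat.cast_zero, h2] at hc
    refine ⟨fun k hk => ?_, fun j => ?_⟩
    · have hz := (Finset.sum_eq_zero_iff_of_nonneg (fun i _ => mul_self_nonneg _)).1
        (le_antisymm hc (Finset.sum_nonneg fun i _ => mul_self_nonneg _)) k (Finset.mem_range.2 hk)
      exact_mod_cast mul_self_eq_zero.1 hz
    · rw [f2.real_eq rfl, f1.real_eq rfl, h7]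
  · refine (copyProg_spec (h1.frame f2)).mono le_rfl fun s3 h3 _ => Or.inr ⟨?_, fun j hj => ?_⟩
    · simp only [Test.Holds, RealExpr.eval, RealExpr.eval_reg, NatExpr.eval, Nat.cast_zero, h2,
        not_le] at hc
      obtain ⟨k, hk, hne⟩ := Finset.exists_ne_zero_of_sum_ne_zero hc.ne'
      refine ⟨k, Finset.mem_range.1 hk, fun h0 => hne ?_⟩
      rw [h0]; simp
    · rw [h3 j (hX.exists_digitCol hj), f2.real_eq rfl, f1.real_eq rfl]
  · have hN := X.length_digits_le
    have hL := hX.levels_pos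
    have hm := hX.size_pos
    have a1 : X.m ≤ X.m * X.levels := Nat.le_mul_of_pos_right _ hL
    have a2 : X.levels ≤ X.m * X.levels := Nat.le_mul_of_pos_left _ hm
    have a4 : X.m * (60 * X.levels + 130) = 60 * (X.m * X.levels) + 130 * X.m := by ring
    simp only [Test.cost, RealExpr.cost, NatExpr.cost, RealExpr.reg]
    omega

end Sparse

/-! ### Problems in memory -/

namespace LEAInstance

variable (I : LEAInstance)

/-- The contents of the memory when the problem is loaded with its nonzero entries in the order
`pos`. -/
abbrev toSparse (pos : Fin I.nnz → Fin I.d × Fin I.n) : Sparse where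
  d := I.d
  n := I.n
  m := I.nnz
  row k := if h : k < I.nnz then (pos ⟨k, h⟩).1 else 0
  col k := if h : k < I.nnz then (pos ⟨k, h⟩).2 else 0
  val k := if h : k < I.nnz then I.A (pos ⟨k, h⟩).1 (pos ⟨k, h⟩).2 else 0
  rhs i := if h : i < I.d then I.b ⟨i, h⟩ else 0
  ε := I.ε

variable {I} {pos : Fin I.nnz → Fin I.d × Fin I.n}

lemma toSparse_rhs : (fun i : Fin I.d => (I.toSparse pos).rhs i) = I.b := by
  funext i; simp

/-- Sums over the stored entries are sums over all entries. -/
lemma sum_toSparse {M : Type*} [AddCommMonoid M]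
    (hpos : Set.BijOn pos Set.univ (I.support : Set (Fin I.d × Fin I.n)))
    (F : ℕ → ℕ → ℤ → M) (hF : ∀ i j, F i j 0 = 0) :
    ∑ k ∈ Finset.range I.nnz, F ((I.toSparse pos).row k) ((I.toSparse pos).col k)
      ((I.toSparse pos).val k) = ∑ i : Fin I.d, ∑ j : Fin I.n, F i j (I.A i j) := by
  rw [Finset.sum_range, ← Fintype.sum_prod_type']
  have h1 : ∑ p : Fin I.d × Fin I.n, F p.1 p.2 (I.A p.1 p.2) =
      ∑ p ∈ I.support, F p.1 p.2 (I.A p.1 p.2) := by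
    refine (Finset.sum_subset (Finset.subset_univ _) fun p _ hp => ?_).symm
    have : I.A p.1 p.2 = 0 := by simpa [support] using hp
    rw [this, hF]
  rw [h1]
  refine Finset.sum_bij (fun k _ => pos k) (fun k _ => hpos.1 trivial)
    (fun k _ k' _ h => hpos.2.1 trivial trivial h) (fun p hp => ?_) (fun k _ => by simp)
  obtain ⟨k, -, hk⟩ := hpos.2.2 hp
  exact ⟨k, Finset.mem_univ _, hk⟩

lemma loaded_toSparse {s : RAMState}
    (hd : s.nat 0 0 = I.d) (hn : s.nat 0 1 = I.n) (hm : s.nat 0 2 = I.nnz)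
    (hA : ∀ k : Fin I.nnz, s.nat 1 k = ((pos k).1 : ℕ) ∧ s.nat 2 k = ((pos k).2 : ℕ) ∧
      s.real 0 k = (I.A (pos k).1 (pos k).2 : ℝ))
    (hb : ∀ i : Fin I.d, s.real 1 i = (I.b i : ℝ)) (hε : s.real 2 0 = I.ε) :
    (I.toSparse pos).Loaded s where
  rows := hd
  cols := hn
  size := hm
  row k hk := by simpa [show k < I.nnz from hk] using (hA ⟨k, hk⟩).1
  col k hk := by simpa [show k < I.nnz from hk] using (hA ⟨k, hk⟩).2.1
  val k hk := by simpa [show k < I.nnz from hk] using (hA ⟨k, hk⟩).2.2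
  rhs i hi := by simpa [show i < I.d from hi] using hb ⟨i, hi⟩
  accuracy := hε

section General

variable (hG : generalMatrices I.d I.n I.A)

include hG

lemma nnz_pos : 0 < I.nnz := by
  obtain ⟨j, hj⟩ := hG.2.1 ⟨0, hG.1⟩
  exact Finset.card_pos.2 ⟨(⟨0, hG.1⟩, j), by simp [support, hj]⟩

lemma d_le_nnz : I.d ≤ I.nnz := by
  have : I.support.image Prod.fst = Finset.univ := by
    refine Finset.eq_univ_of_forall fun i => ?_
    obtain ⟨j, hj⟩ := hG.2.1 i
    exact Finset.mem_image.2 ⟨(i, j), by simp [support, hj], rfl⟩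
  have h := Finset.card_image_le (s := I.support) (f := Prod.fst)
  rw [this] at h
  simpa [nnz] using h

lemma one_le_entrySize : 1 ≤ I.entrySize := by
  obtain ⟨j, hj⟩ := hG.2.1 ⟨0, hG.1⟩
  refine le_max_of_le_left (le_trans ?_ (Finset.le_sup (Finset.mem_univ (⟨0, hG.1⟩, j))))
  simp only
  omega

lemma valid_toSparse (hpos : Set.BijOn pos Set.univ (I.support : Set (Fin I.d × Fin I.n))) :
    (I.toSparse pos).Valid where
  row_lt k hk := by simp [show k < I.nnz from hk]
  col_lt k hk := by simp [show k < I.nnz from hk]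
  val_ne k hk := by
    have : pos ⟨k, hk⟩ ∈ I.support := hpos.1 trivial
    simpa [show k < I.nnz from hk, support] using this
  exists_col j hj := by
    obtain ⟨i, hi⟩ := hG.2.2 ⟨j, hj⟩
    have hmem : ((i, ⟨j, hj⟩) : Fin I.d × Fin I.n) ∈
        (I.support : Set (Fin I.d × Fin I.n)) := by simp [support, hi]
    obtain ⟨k, -, hk⟩ := hpos.2.2 hmem
    exact ⟨k, k.2, by simp [hk]⟩
  size_pos := nnz_pos hG
  ε_pos := I.ε_pos

/-- A nonzero integer matrix has largest singular value at least 1. -/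
lemma one_le_sSup_singularValues :
    I.linMap ≠ 0 ∧ 1 ≤ sSup (Set.range I.linMap.singularValues) := by
  obtain ⟨j, hj⟩ := hG.2.1 ⟨0, hG.1⟩
  set e : EuclideanSpace ℝ (Fin I.n) := EuclideanSpace.single j 1 with he
  have h1 : 1 ≤ ‖I.linMap e‖ := by
    refine le_trans ?_ (EuclideanSpace.abs_apply_le_norm _ ⟨0, hG.1⟩)
    rw [linMap_apply, Finset.sum_eq_single j (by intro k _ hk; simp [he, hk]) (by simp)]
    simp only [he, PiLp.single_apply, if_true, mul_one]
    exact_mod_cast Int.one_le_abs hj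
  refine ⟨fun h => ?_, ?_⟩
  · rw [h] at h1
    simp at h1
    linarith
  · have := I.linMap.norm_apply_le_sSup e
    have hn : ‖e‖ = 1 := by simp [he]
    rw [hn, mul_one] at this
    exact h1.trans this

end General

section Encoding

variable (hX : (I.toSparse pos).Valid)
  (hpos : Set.BijOn pos Set.univ (I.support : Set (Fin I.d × Fin I.n)))

/-- The boundary problem models the original one. -/
noncomputable def model : Scaffold.Model (Sparse.scaffold hX) I.b (Sparse.boundaryInstance hX) where
  edge := Scaffold.edgeEquiv _ _ _
  tri := Scaffold.triEquiv _ _ _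
  linMap_apply := Scaffold.toInstance_linMap_apply _ _ _ _ _
  rhs_apply e := by
    rw [← toSparse_rhs (pos := pos)]
    exact Scaffold.toInstance_rhs_apply _ _ _ _ _ e

include hpos

lemma scaffold_toSparse_matrix : (Sparse.scaffold hX).matrix = I.A := by
  ext i j
  rw [Sparse.scaffold_matrix]
  have h := sum_toSparse hpos (fun i' j' z => if i' = (i : ℕ) ∧ j' = (j : ℕ) then z else 0)
    (by simp)
  refine h.trans ?_
  rw [Finset.sum_eq_single i, Finset.sum_eq_single j]
  · simp
  · intro j' _ hj'
    simp [Fin.val_inj, hj']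
  · simp
  · intro i' _ hi'
    simp [Fin.val_inj, hi']
  · simp

lemma normalRhs_toSparse (j : Fin I.n) : (I.toSparse pos).normalRhs I.nnz j =
    ∑ i, I.A i j * I.b i := by
  have h := sum_toSparse hpos
    (fun i' j' z => if j' = (j : ℕ) then z * (I.toSparse pos).rhs i' else 0)
    (by simp)
  refine h.trans (Finset.sum_congr rfl fun i _ => ?_)
  rw [Finset.sum_eq_single j]
  · simp
  · intro j' _ hj'
    simp [Fin.val_inj, hj']
  · simp

lemma bulk_toSparse : (I.toSparse pos).bulk =
    I.nnz + 1 / I.ε + ∑ i, ∑ j, (I.A i j : ℝ) ^ 2 + ∑ i, (I.b i : ℝ) ^ 2 := by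
  have h := sum_toSparse hpos (fun _ _ z => (z : ℝ) * z) (by simp)
  rw [Sparse.bulk, Finset.sum_range (n := I.d)]
  simp only [sq]
  rw [← h]
  simp

end Encoding

/-- The entries of the product of the transposed matrix and the right-hand side as inner
products. -/
lemma sum_mul_eq_inner (j : Fin I.n) : ((∑ i, I.A i j * I.b i : ℤ) : ℝ) =
    inner ℝ (I.linMap (EuclideanSpace.single j 1)) I.projRhs := by
  have h0 : inner ℝ (I.linMap (EuclideanSpace.single j 1)) (I.rhs - I.projRhs) = (0 : ℝ) :=
    (Submodule.mem_orthogonal _ _).1 I.rhs_sub_projRhs_mem _ ⟨_, rfl⟩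
  rw [inner_sub_right, sub_eq_zero] at h0
  rw [← h0, EuclideanSpace.inner_eq_sum]
  push_cast
  refine Finset.sum_congr rfl fun i _ => ?_
  rw [linMap_apply, Finset.sum_eq_single j (by intro k _ hk; simp [hk]) (by simp)]
  simp [rhs]

/-- If the right-hand side is orthogonal to the columns, then its projection vanishes. -/
lemma isSolution_zero (h : ∀ j, ∑ i, I.A i j * I.b i = 0) : I.IsSolution 0 := by
  have hp : I.projRhs = 0 := by
    refine (Submodule.starProjection_apply_eq_zero_iff _).2 ?_
    rw [Submodule.mem_orthogonal]
    rintro _ ⟨x, rfl⟩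
    rw [EuclideanSpace.inner_eq_sum]
    simp only [linMap_apply, Finset.sum_mul]
    rw [Finset.sum_comm]
    refine Finset.sum_eq_zero fun j _ => ?_
    have := congrArg (Int.cast (R := ℝ)) (h j)
    push_cast at this
    calc ∑ i, (I.A i j : ℝ) * x j * I.rhs i = x j * ∑ i, (I.A i j : ℝ) * I.b i := by
          rw [Finset.mul_sum]
          exact Finset.sum_congr rfl fun i _ => by simp [rhs]; ring
      _ = 0 := by rw [this, mul_zero]
  simp [IsSolution, hp]

end LEAInstance

/-! ### Accuracy of the recovered solution -/

namespace LEAInstance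

variable {I : LEAInstance} {pos : Fin I.nnz → Fin I.d × Fin I.n}

/-- If the projected right-hand side is nonzero, then it is not much shorter than the right-hand
side: its inner product with some column of the matrix is a nonzero integer. -/
lemma norm_rhs_le (hpos : Set.BijOn pos Set.univ (I.support : Set (Fin I.d × Fin I.n)))
    {j : Fin I.n} (hj : ∑ i, I.A i j * I.b i ≠ 0) :
    ‖I.rhs‖ ≤ (I.toSparse pos).bulk * ‖I.projRhs‖ := by
  set a := I.linMap (EuclideanSpace.single j 1) with ha
  have hε : 0 < 1 / I.ε := one_div_pos.2 I.ε_pos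
  have hA : ∑ i, (I.A i j : ℝ) ^ 2 ≤ ∑ i, ∑ j, (I.A i j : ℝ) ^ 2 :=
    Finset.sum_le_sum fun i _ => Finset.single_le_sum (f := fun j => (I.A i j : ℝ) ^ 2)
      (fun _ _ => sq_nonneg _) (Finset.mem_univ j)
  have hA0 : 0 ≤ ∑ i, (I.A i j : ℝ) ^ 2 := Finset.sum_nonneg fun _ _ => sq_nonneg _
  have hb0 : 0 ≤ ∑ i, (I.b i : ℝ) ^ 2 := Finset.sum_nonneg fun _ _ => sq_nonneg _
  have hm : (0 : ℝ) ≤ I.nnz := Nat.cast_nonneg _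
  have hW := bulk_toSparse hpos
  have ha2 : ‖a‖ ^ 2 = ∑ i, (I.A i j : ℝ) ^ 2 := by
    rw [EuclideanSpace.real_norm_sq_eq]
    refine Finset.sum_congr rfl fun i _ => ?_
    rw [ha, linMap_apply, Finset.sum_eq_single j (by intro k _ hk; simp [hk]) (by simp)]
    simp
  have hb2 : ‖I.rhs‖ ^ 2 = ∑ i, (I.b i : ℝ) ^ 2 := by
    rw [EuclideanSpace.real_norm_sq_eq]
    rfl
  have hab : ‖I.rhs‖ * ‖a‖ ≤ (I.toSparse pos).bulk := by
    nlinarith [two_mul_le_add_sq ‖I.rhs‖ ‖a‖]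
  have h1 : 1 ≤ ‖a‖ * ‖I.projRhs‖ := by
    refine le_trans ?_ (abs_real_inner_le_norm a I.projRhs)
    rw [← sum_mul_eq_inner j]
    exact_mod_cast Int.one_le_abs hj
  calc ‖I.rhs‖ ≤ ‖I.rhs‖ * (‖a‖ * ‖I.projRhs‖) := le_mul_of_one_le_right (norm_nonneg _) h1
    _ = ‖I.rhs‖ * ‖a‖ * ‖I.projRhs‖ := (mul_assoc _ _ _).symm
    _ ≤ _ := by gcongr

lemma nnz_le_bulk (I : LEAInstance) (pos : Fin I.nnz → Fin I.d × Fin I.n) :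
    (I.nnz : ℝ) ≤ (I.toSparse pos).bulk := by
  have h1 : 0 < 1 / I.ε := one_div_pos.2 I.ε_pos
  have h2 := Finset.sum_nonneg fun k (_ : k ∈ Finset.range (I.toSparse pos).m) =>
    mul_self_nonneg ((I.toSparse pos).val k : ℝ)
  have h3 := Finset.sum_nonneg fun k (_ : k ∈ Finset.range (I.toSparse pos).d) =>
    mul_self_nonneg ((I.toSparse pos).rhs k : ℝ)
  rw [Sparse.bulk]
  linarith

lemma inv_ε_le_bulk (I : LEAInstance) (pos : Fin I.nnz → Fin I.d × Fin I.n) :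
    1 / I.ε ≤ (I.toSparse pos).bulk := by
  have h1 : (0 : ℝ) ≤ I.nnz := Nat.cast_nonneg _
  have h2 := Finset.sum_nonneg fun k (_ : k ∈ Finset.range (I.toSparse pos).m) =>
    mul_self_nonneg ((I.toSparse pos).val k : ℝ)
  have h3 := Finset.sum_nonneg fun k (_ : k ∈ Finset.range (I.toSparse pos).d) =>
    mul_self_nonneg ((I.toSparse pos).rhs k : ℝ)
  rw [Sparse.bulk]
  linarith

/-- Solutions of the boundary problem restrict to solutions of the original problem, unless the
projected right-hand side of the latter vanishes. -/
lemma isSolution_of_boundaryInstance (hG : generalMatrices I.d I.n I.A)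
    (hpos : Set.BijOn pos Set.univ (I.support : Set (Fin I.d × Fin I.n)))
    (hX : (I.toSparse pos).Valid)
    {j : Fin I.n} (hj : ∑ i, I.A i j * I.b i ≠ 0)
    {y : EuclideanSpace ℝ (Fin (Sparse.boundaryInstance hX).n)}
    (hy : (Sparse.boundaryInstance hX).IsSolution y) :
    I.IsSolution (WithLp.toLp 2 fun j =>
      y ((model hX).tri (.inr ((Sparse.scaffold hX).rep j, 0)))) := by
  refine (Scaffold.Model.norm_linMap_sub_projRhs_le I (Sparse.scaffold hX)
    (scaffold_toSparse_matrix hX hpos) hX.levels_pos (model hX) y hy).trans ?_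
  set W := (I.toSparse pos).bulk with hW
  set K : ℝ := 2 ^ (I.toSparse pos).levels with hK
  set w : ℝ := ((Sparse.scaffold hX).weight : ℝ) with hw
  set N : ℝ := ((I.toSparse pos).digits.length : ℝ) with hN
  have hε2 : (Sparse.boundaryInstance hX).ε = 1 / (K * K) := rfl
  have hb := norm_rhs_le hpos hj
  have hW1 : 1 ≤ W := hX.one_le_bulk
  have hwW : w ≤ W := by
    rw [hw, Sparse.scaffold_weight]
    exact hX.sum_natAbs_le_bulk
  have hNW : N ≤ W := le_trans (Nat.cast_le.2 (Sparse.length_digits_le_weight hX)) hwW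
  have hdW : (I.d : ℝ) ≤ W :=
    le_trans (by exact_mod_cast d_le_nnz hG) (nnz_le_bulk I pos)
  have hεW : 1 ≤ I.ε * W := by
    have := mul_le_mul_of_nonneg_left (inv_ε_le_bulk I pos) I.ε_pos.le
    rwa [mul_one_div_cancel I.ε_pos.ne'] at this
  have hKW : 100 * W * W * W * W ≤ K := (I.toSparse pos).threshold_le
  have hK1 : 1 ≤ K := one_le_pow₀ (by norm_num)
  have hw0 : 0 ≤ w := Nat.cast_nonneg _
  have hN0 : 0 ≤ N := Nat.cast_nonneg _
  have hd0 : (0 : ℝ) ≤ I.d := Nat.cast_nonneg _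
  set p := ‖I.projRhs‖ with hp
  have hp0 : 0 ≤ p := norm_nonneg _
  have hKpos : 0 < K := by linarith
  have hε0 := I.ε_pos
  rw [hε2]
  have h1 : w * (19 * N) * (1 / K + 1 / (K * K)) + I.d * (4 * K) * (1 / (K * K)) ≤
      42 * W ^ 2 / K := by
    have e1 : 1 / (K * K) ≤ 1 / K := one_div_le_one_div_of_le hKpos (by nlinarith)
    have e2 : I.d * (4 * K) * (1 / (K * K)) = 4 * I.d / K := by field_simp
    rw [e2]
    calc w * (19 * N) * (1 / K + 1 / (K * K)) + 4 * I.d / K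
        ≤ W * (19 * W) * (1 / K + 1 / K) + 4 * (W * W) / K := by
          gcongr
          nlinarith
      _ = 42 * W ^ 2 / K := by ring
  calc _ ≤ 42 * W ^ 2 / K * (2 * (W * p)) := by gcongr
    _ = 84 * W ^ 3 * p / K := by ring
    _ ≤ I.ε * p := by
        rw [div_le_iff₀ hKpos]
        calc 84 * W ^ 3 * p ≤ 84 * W ^ 3 * p * (I.ε * W) :=
              le_mul_of_one_le_right (by positivity) hεW
          _ = I.ε * p * (84 * W * W * W * W) := by ring
          _ ≤ I.ε * p * K := by
              gcongr
              refine le_trans ?_ hKW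
              gcongr
              norm_num

/-! ### Size of the boundary problem -/

lemma cond_nonneg (I : LEAInstance) : 0 ≤ I.cond :=
  div_nonneg (Real.sSup_nonneg (by rintro _ ⟨k, rfl⟩; exact LinearMap.singularValues_nonneg _ _))
    (Real.sInf_nonneg (by rintro _ ⟨-, k, rfl⟩; exact LinearMap.singularValues_nonneg _ _))

/-- The quantities on which the size of the boundary problem depends are at most powers of the
parameter of the original problem. -/
structure ParamBounds (I : LEAInstance) (P : ℝ) : Prop where
  three_le : 3 ≤ P
  nnz_le : I.nnz ≤ P
  inv_le : I.ε⁻¹ ≤ P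
  cond_le : I.cond ≤ P
  entrySize_le : I.entrySize ≤ P

lemma paramBounds (hG : generalMatrices I.d I.n I.A) : ParamBounds I I.param := by
  have h1 : (1 : ℝ) ≤ I.nnz := by exact_mod_cast nnz_pos hG
  have h2 : 1 ≤ I.ε⁻¹ := (one_le_inv₀ I.ε_pos).2 I.ε_le_one
  have h3 := I.cond_nonneg
  have h4 : (1 : ℝ) ≤ I.entrySize := by exact_mod_cast one_le_entrySize hG
  constructor <;> rw [param] <;> linarith

lemma natAbs_A_le (I : LEAInstance) (i : Fin I.d) (j : Fin I.n) :
    (I.A i j).natAbs ≤ I.entrySize :=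
  le_max_of_le_left (Finset.le_sup (f := fun p : Fin I.d × Fin I.n => (I.A p.1 p.2).natAbs)
    (Finset.mem_univ (i, j)))

lemma natAbs_b_le (I : LEAInstance) (i : Fin I.d) : (I.b i).natAbs ≤ I.entrySize :=
  le_max_of_le_right (Finset.le_sup (f := fun i => (I.b i).natAbs) (Finset.mem_univ i))

lemma cast_mul_self_le {z : ℤ} {B : ℕ} {P : ℝ} (h : z.natAbs ≤ B) (hP : (B : ℝ) ≤ P) :
    (z : ℝ) * z ≤ P * P := by
  have h1 : |(z : ℝ)| ≤ P := by
    rw [← Int.cast_abs, Int.abs_eq_natAbs]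
    exact le_trans (by exact_mod_cast h) hP
  rw [← abs_mul_abs_self (z : ℝ)]
  exact mul_self_le_mul_self (abs_nonneg _) h1

lemma ParamBounds.bulk_le {P : ℝ} (h : ParamBounds I P) (hd : I.d ≤ I.nnz) :
    (I.toSparse pos).bulk ≤ P ^ 4 := by
  have h1 : ∑ k ∈ Finset.range (I.toSparse pos).m,
      ((I.toSparse pos).val k : ℝ) * (I.toSparse pos).val k ≤ P * (P * P) := by
    refine (Finset.sum_le_card_nsmul _ _ (P * P) fun k hk => ?_).trans ?_
    · rw [Finset.mem_range] at hk
      simp only [show k < I.nnz from hk, dif_pos]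
      exact cast_mul_self_le (I.natAbs_A_le _ _) h.entrySize_le
    · rw [Finset.card_range, nsmul_eq_mul]
      exact mul_le_mul_of_nonneg_right h.nnz_le (mul_self_nonneg P)
  have h2 : ∑ k ∈ Finset.range (I.toSparse pos).d,
      ((I.toSparse pos).rhs k : ℝ) * (I.toSparse pos).rhs k ≤ P * (P * P) := by
    refine (Finset.sum_le_card_nsmul _ _ (P * P) fun k hk => ?_).trans ?_
    · rw [Finset.mem_range] at hk
      simp only [show k < I.d from hk, dif_pos]
      exact cast_mul_self_le (I.natAbs_b_le _) h.entrySize_le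
    · rw [Finset.card_range, nsmul_eq_mul]
      exact mul_le_mul_of_nonneg_right (le_trans (by exact_mod_cast hd) h.nnz_le)
        (mul_self_nonneg P)
  have h3 := h.three_le
  have h4 : 1 / I.ε ≤ P := by rw [one_div]; exact h.inv_le
  have h5 := h.nnz_le
  rw [Sparse.bulk]
  calc _ ≤ P + P + P * (P * P) + P * (P * P) := by gcongr
    _ ≤ 3 * P ^ 3 := by nlinarith [sq_nonneg P]
    _ ≤ P * P ^ 3 := by gcongr
    _ = P ^ 4 := by ring

lemma ParamBounds.two_pow_levels_le {P : ℝ} (h : ParamBounds I P) (hd : I.d ≤ I.nnz)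
    (hX : (I.toSparse pos).Valid) : (2 : ℝ) ^ (I.toSparse pos).levels ≤ P ^ 21 := by
  have h1 := (I.toSparse pos).lt_threshold (Nat.sub_lt hX.levels_pos one_pos)
  have h2 := h.bulk_le (pos := pos) hd
  have h3 := h.three_le
  have h0 : 0 ≤ (I.toSparse pos).bulk := zero_le_one.trans hX.one_le_bulk
  calc (2 : ℝ) ^ (I.toSparse pos).levels = 2 ^ ((I.toSparse pos).levels - 1) * 2 := by
        rw [← pow_succ, Nat.sub_add_cancel hX.levels_pos]
    _ ≤ (100 * P ^ 4 * P ^ 4 * P ^ 4 * P ^ 4) * 2 := by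
        gcongr
        refine h1.le.trans ?_
        rw [Sparse.threshold]
        gcongr
    _ = 200 * P ^ 16 := by ring
    _ ≤ P ^ 5 * P ^ 16 := by
        gcongr
        exact le_trans (by norm_num) (pow_le_pow_left₀ (by norm_num) h3 5)
    _ = P ^ 21 := by ring

lemma ParamBounds.levels_le {P : ℝ} (h : ParamBounds I P) (hd : I.d ≤ I.nnz)
    (hX : (I.toSparse pos).Valid) : ((I.toSparse pos).levels : ℝ) ≤ 31 * Real.log P := by
  have h1 := Real.log_le_log (by positivity) (h.two_pow_levels_le hd hX)
  rw [Real.log_pow, Real.log_pow] at h1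
  have h2 := Real.log_two_gt_d9
  have h3 : (0 : ℝ) ≤ (I.toSparse pos).levels := Nat.cast_nonneg _
  push_cast at h1
  nlinarith

lemma ParamBounds.one_le_log {P : ℝ} (h : ParamBounds I P) : 1 ≤ Real.log P := by
  rw [Real.le_log_iff_exp_le (by linarith [h.three_le])]
  exact le_trans Real.exp_one_lt_d9.le (le_trans (by norm_num) h.three_le)

lemma numTris_le (hd : I.d ≤ I.nnz) :
    Scaffold.numTris I.d (I.toSparse pos).levels (I.toSparse pos).digits.length ≤
      22 * (I.nnz * (I.toSparse pos).levels) := by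
  have h1 : (I.toSparse pos).digits.length ≤ I.nnz * (I.toSparse pos).levels :=
    (I.toSparse pos).length_digits_le
  have h2 := Nat.mul_le_mul_right (I.toSparse pos).levels hd
  rw [Scaffold.numTris]
  nlinarith

lemma ParamBounds.numTris_le {P : ℝ} (h : ParamBounds I P) (hd : I.d ≤ I.nnz)
    (hX : (I.toSparse pos).Valid) : (Scaffold.numTris I.d (I.toSparse pos).levels
      (I.toSparse pos).digits.length : ℝ) ≤ P ^ 25 := by
  have h1 : ((I.toSparse pos).levels : ℝ) ≤ P ^ 21 :=
    le_trans (by exact_mod_cast Nat.lt_two_pow_self.le) (h.two_pow_levels_le hd hX)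
  have h3 := h.three_le
  have h4 := h.nnz_le
  calc (Scaffold.numTris I.d (I.toSparse pos).levels (I.toSparse pos).digits.length : ℝ)
      ≤ 22 * (I.nnz * (I.toSparse pos).levels) := by
        exact_mod_cast LEAInstance.numTris_le (pos := pos) hd
    _ ≤ P ^ 3 * (P * P ^ 21) := by
        gcongr
        exact le_trans (by norm_num) (pow_le_pow_left₀ (by norm_num) h3 3)
    _ = P ^ 25 := by ring

/-- The condition number of the boundary problem is bounded by a power of the parameter. -/
lemma ParamBounds.cond_boundaryInstance_le {P : ℝ} (h : ParamBounds I P)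
    (hG : generalMatrices I.d I.n I.A)
    (hpos : Set.BijOn pos Set.univ (I.support : Set (Fin I.d × Fin I.n)))
    (hX : (I.toSparse pos).Valid) : (Sparse.boundaryInstance hX).cond ≤ P ^ 110 := by
  obtain ⟨hne, hσ⟩ := one_le_sSup_singularValues hG
  have hd := d_le_nnz hG
  refine ((model hX).cond_le (scaffold_toSparse_matrix hX hpos) hX.levels_pos hX.digits_pos
    hne hσ).trans ?_
  rw [(model hX).numTris_eq]
  have h3 := h.three_le
  have hT : (Scaffold.numTris (I.toSparse pos).d (I.toSparse pos).levels
      (I.toSparse pos).digits.length : ℝ) ≤ P ^ 25 := h.numTris_le hd hX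
  have hK := h.two_pow_levels_le hd hX
  have hw : ((Sparse.scaffold hX).weight : ℝ) ≤ P ^ 4 := by
    rw [Sparse.scaffold_weight]
    exact hX.sum_natAbs_le_bulk.trans (h.bulk_le hd)
  have hN : ((I.toSparse pos).digits.length : ℝ) ≤ P ^ 4 :=
    le_trans (by exact_mod_cast Sparse.length_digits_le_weight hX) hw
  have hdP : (I.d : ℝ) ≤ P := le_trans (by exact_mod_cast hd) h.nnz_le
  have hc := h.cond_le
  have hc0 := I.cond_nonneg
  set w := ((Sparse.scaffold hX).weight : ℝ)
  set N := ((I.toSparse pos).digits.length : ℝ)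
  have hP1 : 1 ≤ P := by linarith
  -- every power of `P` below absorbs numerical factors, since `3 ≤ P`
  have e1 : I.d * (4 * 2 ^ (I.toSparse pos).levels) + w * (19 * N) ≤ P ^ 25 := by
    calc _ ≤ P * (4 * P ^ 21) + P ^ 4 * (19 * P ^ 4) := by gcongr
      _ = 4 * P ^ 22 + 19 * P ^ 8 := by ring
      _ ≤ 4 * P ^ 22 + 19 * P ^ 22 := by
        gcongr
        norm_num
      _ = 23 * P ^ 22 := by ring
      _ ≤ P ^ 3 * P ^ 22 := by
        gcongr
        exact le_trans (by norm_num) (pow_le_pow_left₀ (by norm_num) h3 3)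
      _ = P ^ 25 := by ring
  have e2 : 9 + (N + 1) * (I.cond * (I.d * (4 * 2 ^ (I.toSparse pos).levels) + w * (19 * N)) +
      19 * N) ≤ P ^ 36 := by
    have q0 : (1 : ℝ) ≤ P ^ 4 := one_le_pow₀ hP1
    have q1 : P ^ 4 ≤ P ^ 26 := pow_le_pow_right₀ hP1 (by norm_num)
    have q2 : (1 : ℝ) ≤ P ^ 30 := one_le_pow₀ hP1
    calc _ ≤ 9 + (P ^ 4 + P ^ 4) * (P * P ^ 25 + 19 * P ^ 26) := by
            have : 19 * N ≤ 19 * P ^ 26 := by linarith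
            gcongr
      _ = 9 * 1 + 40 * P ^ 30 := by ring
      _ ≤ 9 * P ^ 30 + 40 * P ^ 30 := by gcongr
      _ = 49 * P ^ 30 := by ring
      _ ≤ P ^ 6 * P ^ 30 := by
        gcongr
        exact le_trans (by norm_num) (pow_le_pow_left₀ (by norm_num) h3 6)
      _ = P ^ 36 := by ring
  calc _ ≤ P * P ^ 25 * (P ^ 25 * (P ^ 21 * P ^ 36)) := by gcongr
    _ = P ^ 108 := by ring
    _ ≤ P ^ 110 := pow_le_pow_right₀ hP1 (by norm_num)

end LEAInstance

/-! ### The reduction -/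

namespace LEAInstance

variable {I : LEAInstance} {pos : Fin I.nnz → Fin I.d × Fin I.n}

/-- Given a solution of the boundary problem, the decoding program computes a solution of the
original problem. -/
lemma reaches_decProg (hG : generalMatrices I.d I.n I.A)
    (hpos : Set.BijOn pos Set.univ (I.support : Set (Fin I.d × Fin I.n)))
    (hX : (I.toSparse pos).Valid) {s : RAMState} (hs : (I.toSparse pos).Loaded s)
    (h7 : s.real 7 = fun _ => 0) (h11 : s.real 11 = fun _ => 0)
    {y : EuclideanSpace ℝ (Fin (Sparse.boundaryInstance hX).n)}
    (hy : (Sparse.boundaryInstance hX).IsSolution y) :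
    Reaches Sparse.decProg (s.loadVector 6 y) (100000 * (I.nnz * (I.toSparse pos).levels))
      fun s' => ∃ x : EuclideanSpace ℝ (Fin I.n), (∀ j : Fin I.n, s'.real 7 j = x j) ∧
        I.IsSolution x := by
  have hreal : ∀ a ≠ 6, (s.loadVector 6 y).real a = s.real a := fun a ha =>
    Function.update_of_ne ha _ _
  have hl : (I.toSparse pos).Loaded (s.loadVector 6 y) :=
    { rows := hs.rows, cols := hs.cols, size := hs.size, row := hs.row, col := hs.col
      val := by rw [hreal 0 (by norm_num)]; exact hs.val
      rhs := by rw [hreal 1 (by norm_num)]; exact hs.rhs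
      accuracy := by rw [hreal 2 (by norm_num)]; exact hs.accuracy }
  refine (Sparse.decProg_spec hX hl (d_le_nnz hG) (by rw [hreal 11 (by norm_num), h11])
    (by rw [hreal 7 (by norm_num), h7])).mono le_rfl ?_
  rintro s' (⟨h0, hz⟩ | ⟨⟨k, hk, hk0⟩, hz⟩) _
  · refine ⟨0, fun j => by simp [hz], isSolution_zero fun j => ?_⟩
    obtain ⟨k, hk, hkj⟩ := hX.exists_col j j.2
    rw [← normalRhs_toSparse hpos, ← hkj]
    exact h0 k hk
  · refine ⟨_, fun j => ?_, isSolution_of_boundaryInstance hG hpos hX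
      (j := ⟨(I.toSparse pos).col k, hX.col_lt k hk⟩) ?_ hy⟩
    · rw [hz j j.2]
      have h6 : (s.loadVector 6 y).real 6 = fun k =>
        if h : k < (Sparse.boundaryInstance hX).n then y ⟨k, h⟩ else 0 := by
        simp [RAMState.loadVector]
      have hi : 9 * (I.d * (I.toSparse pos).levels) +
          13 * ringLast (I.toSparse pos).digitCol (I.toSparse pos).digits.length j =
          ((model hX).tri (.inr ((Sparse.scaffold hX).rep j, 0)) : ℕ) := by
        refine Eq.trans ?_ (Scaffold.triEquiv_leg _ _).symm
        simp only [Sparse.scaffold, Fin.val_zero]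
        ring
      rw [h6]
      simp only [hi, Fin.is_lt, dif_pos]
    · rw [← normalRhs_toSparse hpos]
      exact hk0

end LEAInstance

theorem mainTheorem1 : SparseLinearEquationComplete boundaryMatrices := by
  -- `C` is kept opaque, since it is an exponent
  obtain ⟨C, hC⟩ : ∃ C, C = 4000000 := ⟨_, rfl⟩
  refine ⟨Sparse.encProg, Sparse.decProg, C, fun I hG s hs => ?_⟩
  obtain ⟨⟨hd, hn, hm, ⟨pos, hpos, hA⟩, hb, hε⟩, hnat, hreal⟩ := hs
  have hX := LEAInstance.valid_toSparse hG hpos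
  have hl : (I.toSparse pos).Loaded s := LEAInstance.loaded_toSparse hd hn hm hA hb hε
  have hn0 : ∀ a, 3 ≤ a → s.nat a = fun _ => 0 := fun a ha =>
    funext fun k => hnat a k (.inr (.inr ha))
  have hr0 : ∀ a, 3 ≤ a → s.real a = fun _ => 0 := fun a ha =>
    funext fun k => hreal a k (.inr (.inr (.inr ha)))
  have hB := LEAInstance.paramBounds hG
  have hdm := LEAInstance.d_le_nnz hG
  have hlev := hB.levels_le hdm hX
  have hlog := hB.one_le_log
  have hP1 : 1 ≤ I.param := by linarith [hB.three_le]
  have hpow : ∀ {k : ℕ}, k ≤ 110 → I.param ^ k ≤ I.param ^ C := fun hk =>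
    pow_le_pow_right₀ hP1 (by omega)
  -- quasilinear quantities
  have hlin : ∀ {t c : ℕ}, t ≤ c * (I.nnz * (I.toSparse pos).levels) → c ≤ 100000 →
      (t : ℝ) ≤ C * I.nnz * Real.log I.param ^ C := by
    intro t c ht hc
    have hc' : (c : ℝ) ≤ 100000 := by exact_mod_cast hc
    calc (t : ℝ) ≤ c * (I.nnz * (I.toSparse pos).levels) := by exact_mod_cast ht
      _ ≤ 100000 * (I.nnz * (31 * Real.log I.param)) := by gcongr
      _ = 3100000 * I.nnz * Real.log I.param := by ring
      _ ≤ C * I.nnz * Real.log I.param ^ C := by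
          gcongr
          · rw [hC]; norm_num
          · exact le_self_pow₀ hlog (by omega)
  refine ⟨Sparse.boundaryInstance hX, Scaffold.toInstance_mem _ _ _ _ _ hX.digits_pos, ?_, ?_,
    ?_, ?_, ?_, ?_⟩
  · obtain ⟨s', t, hr, ht, hJ⟩ :=
      Sparse.encProg_spec hX hl hdm (hn0 16 (by norm_num)) (hr0 4 (by norm_num))
    exact ⟨s', t, hr, hJ, hlin ht le_rfl⟩
  · intro y hy
    obtain ⟨s', t, hr, ht, x, hx, hsol⟩ := LEAInstance.reaches_decProg hG hpos hX hl
      (hr0 7 (by norm_num)) (hr0 11 (by norm_num)) hy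
    exact ⟨s', t, x, hr, hx, hsol, hlin ht le_rfl⟩
  · refine hlin (c := 66) ?_ (by norm_num)
    rw [Scaffold.toInstance_nnz]
    have := LEAInstance.numTris_le (pos := pos) hdm
    refine (Nat.mul_le_mul_right 3 this).trans (le_of_eq ?_)
    ring
  · have hε2 : (Sparse.boundaryInstance hX).ε⁻¹ =
        2 ^ (I.toSparse pos).levels * 2 ^ (I.toSparse pos).levels := by
      simp [Sparse.accuracy]
    have hK := hB.two_pow_levels_le hdm hX
    rw [hε2]
    calc _ ≤ I.param ^ 21 * I.param ^ 21 := by gcongr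
      _ = I.param ^ 42 := by ring
      _ ≤ _ := hpow (by norm_num)
  · exact (hB.cond_boundaryInstance_le hG hpos hX).trans (hpow le_rfl)
  · refine le_trans ?_ (hpow (k := 1) (by norm_num))
    rw [pow_one]
    refine le_trans ?_ hB.entrySize_le
    exact_mod_cast Scaffold.toInstance_entrySize_le _ _ _ _ _ (LEAInstance.one_le_entrySize hG)
      fun i => by simpa using I.natAbs_b_le i
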